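/- Graphs are finite and simple. Let $\mathbb K$ be a field, let $G$ be a graph with vertex set $V$, and let $d\in\mathbb Z_{\ge 2}^{V}$. For $F\subseteq V$ put $D_F=\prod_{v\in F}\{1,\dots,d_v\}$, and for $i\in D_V$ let $i_F\in D_F$ be its restriction. Regard $G$ as a simplicial complex whose faces are the empty set, the vertices and the edges. The toric ideal $I_{G,d}$ is the kernel of the $\mathbb K$-algebra homomorphism $$\mathbb K[p_i : i\in D_V]\to\mathbb K[a^F_j : F \text{ a facet of } G,\ j\in D_F],\qquad p_i\mapsto\prod_{F\text{ facet of }G}a^F_{i_F},$$ and the Markov width $\mu(G,d)$ is the largest degree of an element of a minimal set of homogeneous generators of $I_{G,d}$ (it is $0$ if $I_{G,d}=0$). The graph $G$ is \emph{Markov slim} if for every independent set $I$ of $G$ and every $d$ with $d_v\ge 2$ for $v\in I$ and $d_v=2$ for $v\in V\setminus I$ one has $\mu(G,d)\le 4$. The graph $G$ is \emph{outerplanar} if it can be embedded in a closed disc, with vertices as distinct points and edges as simple arcs that meet only in common end vertices, such that all vertices lie on the boundary circle. A class of graphs is \emph{minor-closed} if it contains every graph isomorphic to a minor of one of its members. \textbf{Theorem.}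 The class of outerplanar graphs is the largest minor-closed class of Markov slim graphs: it is minor-closed, all its members are Markov slim, and every minor-closed class all of whose members are Markov slim is contained in it. -/

import Mathlib

universe u v

namespace MarkovSlim

noncomputable section

/-! ### Hierarchical models -/

/-- The toric homomorphism of the hierarchical model of a simplicial complex `Γ` on the vertex
set `V` (a family of finite sets closed under taking subsets, the empty face included) with `d v`
levels at the vertex `v`: the variable `p_i`, `i ∈ ∏_{v ∈ V} [d v]`, is sent to the product over
the facets `F` of `Γ` of the parameters `a^F_{i_F}`, where `i_F` is the restriction of `i`. -/
def toricHom (K : Type v) [Field K] {V : Type u} (Γ : LowerSet (Finset V)) (d : V → ℕ) :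
    MvPolynomial ((w : V) → Fin (d w)) K →ₐ[K]
      MvPolynomial
        (Σ F : {F : Finset V // Maximal (fun A : Finset V => A ∈ Γ) F},
          ((w : {x : V // x ∈ F.1}) → Fin (d w.1))) K :=
  MvPolynomial.aeval fun i =>
    ∏ᶠ F : {F : Finset V // Maximal (fun A : Finset V => A ∈ Γ) F},
      MvPolynomial.X ⟨F, fun w => i w.1⟩

/-- The toric ideal of the hierarchical model of `(Γ, d)`. -/
def toricIdeal (K : Type v) [Field K] {V : Type u} (Γ : LowerSet (Finset V)) (d : V → ℕ) :
    Ideal (MvPolynomial ((w : V) → Fin (d w)) K) :=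
  RingHom.ker (toricHom K Γ d)

/-- A graph as a simplicial complex of dimension at most one: the faces are the empty set, the
vertices and the edges. -/
def graphComplex {V : Type u} (G : SimpleGraph V) : LowerSet (Finset V) where
  carrier := {F | F.card ≤ 2 ∧ G.IsClique (F : Set V)}
  lower' := fun _ _ hBA hA =>
    ⟨(Finset.card_le_card hBA).trans hA.1, hA.2.subset (Finset.coe_subset.2 hBA)⟩

/-- `S` is a set of homogeneous generators of the ideal `I`. -/
def IsHomogeneousGenerating {K : Type v} [Field K] {σ : Type u} (I : Ideal (MvPolynomial σ K))
    (S : Set (MvPolynomial σ K)) : Prop :=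
  (∀ f ∈ S, ∃ n : ℕ, f.IsHomogeneous n) ∧ Ideal.span S = I

/-- `μ(I)`: the largest degree of an element of an inclusion-minimal set of homogeneous
generators of the homogeneous ideal `I` (`0` for the zero ideal). -/
def maxGeneratorDegree {K : Type v} [Field K] {σ : Type u} (I : Ideal (MvPolynomial σ K)) : ℕ∞ :=
  ⨆ (S : Set (MvPolynomial σ K)) (_ : Minimal (IsHomogeneousGenerating I) S) (f ∈ S),
    (f.totalDegree : ℕ∞)

/-- The Markov width `μ(G, d)` of the graph model of `G` with levels `d`. -/
def markovWidth (K : Type v) [Field K] {V : Type u} (G : SimpleGraph V) (d : V → ℕ) : ℕ∞ :=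
  maxGeneratorDegree (toricIdeal K (graphComplex G) d)

/-- A graph is Markov slim if, for every independent set `I`, all models with at least two levels
at the vertices in `I` and exactly two levels at all the others have Markov width at most four. -/
def IsMarkovSlim (K : Type v) [Field K] {V : Type u} (G : SimpleGraph V) : Prop :=
  ∀ I : Set V, G.IsIndepSet I →
    ∀ d : V → ℕ, (∀ w ∈ I, 2 ≤ d w) → (∀ w ∉ I, d w = 2) → markovWidth K G d ≤ 4

/-! ### Outerplanar graphs -/

/-- An embedding of a graph in the closed unit disc of the plane with all vertices on the unit
circle: vertices are distinct points of the circle, each edge is a simple arc in the disc between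
its two ends, an arc contains no other vertex, and two arcs meet at most in a common end. -/
structure OuterplanarEmbedding {V : Type u} (G : SimpleGraph V) where
  /-- The positions of the vertices. -/
  pos : V → ℂ
  /-- The arcs that represent the edges. -/
  arc : G.edgeSet → C(unitInterval, ℂ)
  pos_injective : Function.Injective pos
  pos_mem_circle : ∀ w : V, pos w ∈ Metric.sphere (0 : ℂ) 1
  arc_injective : ∀ e : G.edgeSet, Function.Injective (arc e)
  arc_mem_disc : ∀ (e : G.edgeSet) (t : unitInterval), arc e t ∈ Metric.closedBall (0 : ℂ) 1
  arc_ends : ∀ e : G.edgeSet, s(arc e 0, arc e 1) = Sym2.map pos e.1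
  arc_vertex : ∀ (e : G.edgeSet) (w : V), pos w ∈ Set.range (arc e) → w ∈ e.1
  arc_inter : ∀ e e' : G.edgeSet, e ≠ e' →
    ∀ z ∈ Set.range (arc e) ∩ Set.range (arc e'), ∃ w : V, w ∈ e.1 ∧ w ∈ e'.1 ∧ z = pos w

/-- A graph is outerplanar if it has a planar embedding with all vertices on a circle and all
edges in the disc that the circle bounds. -/
def IsOuterplanar {V : Type u} (G : SimpleGraph V) : Prop :=
  Nonempty (OuterplanarEmbedding G)

/-! ### Minors and classes of finite graphs -/

/-- `H` is (isomorphic to) a minor of `G`: there are pairwise disjoint, connected, non-empty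
branch sets in `G`, one for each vertex of `H`, with an edge of `G` between the branch sets of any
two adjacent vertices of `H`. -/
def IsMinor {W V : Type u} (H : SimpleGraph W) (G : SimpleGraph V) : Prop :=
  ∃ B : W → Set V,
    (∀ x : W, (G.induce (B x)).Connected) ∧
    (∀ x y : W, x ≠ y → Disjoint (B x) (B y)) ∧
    (∀ x y : W, H.Adj x y → ∃ a ∈ B x, ∃ b ∈ B y, G.Adj a b)

/-- A finite simple graph. -/
structure FinGraph where
  /-- The vertex set. -/
  V : Type u
  finite_V : Finite V
  /-- The adjacency structure. -/
  graph : SimpleGraph V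

/-- A class of finite graphs is minor-closed if it contains every graph that is isomorphic to a
minor of one of its members. -/
def MinorClosed (𝒞 : Set FinGraph.{u}) : Prop :=
  ∀ G H : FinGraph.{u}, IsMinor H.graph G.graph → G ∈ 𝒞 → H ∈ 𝒞

end

end MarkovSlim

namespace MarkovSlim

/-!
A graph is outerplanar if and only if its vertices have a linear order without crossing edges
`a c`, `b d` with `a < b < c < d`. In one direction the chords of such an order on a circle form an
embedding, in the other one two arcs in the disc whose ends alternate on the circle must meet.
A minor of the graph inherits a noncrossing order from one representative of each branch set.

The toric ideal is generated in degree `k` if and only if any two contingency tables with the same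
margins on the edges are joined by moves of at most `k` observations. For a graph with a noncrossing
order this is shown for `k = 4` by induction. A vertex of degree at most one can be removed, and a
chord with vertices on both sides cuts the model into a fibre product along a face. Otherwise the
first vertex `v` has exactly two neighbours `a` and `b`, both binary if `v` is chosen in the
independent set, and without the edge `a b` both the path `a v b` and the rest are forests. The
tables on the two parts with a prescribed `a b` margin are joined by moves of degree four (for the
triangle on `v`, `a`, `b` this is the model of no three-way interaction), and since `a` and `b` are
binary, the `a b` margin is governed by a single entry, which quadratic moves of the two forests
change in steps of one and hence can change simultaneously.

Conversely, for `K₄` with binary vertices and for `K₂,₃` with three levels on the side of two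
vertices there are tables with six observations and only one other table with the same margins,
which has no observation in common with them. A minor-closed class of Markov slim graphs therefore
excludes both graphs as minors. A graph without these minors has a noncrossing order, by induction
on the vertex set: if `s` and `t` are adjacent or linked outside the set, either a cut vertex
between them leads to an order from `s` to `t`, or Menger's theorem gives two disjoint connections
between them. If these together with the edge or link yield no minor, they lie in different
components of the complement of `s` and `t`, whose orders are glued along the two arcs of the
circle.
-/

/-! ### Congruences of multisets and their moves -/

section Moves

variable {X Y Z S : Type*} {c : AddCon (Multiset X)} {k l : ℕ} {T U : Multiset X}

/-- One step of a Markov basis: `U` arises from `T` by exchanging a submultiset of at most `k`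
elements for a congruent one. -/
def Move (c : AddCon (Multiset X)) (k : ℕ) (T U : Multiset X) : Prop :=
  ∃ A B C : Multiset X, A.card ≤ k ∧ B.card ≤ k ∧ c A B ∧ T = A + C ∧ U = B + C

/-- Connectedness by moves of at most `k` elements, that is, in the fibre graph of the Markov basis
of all binomials of degree at most `k`. -/
def Linked (c : AddCon (Multiset X)) (k : ℕ) : Multiset X → Multiset X → Prop :=
  Relation.ReflTransGen (Move c k)

/-- The congruence `c` is generated by its pairs of multisets with at most `k` elements; for the
congruence of a toric ideal this says that the binomials of degree at most `k` generate the ideal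
(`span_shortBinomials_eq_ker`). -/
def IsGeneratedInDegree (c : AddCon (Multiset X)) (k : ℕ) : Prop :=
  ∀ ⦃T U⦄, c T U → Linked c k T U

lemma Move.rel (h : Move c k T U) : c T U := by
  obtain ⟨A, B, C, -, -, hAB, rfl, rfl⟩ := h
  exact c.add hAB (c.refl C)

lemma Move.symm (h : Move c k T U) : Move c k U T := by
  obtain ⟨A, B, C, hA, hB, hAB, rfl, rfl⟩ := h
  exact ⟨B, A, C, hB, hA, c.symm hAB, rfl, rfl⟩

lemma Move.add_right (D : Multiset X) (h : Move c k T U) : Move c k (T + D) (U + D) := by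
  obtain ⟨A, B, C, hA, hB, hAB, rfl, rfl⟩ := h
  exact ⟨A, B, C + D, hA, hB, hAB, add_assoc .., add_assoc ..⟩

lemma Move.mono {d : AddCon (Multiset X)} (hkl : k ≤ l) (hcd : c ≤ d) (h : Move c k T U) :
    Move d l T U := by
  obtain ⟨A, B, C, hA, hB, hAB, rfl, rfl⟩ := h
  exact ⟨A, B, C, hA.trans hkl, hB.trans hkl, hcd hAB, rfl, rfl⟩

lemma Linked.rel (h : Linked c k T U) : c T U := by
  induction h with
  | refl => exact c.refl _
  | tail _ hmove ih => exact c.trans ih hmove.rel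

lemma Linked.symm (h : Linked c k T U) : Linked c k U T := by
  induction h with
  | refl => exact .refl
  | tail _ hmove ih => exact .head hmove.symm ih

lemma Linked.mono {d : AddCon (Multiset X)} (hkl : k ≤ l) (hcd : c ≤ d) (h : Linked c k T U) :
    Linked d l T U :=
  Relation.ReflTransGen.mono (fun _ _ => Move.mono hkl hcd) _ _ h

lemma Linked.add_right (D : Multiset X) (h : Linked c k T U) : Linked c k (T + D) (U + D) :=
  Relation.ReflTransGen.lift (· + D) (fun _ _ => Move.add_right D) _ _ h

lemma Linked.cons (x : X) (h : Linked c k T U) : Linked c k (x ::ₘ T) (x ::ₘ U) := by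
  simpa only [add_comm _ {x}, Multiset.singleton_add] using h.add_right {x}

lemma linked_add_right {A B : Multiset X} (hA : A.card ≤ k) (hB : B.card ≤ k) (hAB : c A B)
    (C : Multiset X) : Linked c k (A + C) (B + C) :=
  .single ⟨A, B, C, hA, hB, hAB, rfl, rfl⟩

lemma isGeneratedInDegree_of_le_bot (h : c ≤ ⊥) : IsGeneratedInDegree c k := by
  intro T U hTU
  obtain rfl : T = U := h hTU
  exact .refl

/-- The finer congruence that also remembers the image under `f`. -/
def refineBy (c : AddCon (Multiset X)) (f : X → S) : AddCon (Multiset X) :=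
  c ⊓ AddCon.ker (Multiset.mapAddMonoidHom f)

lemma refineBy_iff {f : X → S} : refineBy c f T U ↔ c T U ∧ T.map f = U.map f := Iff.rfl

lemma count_map_eq_sum {γ : Type*} [Fintype X] [DecidableEq X] [DecidableEq γ] (g : X → γ)
    (P : Multiset X) (y : γ) : (P.map g).count y = ∑ x with g x = y, P.count x := by
  classical
  rw [Multiset.count_map, ← Multiset.toFinset_sum_count_eq]
  refine Finset.sum_subset_zero_on_sdiff (fun x hx => ?_) (fun x hx => ?_) fun x hx => ?_
  · have : x ∈ P.filter fun a => y = g a := Multiset.mem_toFinset.1 hx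
    simpa using (Multiset.mem_filter.1 this).2.symm
  · obtain ⟨hx, hxP⟩ := Finset.mem_sdiff.1 hx
    rw [Multiset.mem_toFinset, Multiset.mem_filter, not_and'] at hxP
    exact Multiset.count_eq_zero.2 (hxP (Finset.mem_filter.1 hx).2.symm)
  · exact Multiset.count_filter_of_pos
      (Multiset.mem_filter.1 (Multiset.mem_toFinset.1 hx)).2

lemma map_eq_map_of_factors {f : X → Y} {g : X → Z} (hfg : ∀ x y, g x = g y → f x = f y)
    (h : T.map g = U.map g) : T.map f = U.map f := by
  rw [← Multiset.rel_eq, Multiset.rel_map] at h ⊢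
  exact h.mono fun a _ b _ hab => hfg a b hab

lemma exists_eq_add_of_map_eq_add (p : Z → X) {T : Multiset Z} {A C : Multiset X}
    (h : T.map p = A + C) : ∃ T₁ T₂, T = T₁ + T₂ ∧ T₁.map p = A ∧ T₂.map p = C := by
  induction A using Multiset.induction generalizing T with
  | empty => exact ⟨0, T, (zero_add T).symm, rfl, by simpa using h⟩
  | cons a A ih =>
    classical
    rw [Multiset.cons_add, ← Multiset.map_eq_cons] at h
    obtain ⟨z, hz, rfl, hT⟩ := h
    obtain ⟨T₁, T₂, h₁, rfl, rfl⟩ := ih hT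
    exact ⟨z ::ₘ T₁, T₂, by rw [Multiset.cons_add, ← h₁, Multiset.cons_erase hz], by simp, rfl⟩

end Moves

/-! ### Gluing congruences along a fibre product -/

/-- `Z`, with the projections `p` and `q`, is the fibre product of `X` and `Y` over `S`. -/
structure IsFiberProduct {X Y Z S : Type*} (p : Z → X) (q : Z → Y) (f : X → S) (g : Y → S) :
    Prop where
  comm : ∀ z, f (p z) = g (q z)
  lift : ∀ x y, f x = g y → ∃ z, p z = x ∧ q z = y
  ext : ∀ {z z'}, p z = p z' → q z = q z' → z = z'

/-- The congruence on multisets in `Z` whose classes are determined by the classes of the images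
under `p` and `q`. -/
def glue {X Y Z : Type*} (p : Z → X) (q : Z → Y) (c : AddCon (Multiset X))
    (d : AddCon (Multiset Y)) : AddCon (Multiset Z) :=
  c.comap (Multiset.map p) (Multiset.map_add p) ⊓ d.comap (Multiset.map q) (Multiset.map_add q)

lemma glue_iff {X Y Z : Type*} {p : Z → X} {q : Z → Y} {c : AddCon (Multiset X)}
    {d : AddCon (Multiset Y)} {T T' : Multiset Z} :
    glue p q c d T T' ↔ c (T.map p) (T'.map p) ∧ d (T.map q) (T'.map q) := Iff.rfl

namespace IsFiberProduct

variable {X Y Z S : Type*} {p : Z → X} {q : Z → Y} {f : X → S} {g : Y → S}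
  {c : AddCon (Multiset X)} {d : AddCon (Multiset Y)} {e : AddCon (Multiset Z)} {k : ℕ}

lemma swap (h : IsFiberProduct p q f g) : IsFiberProduct q p g f where
  comm z := (h.comm z).symm
  lift x y hxy := (h.lift y x hxy.symm).imp fun _ => And.symm
  ext h₁ h₂ := h.ext h₂ h₁

lemma map_map (h : IsFiberProduct p q f g) (T : Multiset Z) :
    (T.map p).map f = (T.map q).map g := by
  simp only [Multiset.map_map, Function.comp_apply, h.comm]

lemma exists_map_eq (h : IsFiberProduct p q f g) {A : Multiset X} {B : Multiset Y}
    (hAB : A.map f = B.map g) : ∃ T : Multiset Z, T.map p = A ∧ T.map q = B := by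
  induction A using Multiset.induction generalizing B with
  | empty => exact ⟨0, rfl, by simpa [eq_comm] using hAB⟩
  | cons x A ih =>
    classical
    rw [Multiset.map_cons, eq_comm, ← Multiset.map_eq_cons] at hAB
    obtain ⟨y, hy, hxy, hB⟩ := hAB
    obtain ⟨T, rfl, hT⟩ := ih hB.symm
    obtain ⟨z, rfl, rfl⟩ := h.lift x y hxy.symm
    exact ⟨z ::ₘ T, by simp, by rw [Multiset.map_cons, hT, Multiset.cons_erase hy]⟩

/-- A quadratic move trades the second components of two elements over the same point of `S`;
it brings any prescribed element `z` into `T'`. -/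
lemma exists_linked_cons_of_map_eq (h : IsFiberProduct p q f g)
    (he : ∀ T T', T.map p = T'.map p → T.map q = T'.map q → e T T') {z : Z} {T T' : Multiset Z}
    (hp : (z ::ₘ T).map p = T'.map p) (hq : (z ::ₘ T).map q = T'.map q) :
    ∃ U, Linked e 2 T' (z ::ₘ U) ∧ T.map p = U.map p ∧ T.map q = U.map q := by
  classical
  rw [Multiset.map_cons, eq_comm, ← Multiset.map_eq_cons] at hp
  obtain ⟨z', hz', hpz, hp⟩ := hp
  obtain ⟨U, rfl⟩ := Multiset.exists_cons_of_mem hz'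
  rw [Multiset.erase_cons_head] at hp
  simp only [Multiset.map_cons] at hq
  by_cases hqz : q z' = q z
  · obtain rfl := h.ext hpz hqz
    exact ⟨U, .refl, hp.symm, (Multiset.cons_inj_right _).1 hq⟩
  have hmem : q z ∈ U.map q :=
    (Multiset.mem_cons.1 (hq ▸ Multiset.mem_cons_self _ _)).resolve_left (Ne.symm hqz)
  obtain ⟨y, hy, hyz⟩ := Multiset.mem_map.1 hmem
  obtain ⟨W, rfl⟩ := Multiset.exists_cons_of_mem hy
  have hfg : f (p y) = g (q z') := by rw [h.comm, hyz, ← h.comm, ← hpz, h.comm]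
  obtain ⟨w, hwp, hwq⟩ := h.lift (p y) (q z') hfg
  have hmove : Linked e 2 ({z', y} + W) ({z, w} + W) := by
    refine linked_add_right (by simp) (by simp) (he _ _ (by simp [hpz, hwp]) ?_) W
    simpa [hwq, hyz] using Multiset.pair_comm _ _
  refine ⟨w ::ₘ W, by simpa using hmove, by simp [← hp, hwp], ?_⟩
  simp only [Multiset.map_cons, hyz, hwq] at hq ⊢
  rw [Multiset.cons_swap] at hq
  exact (Multiset.cons_inj_right _).1 hq

lemma linked_of_map_eq (h : IsFiberProduct p q f g)
    (he : ∀ T T', T.map p = T'.map p → T.map q = T'.map q → e T T') {T T' : Multiset Z}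
    (hp : T.map p = T'.map p) (hq : T.map q = T'.map q) : Linked e 2 T' T := by
  induction T using Multiset.induction generalizing T' with
  | empty =>
    obtain rfl : T' = 0 := by simpa using hp.symm
    exact .refl
  | cons z T ih =>
    obtain ⟨U, hU, hpU, hqU⟩ := h.exists_linked_cons_of_map_eq he hp hq
    exact hU.trans ((ih hpU hqU).cons z)

lemma exists_linked_of_linked_map (h : IsFiberProduct p q f g)
    (he : ∀ T T', c (T.map p) (T'.map p) → T.map q = T'.map q → e T T')
    (hf : ∀ A B, c A B → A.map f = B.map f) {T : Multiset Z} {B : Multiset X}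
    (hB : Linked c k (T.map p) B) :
    ∃ T', T'.map p = B ∧ T'.map q = T.map q ∧ Linked e k T T' := by
  induction hB with
  | refl => exact ⟨T, rfl, rfl, .refl⟩
  | tail _ hmove ih =>
    obtain ⟨T', hp, hq, hTT'⟩ := ih
    obtain ⟨A, B, C, hA, hB, hAB, rfl, rfl⟩ := hmove
    obtain ⟨T₁, T₂, rfl, rfl, rfl⟩ := exists_eq_add_of_map_eq_add p hp
    obtain ⟨E, rfl, hE⟩ := h.exists_map_eq (A := B) (B := T₁.map q)
      ((hf _ _ hAB).symm.trans (h.map_map T₁))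
    refine ⟨E + T₂, by simp, by simp [hE, ← hq], hTT'.trans ?_⟩
    exact linked_add_right (by simpa using hA) (by simpa using hB) (he _ _ hAB hE.symm) T₂

theorem isGeneratedInDegree_glue (h : IsFiberProduct p q f g)
    (hf : ∀ A B, c A B → A.map f = B.map f) (hg : ∀ A B, d A B → A.map g = B.map g) (hk : 2 ≤ k)
    (hc : IsGeneratedInDegree c k) (hd : IsGeneratedInDegree d k) :
    IsGeneratedInDegree (glue p q c d) k := by
  rintro T T' ⟨hp, hq⟩
  obtain ⟨T₁, hp₁, hq₁, hl₁⟩ := h.exists_linked_of_linked_map (e := glue p q c d)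
    (fun U U' hU hU' => glue_iff.2 ⟨hU, hU' ▸ d.refl _⟩) hf (hc hp)
  obtain ⟨T₂, hq₂, hp₂, hl₂⟩ := h.swap.exists_linked_of_linked_map (e := glue p q c d) (T := T₁)
    (fun U U' hU hU' => glue_iff.2 ⟨hU' ▸ c.refl _, hU⟩) hg (hq₁ ▸ hd hq)
  have hl₃ : Linked (glue p q c d) 2 T₂ T' := h.linked_of_map_eq
    (fun U U' hU hU' => glue_iff.2 ⟨hU ▸ c.refl _, hU' ▸ d.refl _⟩)
    (hp₁.symm.trans hp₂.symm) hq₂.symm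
  exact hl₁.trans (hl₂.trans (hl₃.mono hk le_rfl))

end IsFiberProduct

/-! ### Gluing along two binary coordinates -/

section BinaryPair

variable {X Y Z : Type*} {c : AddCon (Multiset X)} {d : AddCon (Multiset Y)} {k : ℕ}

/-- Congruent multisets have the same one-dimensional marginals under `f`, although their joint
images under `f` may differ. -/
def PreservesMarginals {S₁ S₂ : Type*} (c : AddCon (Multiset X)) (f : X → S₁ × S₂) : Prop :=
  ∀ ⦃A B⦄, c A B → (A.map f).map Prod.fst = (B.map f).map Prod.fst ∧
    (A.map f).map Prod.snd = (B.map f).map Prod.snd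

/-- The quadratic moves that increase the entry `(false, false)` of the `2 × 2` table of the images
under `f`, necessarily by one. -/
structure IsRaisingMove (c : AddCon (Multiset X)) (f : X → Bool × Bool) (x₁ x₂ y₁ y₂ : X) :
    Prop where
  rel : c {x₁, x₂} {y₁, y₂}
  map_source₁ : f x₁ = (false, true)
  map_source₂ : f x₂ = (true, false)
  map_target₁ : f y₁ = (false, false)
  map_target₂ : f y₂ = (true, true)

lemma count_map_fst (P : Multiset (Bool × Bool)) (b : Bool) :
    (P.map Prod.fst).count b = P.count (b, true) + P.count (b, false) := by
  rw [count_map_eq_sum, Finset.sum_filter, Fintype.sum_prod_type]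
  cases b <;> simp

lemma count_map_snd (P : Multiset (Bool × Bool)) (b : Bool) :
    (P.map Prod.snd).count b = P.count (true, b) + P.count (false, b) := by
  rw [count_map_eq_sum, Finset.sum_filter, Fintype.sum_prod_type]
  cases b <;> simp

lemma eq_of_marginals_of_count_eq {P Q : Multiset (Bool × Bool)}
    (hfst : P.map Prod.fst = Q.map Prod.fst) (hsnd : P.map Prod.snd = Q.map Prod.snd)
    (h : P.count (false, false) = Q.count (false, false)) : P = Q := by
  have hrow (b : Bool) := congrArg (Multiset.count b) hfst
  have hcol (b : Bool) := congrArg (Multiset.count b) hsnd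
  simp only [count_map_fst, count_map_snd] at hrow hcol
  have hrow_false := hrow false
  have hrow_true := hrow true
  have hcol_false := hcol false
  ext ⟨x, y⟩
  cases x <;> cases y <;> lia

lemma eq_of_count_pair_lt : ∀ s₁ s₂ t₁ t₂ : Bool × Bool,
    ({s₁.1, s₂.1} : Multiset Bool) = {t₁.1, t₂.1} → ({s₁.2, s₂.2} : Multiset Bool) = {t₁.2, t₂.2} →
    ({s₁, s₂} : Multiset (Bool × Bool)).count (false, false) <
      ({t₁, t₂} : Multiset (Bool × Bool)).count (false, false) →
    (s₁ = (false, true) ∧ s₂ = (true, false) ∨ s₂ = (false, true) ∧ s₁ = (true, false)) ∧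
    (t₁ = (false, false) ∧ t₂ = (true, true) ∨ t₂ = (false, false) ∧ t₁ = (true, true)) := by
  decide

lemma exists_isRaisingMove_of_count_lt {f : X → Bool × Bool} (hf : PreservesMarginals c f)
    {A B : Multiset X} (hA : A.card ≤ 2) (hAB : c A B)
    (hlt : (A.map f).count (false, false) < (B.map f).count (false, false)) :
    ∃ x₁ x₂ y₁ y₂, A = {x₁, x₂} ∧ B = {y₁, y₂} ∧ IsRaisingMove c f x₁ x₂ y₁ y₂ := by
  obtain ⟨hfst, hsnd⟩ := hf hAB
  have hcard : A.card = B.card := by simpa using congrArg Multiset.card hfst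
  obtain hA | hA | hA : A.card = 0 ∨ A.card = 1 ∨ A.card = 2 := by lia
  · rw [Multiset.card_eq_zero.1 hA, Multiset.card_eq_zero.1 (hcard.symm.trans hA)] at hlt
    exact absurd hlt (lt_irrefl _)
  · obtain ⟨x, rfl⟩ := Multiset.card_eq_one.1 hA
    obtain ⟨y, rfl⟩ := Multiset.card_eq_one.1 (hcard ▸ hA)
    have : f x = f y := Prod.ext (by simpa using hfst) (by simpa using hsnd)
    simp [this] at hlt
  · obtain ⟨x₁, x₂, rfl⟩ := Multiset.card_eq_two.1 hA
    obtain ⟨y₁, y₂, rfl⟩ := Multiset.card_eq_two.1 (hcard ▸ hA)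
    obtain ⟨⟨hx₁, hx₂⟩ | ⟨hx₂, hx₁⟩, ⟨hy₁, hy₂⟩ | ⟨hy₂, hy₁⟩⟩ := eq_of_count_pair_lt (f x₁) (f x₂)
      (f y₁) (f y₂) (by simpa using hfst) (by simpa using hsnd) (by simpa using hlt)
    · exact ⟨x₁, x₂, y₁, y₂, rfl, rfl, hAB, hx₁, hx₂, hy₁, hy₂⟩
    · rw [Multiset.pair_comm y₁] at hAB ⊢
      exact ⟨x₁, x₂, y₂, y₁, rfl, rfl, hAB, hx₁, hx₂, hy₂, hy₁⟩
    · rw [Multiset.pair_comm x₁] at hAB ⊢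
      exact ⟨x₂, x₁, y₁, y₂, rfl, rfl, hAB, hx₂, hx₁, hy₁, hy₂⟩
    · rw [Multiset.pair_comm x₁, Multiset.pair_comm y₁] at hAB ⊢
      exact ⟨x₂, x₁, y₂, y₁, rfl, rfl, hAB, hx₂, hx₁, hy₂, hy₁⟩

/-- Discrete intermediate value theorem: quadratic moves change the entry `(false, false)` by at
most one. -/
lemma Linked.exists_isRaisingMove_at_level {f : X → Bool × Bool} (hf : PreservesMarginals c f)
    {A B : Multiset X} (hAB : Linked c 2 A B) {L : ℕ} (hA : (A.map f).count (false, false) ≤ L)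
    (hB : L < (B.map f).count (false, false)) :
    ∃ x₁ x₂ y₁ y₂ C, c A ({x₁, x₂} + C) ∧ (({x₁, x₂} + C).map f).count (false, false) = L ∧
      IsRaisingMove c f x₁ x₂ y₁ y₂ := by
  induction hAB using Relation.ReflTransGen.head_induction_on with
  | refl => lia
  | @head A A' hmove _ ih =>
    by_cases hL : (A'.map f).count (false, false) ≤ L
    · obtain ⟨x₁, x₂, y₁, y₂, C, hC, hrest⟩ := ih hL
      exact ⟨x₁, x₂, y₁, y₂, C, c.trans hmove.rel hC, hrest⟩
    · obtain ⟨A₀, B₀, C, hk, -, hr, rfl, rfl⟩ := hmove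
      simp only [Multiset.map_add, Multiset.count_add] at hA hL
      obtain ⟨x₁, x₂, y₁, y₂, rfl, rfl, h⟩ := exists_isRaisingMove_of_count_lt hf hk hr (by lia)
      refine ⟨x₁, x₂, y₁, y₂, C, c.refl _, ?_, h⟩
      simp [h.map_source₁, h.map_source₂, h.map_target₁, h.map_target₂] at hA hL ⊢
      lia

lemma IsGeneratedInDegree.exists_isRaisingMove (hc : IsGeneratedInDegree c 2) {f : X → Bool × Bool}
    (hf : PreservesMarginals c f) {A B : Multiset X} (hAB : c A B)
    (hlt : (A.map f).count (false, false) < (B.map f).count (false, false)) :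
    ∃ x₁ x₂ y₁ y₂ C, refineBy c f A ({x₁, x₂} + C) ∧ IsRaisingMove c f x₁ x₂ y₁ y₂ := by
  obtain ⟨x₁, x₂, y₁, y₂, C, hA, hcount, hmove⟩ :=
    (hc hAB).exists_isRaisingMove_at_level hf le_rfl hlt
  exact ⟨x₁, x₂, y₁, y₂, C,
    ⟨hA, eq_of_marginals_of_count_eq (hf hA).1 (hf hA).2 hcount.symm⟩, hmove⟩

namespace IsFiberProduct

variable {p : Z → X} {q : Z → Y} {f : X → Bool × Bool} {g : Y → Bool × Bool}

lemma linked_of_map_map_eq (h : IsFiberProduct p q f g) (hk : 2 ≤ k)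
    (hcf : IsGeneratedInDegree (refineBy c f) k) (hdg : IsGeneratedInDegree (refineBy d g) k)
    {T T' : Multiset Z} (hT : glue p q c d T T') (hf : (T.map p).map f = (T'.map p).map f) :
    Linked (glue p q c d) k T T' := by
  have hg : (T.map q).map g = (T'.map q).map g := by rw [← h.map_map, ← h.map_map, hf]
  refine (h.isGeneratedInDegree_glue (fun _ _ => And.right) (fun _ _ => And.right) hk hcf hdg
    (glue_iff.2 ⟨⟨hT.1, hf⟩, hT.2, hg⟩)).mono le_rfl ?_
  exact fun A B hAB => ⟨hAB.1.1, hAB.2.1⟩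

/-- Raising moves of the two factors combine to a raising move of the fibre product. -/
lemma exists_linked_count_succ (h : IsFiberProduct p q f g) (hf : PreservesMarginals c f)
    (hg : PreservesMarginals d g) (hk : 2 ≤ k) (hc : IsGeneratedInDegree c 2)
    (hd : IsGeneratedInDegree d 2) (hcf : IsGeneratedInDegree (refineBy c f) k)
    (hdg : IsGeneratedInDegree (refineBy d g) k) {T T' : Multiset Z} (hT : glue p q c d T T')
    (hlt : ((T.map p).map f).count (false, false) < ((T'.map p).map f).count (false, false)) :
    ∃ U, Linked (glue p q c d) k T U ∧
      ((U.map p).map f).count (false, false) = ((T.map p).map f).count (false, false) + 1 := by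
  obtain ⟨x₁, x₂, y₁, y₂, C, ⟨hC, hCf⟩, hx⟩ := hc.exists_isRaisingMove hf hT.1 hlt
  obtain ⟨u₁, u₂, v₁, v₂, D, ⟨hD, hDg⟩, hu⟩ := hd.exists_isRaisingMove hg hT.2
    (by rwa [← h.map_map, ← h.map_map])
  replace hCf : (T.map p).map f = ({x₁, x₂} + C).map f := hCf
  replace hDg : (T.map q).map g = ({u₁, u₂} + D).map g := hDg
  obtain ⟨E, rfl, rfl⟩ : ∃ E : Multiset Z, E.map p = C ∧ E.map q = D := by
    refine h.exists_map_eq ?_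
    have := hCf.symm.trans ((h.map_map T).trans hDg)
    simpa [hx.map_source₁, hx.map_source₂, hu.map_source₁, hu.map_source₂] using this
  obtain ⟨z₁, rfl, rfl⟩ := h.lift x₁ u₁ (hx.map_source₁.trans hu.map_source₁.symm)
  obtain ⟨z₂, rfl, rfl⟩ := h.lift x₂ u₂ (hx.map_source₂.trans hu.map_source₂.symm)
  obtain ⟨w₁, rfl, rfl⟩ := h.lift y₁ v₁ (hx.map_target₁.trans hu.map_target₁.symm)
  obtain ⟨w₂, rfl, rfl⟩ := h.lift y₂ v₂ (hx.map_target₂.trans hu.map_target₂.symm)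
  have hprepare : Linked (glue p q c d) k T ({z₁, z₂} + E) :=
    h.linked_of_map_map_eq hk hcf hdg
      (glue_iff.2 ⟨by simpa using hC, by simpa using hD⟩) (by simpa using hCf)
  have hraise : Linked (glue p q c d) k ({z₁, z₂} + E) ({w₁, w₂} + E) :=
    linked_add_right (by simpa using hk) (by simpa using hk)
      (glue_iff.2 ⟨by simpa using hx.rel, by simpa using hu.rel⟩) E
  refine ⟨({w₁, w₂} : Multiset Z) + E, hprepare.trans hraise, ?_⟩
  rw [hCf]
  simp [hx.map_source₁, hx.map_source₂, hx.map_target₁, hx.map_target₂]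

lemma linked_of_count_le (h : IsFiberProduct p q f g) (hf : PreservesMarginals c f)
    (hg : PreservesMarginals d g) (hk : 2 ≤ k) (hc : IsGeneratedInDegree c 2)
    (hd : IsGeneratedInDegree d 2) (hcf : IsGeneratedInDegree (refineBy c f) k)
    (hdg : IsGeneratedInDegree (refineBy d g) k) {T T' : Multiset Z} (hT : glue p q c d T T')
    (hle : ((T.map p).map f).count (false, false) ≤ ((T'.map p).map f).count (false, false)) :
    Linked (glue p q c d) k T T' := by
  obtain ⟨n, hn⟩ := Nat.exists_eq_add_of_le hle
  induction n generalizing T with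
  | zero =>
    obtain ⟨hfst, hsnd⟩ := hf hT.1
    exact h.linked_of_map_map_eq hk hcf hdg hT (eq_of_marginals_of_count_eq hfst hsnd hn.symm)
  | succ n ih =>
    obtain ⟨U, hTU, hU⟩ := h.exists_linked_count_succ hf hg hk hc hd hcf hdg hT (by lia)
    exact hTU.trans (ih ((glue p q c d).trans ((glue p q c d).symm hTU.rel) hT) (by lia) (by lia))

theorem isGeneratedInDegree_glue_of_bool (h : IsFiberProduct p q f g)
    (hf : PreservesMarginals c f) (hg : PreservesMarginals d g) (hk : 2 ≤ k)
    (hc : IsGeneratedInDegree c 2) (hd : IsGeneratedInDegree d 2)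
    (hcf : IsGeneratedInDegree (refineBy c f) k) (hdg : IsGeneratedInDegree (refineBy d g) k) :
    IsGeneratedInDegree (glue p q c d) k := by
  intro T T' hT
  obtain hle | hle := le_total (((T.map p).map f).count (false, false))
    (((T'.map p).map f).count (false, false))
  · exact h.linked_of_count_le hf hg hk hc hd hcf hdg hT hle
  · exact (h.linked_of_count_le hf hg hk hc hd hcf hdg ((glue p q c d).symm hT) hle).symm

end IsFiberProduct

end BinaryPair

/-! ### Margins of hierarchical models -/

section Margins

variable {V : Type*} {α : V → Type*} {Γ : LowerSet (Finset V)} {k : ℕ}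

/-- The congruence of the hierarchical model of the complex `Γ`: two contingency tables, encoded as
multisets of cells `∀ v, α v`, are congruent if they have the same margins on all faces of `Γ`. -/
def marginCon (α : V → Type*) (Γ : LowerSet (Finset V)) : AddCon (Multiset (∀ v, α v)) where
  r T U := ∀ F ∈ Γ, T.map F.restrict = U.map F.restrict
  iseqv := ⟨fun _ _ _ => rfl, fun h F hF => (h F hF).symm,
    fun h₁ h₂ F hF => (h₁ F hF).trans (h₂ F hF)⟩
  add' h₁ h₂ F hF := by rw [Multiset.map_add, Multiset.map_add, h₁ F hF, h₂ F hF]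

lemma map_eq_map_of_marginCon {S : Type*} {T U : Multiset (∀ v, α v)} (h : marginCon α Γ T U)
    {F : Finset V} (hF : F ∈ Γ) {f : (∀ v, α v) → S}
    (hf : ∀ x y, (∀ v ∈ F, x v = y v) → f x = f y) : T.map f = U.map f :=
  map_eq_map_of_factors (fun x y hxy => hf x y fun v hv => congrFun hxy ⟨v, hv⟩) (h F hF)

lemma isGeneratedInDegree_marginCon_of_forall_mem {F : Finset V} (hF : F ∈ Γ)
    (hV : ∀ v, v ∈ F) : IsGeneratedInDegree (marginCon α Γ) k :=
  isGeneratedInDegree_of_le_bot fun T U h => by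
    have := map_eq_map_of_marginCon h hF (f := id) fun x y hxy => funext fun v => hxy v (hV v)
    rwa [Multiset.map_id, Multiset.map_id] at this

/-- The induced subcomplex on `A`, as a complex on the type of elements of `A`. -/
def inducedComplex (Γ : LowerSet (Finset V)) (A : Set V) : LowerSet (Finset A) where
  carrier := {F | F.map (Function.Embedding.subtype _) ∈ Γ}
  lower' _ _ hle hF := Γ.lower (Finset.map_subset_map.2 hle) hF

lemma mem_inducedComplex {A : Set V} {F : Finset A} :
    F ∈ inducedComplex Γ A ↔ F.map (Function.Embedding.subtype _) ∈ Γ := Iff.rfl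

lemma exists_mem_inducedComplex {A : Set V} {F : Finset V} (hF : F ∈ Γ) (hFA : ↑F ⊆ A) :
    ∃ F' ∈ inducedComplex Γ A, ∀ v : A, v ∈ F' ↔ ↑v ∈ F := by
  classical
  refine ⟨F.subtype (· ∈ A), ?_, fun v => Finset.mem_subtype⟩
  rwa [mem_inducedComplex, Finset.subtype_map_of_mem fun v hv => hFA hv]

lemma marginCon_inducedComplex_iff {A : Set V} {T U : Multiset (∀ v, α v)} :
    marginCon (fun v : A => α v) (inducedComplex Γ A) (T.map A.domRestrict) (U.map A.domRestrict) ↔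
      ∀ F ∈ Γ, ↑F ⊆ A → T.map F.restrict = U.map F.restrict := by
  refine ⟨fun h F hF hFA => ?_, fun h F hF => ?_⟩
  · obtain ⟨F', hF', hmem⟩ := exists_mem_inducedComplex hF hFA
    have := map_eq_map_of_marginCon h hF' (f := fun x (v : F) => x ⟨v, hFA v.2⟩)
      fun x y hxy => funext fun v => hxy _ ((hmem _).2 v.2)
    rwa [Multiset.map_map, Multiset.map_map] at this
  · simp only [Multiset.map_map]
    refine map_eq_map_of_factors (fun x y hxy => ?_) (h _ hF fun v hv => ?_)
    · ext v
      exact congrFun hxy ⟨v, Finset.mem_map_of_mem _ v.2⟩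
    · obtain ⟨w, -, rfl⟩ := Finset.mem_map.1 hv
      exact w.2

lemma marginCon_eq_glue {A B : Set V} (hcov : ∀ F ∈ Γ, (F : Set V) ⊆ A ∨ ↑F ⊆ B) :
    marginCon α Γ = glue A.domRestrict B.domRestrict (marginCon _ (inducedComplex Γ A))
      (marginCon _ (inducedComplex Γ B)) := by
  ext T U
  rw [glue_iff, marginCon_inducedComplex_iff, marginCon_inducedComplex_iff]
  exact ⟨fun h => ⟨fun F hF _ => h F hF, fun F hF _ => h F hF⟩,
    fun h F hF => (hcov F hF).elim (h.1 F hF) (h.2 F hF)⟩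

lemma isFiberProduct_domRestrict {S : Type*} {A B : Set V} (hAB : A ∪ B = Set.univ)
    {f : (∀ v : A, α v) → S} {g : (∀ v : B, α v) → S}
    (hfg : ∀ x y, f x = g y ↔ ∀ v (hA : v ∈ A) (hB : v ∈ B), x ⟨v, hA⟩ = y ⟨v, hB⟩) :
    IsFiberProduct (A.domRestrict (π := α)) (B.domRestrict (π := α)) f g where
  comm z := (hfg _ _).2 fun _ _ _ => rfl
  lift x y hxy := by
    classical
    rw [hfg] at hxy
    refine ⟨fun v => if h : v ∈ A then x ⟨v, h⟩ else
      y ⟨v, (Set.eq_univ_iff_forall.1 hAB v).resolve_left h⟩, ?_, ?_⟩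
    · ext ⟨v, hv⟩
      exact dif_pos hv
    · ext ⟨v, hv⟩
      by_cases h : v ∈ A
      · exact (dif_pos h).trans (hxy v h hv)
      · exact dif_neg h
  ext {z z'} h hz := by
    ext v
    obtain hv | hv := Set.eq_univ_iff_forall.1 hAB v
    · exact congrFun h ⟨v, hv⟩
    · exact congrFun hz ⟨v, hv⟩

theorem isGeneratedInDegree_marginCon_of_separating_face {A B : Set V} (hAB : A ∪ B = Set.univ)
    (hcov : ∀ F ∈ Γ, (F : Set V) ⊆ A ∨ ↑F ⊆ B) {S : Finset V} (hS : S ∈ Γ) (hSAB : A ∩ B = S)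
    (hk : 2 ≤ k)
    (hA : IsGeneratedInDegree (marginCon (fun v : A => α v) (inducedComplex Γ A)) k)
    (hB : IsGeneratedInDegree (marginCon (fun v : B => α v) (inducedComplex Γ B)) k) :
    IsGeneratedInDegree (marginCon α Γ) k := by
  have hmem (v : V) : v ∈ S ↔ v ∈ A ∧ v ∈ B := (Set.ext_iff.1 hSAB v).symm
  obtain ⟨SA, hSA, hmemA⟩ := exists_mem_inducedComplex hS (fun v hv => ((hmem v).1 hv).1)
  obtain ⟨SB, hSB, hmemB⟩ := exists_mem_inducedComplex hS (fun v hv => ((hmem v).1 hv).2)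
  rw [marginCon_eq_glue hcov]
  refine (isFiberProduct_domRestrict (S := ∀ v : S, α v) hAB
    (f := fun x v => x ⟨v, ((hmem v).1 v.2).1⟩) (g := fun y v => y ⟨v, ((hmem v).1 v.2).2⟩)
    fun x y => ?_).isGeneratedInDegree_glue (fun T U h => ?_) (fun T U h => ?_) hk hA hB
  · exact ⟨fun h v h₁ h₂ => congrFun h ⟨v, (hmem v).2 ⟨h₁, h₂⟩⟩, fun h => funext fun v => h v _ _⟩
  · exact map_eq_map_of_marginCon h hSA fun x y hxy => funext fun v => hxy _ ((hmemA _).2 v.2)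
  · exact map_eq_map_of_marginCon h hSB fun x y hxy => funext fun v => hxy _ ((hmemB _).2 v.2)

/-- The hypothesis `hm` says that the link of `m` is a simplex. -/
theorem isGeneratedInDegree_marginCon_of_simplicial {m : V} {S : Finset V} (hS : S ∈ Γ)
    (hmS : m ∈ S) (hm : ∀ F ∈ Γ, m ∈ F → F ⊆ S) (hk : 2 ≤ k)
    (h : IsGeneratedInDegree
      (marginCon (fun v : ({m}ᶜ : Set V) => α v) (inducedComplex Γ {m}ᶜ)) k) :
    IsGeneratedInDegree (marginCon α Γ) k := by
  classical
  obtain ⟨S', hS', hmem⟩ := exists_mem_inducedComplex hS subset_rfl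
  refine isGeneratedInDegree_marginCon_of_separating_face (A := {m}ᶜ) (B := S) (S := S.erase m)
    ?_ (fun F hF => ?_) (Γ.lower (S.erase_subset m) hS) ?_ hk h
    (isGeneratedInDegree_marginCon_of_forall_mem hS' fun v => (hmem v).2 v.2)
  · refine Set.eq_univ_iff_forall.2 fun v => ?_
    by_cases hv : v = m
    exacts [.inr (hv ▸ hmS), .inl hv]
  · by_cases hmF : m ∈ F
    · exact .inr (Finset.coe_subset.2 (hm F hF hmF))
    · exact .inl (Set.subset_compl_singleton_iff.2 hmF)
  · rw [Finset.coe_erase, Set.inter_comm, Set.sdiff_eq]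

variable [DecidableEq V]

lemma marginCon_inducedComplex_sup_Iic {S₁ S₂ : Type*} {A : Set V} {a b : V} (ha : a ∈ A)
    (hb : b ∈ A) {f₁ : α a → S₁} {f₂ : α b → S₂} (hf₁ : f₁.Injective) (hf₂ : f₂.Injective) :
    marginCon (fun v : A => α v) (inducedComplex (Γ ⊔ LowerSet.Iic {a, b}) A) =
      refineBy (marginCon _ (inducedComplex Γ A)) fun x => (f₁ (x ⟨a, ha⟩), f₂ (x ⟨b, hb⟩)) := by
  ext T U
  rw [refineBy_iff]
  refine ⟨fun h => ⟨fun F hF => h F (.inl hF), ?_⟩, fun h F hF => hF.elim (h.1 F) fun hF => ?_⟩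
  · obtain ⟨F, hF, hmem⟩ := exists_mem_inducedComplex (Γ := Γ ⊔ LowerSet.Iic {a, b}) (A := A)
      (.inr (LowerSet.mem_Iic_iff.2 (le_refl {a, b}))) (by simp [Set.insert_subset_iff, ha, hb])
    refine map_eq_map_of_marginCon h hF fun x y hxy => ?_
    rw [hxy ⟨a, ha⟩ ((hmem _).2 (by simp)), hxy ⟨b, hb⟩ ((hmem _).2 (by simp))]
  · refine map_eq_map_of_factors (fun x y hxy => funext fun v => ?_) h.2
    obtain ⟨hxa, hxb⟩ := Prod.mk_inj.1 hxy
    have hv : (v : V) ∈ ({a, b} : Finset V) := hF (Finset.mem_map_of_mem _ v.2)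
    obtain ⟨⟨v, hvA⟩, hvF⟩ := v
    obtain rfl | rfl : v = a ∨ v = b := by simpa using hv
    exacts [hf₁ hxa, hf₂ hxb]

theorem isGeneratedInDegree_marginCon_of_separating_binary_pair {A B : Set V} {a b : V}
    (haΓ : {a} ∈ Γ) (hbΓ : {b} ∈ Γ) (hAB : A ∪ B = Set.univ)
    (hcov : ∀ F ∈ Γ, (F : Set V) ⊆ A ∨ ↑F ⊆ B) (hS : A ∩ B = {a, b}) (ea : α a ≃ Bool)
    (eb : α b ≃ Bool) (hk : 2 ≤ k)
    (hA : IsGeneratedInDegree (marginCon (fun v : A => α v) (inducedComplex Γ A)) 2)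
    (hB : IsGeneratedInDegree (marginCon (fun v : B => α v) (inducedComplex Γ B)) 2)
    (hA' : IsGeneratedInDegree
      (marginCon (fun v : A => α v) (inducedComplex (Γ ⊔ LowerSet.Iic {a, b}) A)) k)
    (hB' : IsGeneratedInDegree
      (marginCon (fun v : B => α v) (inducedComplex (Γ ⊔ LowerSet.Iic {a, b}) B)) k) :
    IsGeneratedInDegree (marginCon α Γ) k := by
  have hmem (v : V) : v ∈ A ∧ v ∈ B ↔ v = a ∨ v = b := Set.ext_iff.1 hS v
  obtain ⟨haA, haB⟩ := (hmem a).2 (.inl rfl)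
  obtain ⟨hbA, hbB⟩ := (hmem b).2 (.inr rfl)
  rw [marginCon_inducedComplex_sup_Iic haA hbA ea.injective eb.injective] at hA'
  rw [marginCon_inducedComplex_sup_Iic haB hbB ea.injective eb.injective] at hB'
  have hmarginals {C : Set V} (haC : a ∈ C) (hbC : b ∈ C) :
      PreservesMarginals (marginCon (fun v : C => α v) (inducedComplex Γ C))
        fun x => (ea (x ⟨a, haC⟩), eb (x ⟨b, hbC⟩)) := by
    intro T U h
    simp only [Multiset.map_map]
    exact ⟨map_eq_map_of_marginCon h (F := {⟨a, haC⟩}) haΓ fun x y hxy => by simp [hxy],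
      map_eq_map_of_marginCon h (F := {⟨b, hbC⟩}) hbΓ fun x y hxy => by simp [hxy]⟩
  rw [marginCon_eq_glue hcov]
  refine (isFiberProduct_domRestrict hAB fun x y => ?_).isGeneratedInDegree_glue_of_bool
    (hmarginals haA hbA) (hmarginals haB hbB) hk hA hB hA' hB'
  simp only [Prod.mk.injEq, EmbeddingLike.apply_eq_iff_eq]
  refine ⟨fun ⟨h₁, h₂⟩ v hvA hvB => ?_, fun h => ⟨h a haA haB, h b hbA hbB⟩⟩
  obtain rfl | rfl := (hmem v).1 ⟨hvA, hvB⟩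
  exacts [h₁, h₂]

end Margins

/-! ### The triangle with two binary vertices -/

section Triangle

/-- The congruence of the model of no three-way interaction: equality of the three
two-dimensional margins. -/
def noThreeWayCon (X Y Z : Type*) : AddCon (Multiset (X × Y × Z)) :=
  AddCon.ker (Multiset.mapAddMonoidHom fun t => (t.1, t.2.1)) ⊓
    (AddCon.ker (Multiset.mapAddMonoidHom fun t => (t.1, t.2.2)) ⊓
      AddCon.ker (Multiset.mapAddMonoidHom fun t => t.2))

lemma noThreeWayCon_iff {X Y Z : Type*} {T U : Multiset (X × Y × Z)} :
    noThreeWayCon X Y Z T U ↔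
      T.map (fun t => (t.1, t.2.1)) = U.map (fun t => (t.1, t.2.1)) ∧
      T.map (fun t => (t.1, t.2.2)) = U.map (fun t => (t.1, t.2.2)) ∧
      T.map (fun t => t.2) = U.map (fun t => t.2) := Iff.rfl

lemma noThreeWayCon_cons_iff {X Y Z : Type*} {z : X × Y × Z} {T U : Multiset (X × Y × Z)} :
    noThreeWayCon X Y Z (z ::ₘ T) (z ::ₘ U) ↔ noThreeWayCon X Y Z T U := by
  simp only [noThreeWayCon_iff, Multiset.map_cons, Multiset.cons_inj_right]

lemma noThreeWayCon_bool_quartic {X : Type*} (x x' : X) (a b : Bool) :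
    noThreeWayCon X Bool Bool {(x, a, !b), (x, !a, b), (x', a, b), (x', !a, !b)}
      {(x, a, b), (x, !a, !b), (x', !a, b), (x', a, !b)} := by
  rw [noThreeWayCon_iff]
  refine ⟨?_, ?_, ?_⟩ <;>
  · simp only [Multiset.insert_eq_cons, ← Multiset.singleton_add, Multiset.map_add,
      Multiset.map_singleton]
    abel

lemma exists_mem_eq_of_map_eq {X Y : Type*} {f : X → Y} {T U : Multiset X}
    (h : T.map f = U.map f) {z : X} (hz : z ∈ U) : ∃ t ∈ T, f t = f z :=
  Multiset.mem_map.1 (h ▸ Multiset.mem_map_of_mem f hz)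

variable {X : Type*} {T U : Multiset (X × Bool × Bool)}

lemma exists_mem_of_noThreeWayCon_of_disjoint (h : noThreeWayCon X Bool Bool T U)
    (hTU : Disjoint T U) {x : X} {a b : Bool} (hz : (x, a, b) ∈ U) :
    (x, a, !b) ∈ T ∧ (x, !a, b) ∈ T ∧ ∃ x', x' ≠ x ∧ (x', a, b) ∈ T := by
  have hzT : (x, a, b) ∉ T := fun hzT => Multiset.disjoint_left.1 hTU hzT hz
  obtain ⟨hXY, hXZ, hYZ⟩ := noThreeWayCon_iff.1 h
  obtain ⟨⟨x₁, a₁, b₁⟩, hr, h₁⟩ := exists_mem_eq_of_map_eq hXY hz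
  obtain ⟨⟨x₂, a₂, b₂⟩, hs, h₂⟩ := exists_mem_eq_of_map_eq hXZ hz
  obtain ⟨⟨x₃, a₃, b₃⟩, ht, h₃⟩ := exists_mem_eq_of_map_eq hYZ hz
  obtain ⟨rfl, rfl⟩ := Prod.mk_inj.1 h₁
  obtain ⟨rfl, rfl⟩ := Prod.mk_inj.1 h₂
  obtain ⟨rfl, rfl⟩ := Prod.mk_inj.1 h₃
  obtain rfl : b₁ = !b₃ := Bool.eq_not.2 (by rintro rfl; exact hzT hr)
  obtain rfl : a₂ = !a₃ := Bool.eq_not.2 (by rintro rfl; exact hzT hs)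
  exact ⟨hr, hs, x₃, by rintro rfl; exact hzT ht, ht⟩

lemma exists_linked_cons_of_noThreeWayCon_of_disjoint (h : noThreeWayCon X Bool Bool T U)
    (hTU : Disjoint T U) {z : X × Bool × Bool} (hz : z ∈ U) :
    ∃ W, Linked (noThreeWayCon X Bool Bool) 4 T (z ::ₘ W) ∧ T.card = (z ::ₘ W).card := by
  obtain ⟨x, a, b⟩ := z
  obtain ⟨hr, hs, x', hx', ht⟩ := exists_mem_of_noThreeWayCon_of_disjoint h hTU hz
  have hq := (exists_mem_of_noThreeWayCon_of_disjoint ((noThreeWayCon X _ _).symm h) hTU.symm ht).1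
  have hu := (exists_mem_of_noThreeWayCon_of_disjoint h hTU hq).2.1
  have hle : {(x, a, !b), (x, !a, b), (x', a, b), (x', !a, !b)} ≤ T := by
    refine (Multiset.le_iff_subset (by simp [hx'.symm])).2 ?_
    simp [Multiset.insert_eq_cons, Multiset.cons_subset, hr, hs, ht, hu]
  obtain ⟨C, rfl⟩ := exists_add_of_le hle
  refine ⟨{(x, !a, !b), (x', !a, b), (x', a, !b)} + C, ?_, by simp⟩
  simpa using linked_add_right (by simp) (by simp) (noThreeWayCon_bool_quartic x x' a b) C

theorem isGeneratedInDegree_noThreeWayCon_bool (X : Type*) :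
    IsGeneratedInDegree (noThreeWayCon X Bool Bool) 4 := by
  intro T U h
  induction hn : T.card generalizing T U with
  | zero =>
    obtain rfl := Multiset.card_eq_zero.1 hn
    obtain rfl : U = 0 := by simpa [eq_comm] using h.1
    exact .refl
  | succ n ih =>
    by_cases hTU : Disjoint T U
    · obtain ⟨z, hz⟩ : ∃ z, z ∈ U := by
        obtain ⟨t, ht⟩ := Multiset.card_pos_iff_exists_mem.1 (n.succ_pos.trans_eq hn.symm)
        exact (exists_mem_eq_of_map_eq h.1.symm ht).imp fun _ => And.left
      obtain ⟨W, hW, hcard⟩ := exists_linked_cons_of_noThreeWayCon_of_disjoint h hTU hz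
      obtain ⟨U, rfl⟩ := Multiset.exists_cons_of_mem hz
      have hWU := (noThreeWayCon X Bool Bool).trans ((noThreeWayCon X _ _).symm hW.rel) h
      exact hW.trans ((ih (noThreeWayCon_cons_iff.1 hWU) (by simpa [hn] using hcard.symm)).cons z)
    · obtain ⟨z, hzT, hzU⟩ : ∃ z ∈ T, z ∈ U := by
        simpa only [Multiset.disjoint_left, not_forall, not_not, exists_prop] using hTU
      obtain ⟨T, rfl⟩ := Multiset.exists_cons_of_mem hzT
      obtain ⟨U, rfl⟩ := Multiset.exists_cons_of_mem hzU
      exact (ih (noThreeWayCon_cons_iff.1 h) (by simpa using hn)).cons z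

lemma IsGeneratedInDegree.comap_equiv {X Z : Type*} {c : AddCon (Multiset X)} {k : ℕ}
    (hc : IsGeneratedInDegree c k) (e : Z ≃ X) :
    IsGeneratedInDegree (c.comap (Multiset.map e) (Multiset.map_add e)) k := by
  have hmove {A B : Multiset X} (h : Move c k A B) :
      Move (c.comap (Multiset.map e) (Multiset.map_add e)) k (A.map e.symm) (B.map e.symm) := by
    obtain ⟨A, B, C, hA, hB, hAB, rfl, rfl⟩ := h
    exact ⟨A.map e.symm, B.map e.symm, C.map e.symm, by simpa using hA, by simpa using hB,
      by simpa [AddCon.comap_rel] using hAB, by simp, by simp⟩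
  intro T U h
  have hlift : Linked _ k ((T.map e).map e.symm) ((U.map e).map e.symm) :=
    Relation.ReflTransGen.lift (Multiset.map e.symm) (fun _ _ => hmove) _ _ (hc h)
  simpa using hlift

theorem isGeneratedInDegree_marginCon_triangle {V : Type*} [DecidableEq V] {α : V → Type*}
    {Γ : LowerSet (Finset V)} {v a b : V} (hva : v ≠ a) (hvb : v ≠ b) (hab : a ≠ b)
    (hV : ∀ w, w = v ∨ w = a ∨ w = b)
    (hΓ : ∀ F, F ∈ Γ ↔ F ⊆ {v, a} ∨ F ⊆ {v, b} ∨ F ⊆ {a, b}) (ea : α a ≃ Bool) (eb : α b ≃ Bool) :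
    IsGeneratedInDegree (marginCon α Γ) 4 := by
  let φ (x : ∀ w, α w) : α v × Bool × Bool := (x v, ea (x a), eb (x b))
  have hφ : φ.Bijective := by
    refine ⟨fun x y hxy => funext fun w => ?_, fun ⟨x, y, z⟩ => ?_⟩
    · simp only [φ, Prod.mk.injEq, EmbeddingLike.apply_eq_iff_eq] at hxy
      obtain rfl | rfl | rfl := hV w
      exacts [hxy.1, hxy.2.1, hxy.2.2]
    · refine ⟨fun w => if hv : w = v then hv ▸ x else if ha : w = a then ha ▸ ea.symm y else
        if hb : w = b then hb ▸ eb.symm z else ((hV w).elim hv (Or.rec ha hb)).elim, ?_⟩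
      simp [φ, hva.symm, hvb.symm, hab.symm]
  convert (isGeneratedInDegree_noThreeWayCon_bool (α v)).comap_equiv (Equiv.ofBijective φ hφ)
  ext T U
  rw [AddCon.comap_rel, noThreeWayCon_iff]
  simp only [Multiset.map_map]
  refine ⟨fun h => ⟨?_, ?_, ?_⟩, fun ⟨h₁, h₂, h₃⟩ F hF => ?_⟩
  · exact map_eq_map_of_marginCon h ((hΓ {v, a}).2 (by simp)) fun x y hxy => by simp_all [φ]
  · exact map_eq_map_of_marginCon h ((hΓ {v, b}).2 (by simp)) fun x y hxy => by simp_all [φ]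
  · exact map_eq_map_of_marginCon h ((hΓ {a, b}).2 (by simp)) fun x y hxy => by simp_all [φ]
  · obtain hF | hF | hF := (hΓ F).1 hF
    · refine map_eq_map_of_factors (fun x y hxy => funext fun ⟨w, hw⟩ => ?_) h₁
      obtain rfl | rfl : w = v ∨ w = a := by simpa using hF hw
      all_goals simp_all [φ]
    · refine map_eq_map_of_factors (fun x y hxy => funext fun ⟨w, hw⟩ => ?_) h₂
      obtain rfl | rfl : w = v ∨ w = b := by simpa using hF hw
      all_goals simp_all [φ]
    · refine map_eq_map_of_factors (fun x y hxy => funext fun ⟨w, hw⟩ => ?_) h₃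
      obtain rfl | rfl : w = a ∨ w = b := by simpa using hF hw
      all_goals simp_all [φ]

end Triangle

/-! ### Noncrossing orders -/

/-- `f` orders the vertices in `A` such that no two edges inside `A` cross when the vertices are
placed on a circle in this order. -/
structure NoncrossingOn {V : Type*} (G : SimpleGraph V) (f : V → ℝ) (A : Set V) : Prop where
  injOn : Set.InjOn f A
  not_cross : ∀ a ∈ A, ∀ b ∈ A, ∀ c ∈ A, ∀ d ∈ A, f a < f b → f b < f c → f c < f d →
    G.Adj a c → ¬ G.Adj b d

section Noncrossing

variable {V : Type*} {G : SimpleGraph V} {f : V → ℝ} {A : Set V}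

lemma NoncrossingOn.induce (h : NoncrossingOn G f Set.univ) (A : Set V) :
    NoncrossingOn (G.induce A) (fun v => f v) Set.univ where
  injOn _ _ _ _ hvw := Subtype.ext (h.injOn trivial trivial hvw)
  not_cross a _ b _ c _ d _ h₁ h₂ h₃ hac hbd :=
    h.not_cross a trivial b trivial c trivial d trivial h₁ h₂ h₃ hac hbd

lemma exists_forall_abs_lt_of_finite (hA : A.Finite) (f : V → ℝ) :
    ∃ M : ℝ, ∀ a ∈ A, |f a| < M := by
  obtain ⟨M, hM⟩ := (hA.image fun a => |f a|).bddAbove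
  exact ⟨M + 1, fun a ha => (hM ⟨a, ha, rfl⟩).trans_lt (lt_add_one M)⟩

lemma exists_rotation (hA : A.Finite) (f : V → ℝ) (r : ℝ) :
    ∃ g : V → ℝ, ∀ a ∈ A, ∀ b ∈ A,
      g a < g b ↔ r ≤ f a ∧ f b < r ∨ (r ≤ f a ↔ r ≤ f b) ∧ f a < f b := by
  obtain ⟨M, hM⟩ := exists_forall_abs_lt_of_finite hA f
  refine ⟨fun v => if r ≤ f v then f v else f v + 2 * M, fun a ha b hb => ?_⟩
  have ha := abs_lt.1 (hM a ha)
  have hb := abs_lt.1 (hM b hb)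
  grind

lemma NoncrossingOn.exists_rotate (h : NoncrossingOn G f A) (hA : A.Finite) {s : V}
    (hs : s ∈ A) : ∃ g, NoncrossingOn G g A ∧ ∀ a ∈ A, g s ≤ g a := by
  obtain ⟨g, hg⟩ := exists_rotation hA f (f s)
  refine ⟨g, ⟨fun a ha b hb hab => ?_, fun a ha b hb c hc d hd hab hbc hcd hac hbd => ?_⟩,
    fun a ha => ?_⟩
  · have hab' := hg a ha b hb
    have hba' := hg b hb a ha
    refine h.injOn ha hb ?_
    grind
  · rw [hg a ha b hb] at hab
    rw [hg b hb c hc] at hbc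
    rw [hg c hc d hd] at hcd
    have h₁ := h.not_cross a ha b hb c hc d hd
    have h₂ := h.not_cross b hb c hc d hd a ha
    have h₃ := h.not_cross c hc d hd a ha b hb
    have h₄ := h.not_cross d hd a ha b hb c hc
    have hca := hac.symm
    have hdb := hbd.symm
    grind
  · have := hg a ha s hs
    grind

end Noncrossing

/-! ### Graph models -/

section GraphModel

variable {V : Type u} {G : SimpleGraph V} {α : V → Type*} {k : ℕ}

lemma mem_graphComplex_iff [DecidableEq V] {F : Finset V} :
    F ∈ graphComplex G ↔ F = ∅ ∨ ∃ a b, (a = b ∨ G.Adj a b) ∧ F = {a, b} := by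
  refine ⟨fun ⟨hcard, hF⟩ => ?_, ?_⟩
  · obtain h | h | h : F.card = 0 ∨ F.card = 1 ∨ F.card = 2 := by lia
    · exact .inl (Finset.card_eq_zero.1 h)
    · obtain ⟨a, rfl⟩ := Finset.card_eq_one.1 h
      exact .inr ⟨a, a, .inl rfl, (Finset.pair_eq_singleton a).symm⟩
    · obtain ⟨a, b, hab, rfl⟩ := Finset.card_eq_two.1 h
      exact .inr ⟨a, b, .inr (hF (by simp) (by simp) hab), rfl⟩
  · rintro (rfl | ⟨a, b, rfl | hab, rfl⟩)
    · exact ⟨by simp, by simp⟩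
    · exact ⟨by simp, by simp⟩
    · exact ⟨Finset.card_le_two, by simpa [SimpleGraph.isClique_pair] using fun _ => hab⟩

lemma singleton_mem_graphComplex (a : V) : {a} ∈ graphComplex G := by
  classical
  exact mem_graphComplex_iff.2 (.inr ⟨a, a, .inl rfl, (Finset.pair_eq_singleton a).symm⟩)

lemma inducedComplex_graphComplex (A : Set V) :
    inducedComplex (graphComplex G) A = graphComplex (G.induce A) := by
  ext F
  refine and_congr (by rw [Finset.card_map]) ?_
  rw [Finset.coe_map, SimpleGraph.isClique_iff, SimpleGraph.isClique_iff,
    Set.InjOn.pairwise_image (Function.Embedding.injective _).injOn]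
  rfl

lemma graphComplex_sup_edge [DecidableEq V] {a b : V} (hab : a ≠ b) :
    graphComplex (G ⊔ SimpleGraph.edge a b) = graphComplex G ⊔ LowerSet.Iic {a, b} := by
  refine le_antisymm (fun F hF => ?_) (sup_le (fun F hF => ?_) ?_)
  · obtain rfl | ⟨x, y, hxy, rfl⟩ := mem_graphComplex_iff.1 hF
    · exact .inl (mem_graphComplex_iff.2 (.inl rfl))
    · by_cases h : x = y ∨ G.Adj x y
      · exact .inl (mem_graphComplex_iff.2 (.inr ⟨x, y, h, rfl⟩))
      · right
        simp only [SimpleGraph.sup_adj, SimpleGraph.edge_adj] at hxy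
        rw [SetLike.mem_coe, LowerSet.mem_Iic_iff]
        grind
  · exact ⟨hF.1, hF.2.mono le_sup_left⟩
  · exact LowerSet.Iic_le.2 (mem_graphComplex_iff.2 (.inr ⟨a, b,
      .inr (.inr (by simp [SimpleGraph.edge_adj, hab])), rfl⟩))

lemma subset_or_subset_of_mem_graphComplex {A B : Set V} (hAB : A ∪ B = Set.univ)
    (hcov : ∀ v w, G.Adj v w → v ∈ A ∧ w ∈ A ∨ v ∈ B ∧ w ∈ B) :
    ∀ F ∈ graphComplex G, (F : Set V) ⊆ A ∨ ↑F ⊆ B := by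
  classical
  intro F hF
  obtain rfl | ⟨x, y, rfl | hxy, rfl⟩ := mem_graphComplex_iff.1 hF
  · simp
  · simpa using Set.eq_univ_iff_forall.1 hAB x
  · simpa [Set.insert_subset_iff] using hcov x y hxy

lemma isGeneratedInDegree_graphComplex_of_isEmpty [IsEmpty V] :
    IsGeneratedInDegree (marginCon α (graphComplex G)) k := by
  classical
  exact isGeneratedInDegree_marginCon_of_forall_mem (mem_graphComplex_iff.2 (.inl rfl)) isEmptyElim

lemma isGeneratedInDegree_graphComplex_of_leaf {m : V} (hm : (G.neighborSet m).Subsingleton)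
    (hk : 2 ≤ k) (h : IsGeneratedInDegree
      (marginCon (fun v : ({m}ᶜ : Set V) => α v) (graphComplex (G.induce {m}ᶜ))) k) :
    IsGeneratedInDegree (marginCon α (graphComplex G)) k := by
  classical
  obtain ⟨c, hmc, hc⟩ : ∃ c, (m = c ∨ G.Adj m c) ∧ ∀ w, G.Adj m w → w = c := by
    obtain hempty | ⟨c, hc⟩ := hm.eq_empty_or_singleton
    · exact ⟨m, .inl rfl, fun w hw => (hempty.subset hw).elim⟩
    · exact ⟨c, .inr (hc.superset rfl), fun w hw => hc.subset hw⟩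
  rw [← inducedComplex_graphComplex] at h
  refine isGeneratedInDegree_marginCon_of_simplicial (S := {m, c})
    (mem_graphComplex_iff.2 (.inr ⟨m, c, hmc, rfl⟩)) (by simp) (fun F hF hmF w hw => ?_) hk h
  by_cases hwm : w = m
  · simp [hwm]
  · simp [hc w (hF.2 hmF hw (Ne.symm hwm))]

theorem isGeneratedInDegree_two_of_lower_neighbors_subsingleton {V : Type u} [Finite V]
    {G : SimpleGraph V} {α : V → Type*} {L : Type*} [LinearOrder L] {f : V → L}
    (hf : Function.Injective f) (h : ∀ v, {x | G.Adj v x ∧ f x < f v}.Subsingleton) :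
    IsGeneratedInDegree (marginCon α (graphComplex G)) 2 := by
  induction hn : Nat.card V using Nat.strong_induction_on generalizing V with
  | _ n ih =>
  obtain hV | hV := isEmpty_or_nonempty V
  · exact isGeneratedInDegree_graphComplex_of_isEmpty
  obtain ⟨m, hm⟩ := Finite.exists_max f
  have hlower : ∀ x ∈ G.neighborSet m, x ∈ {x | G.Adj m x ∧ f x < f m} := fun x hx =>
    ⟨hx, lt_of_le_of_ne (hm x) (hf.ne hx.ne')⟩
  refine isGeneratedInDegree_graphComplex_of_leaf ((h m).anti hlower) le_rfl
    (ih _ ?_ (hf.comp Subtype.val_injective) (fun v x hx y hy => ?_) rfl)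
  · exact hn ▸ Set.ncard_lt_card (s := {m}ᶜ) (by simp)
  · exact Subtype.ext (h v hx hy)

lemma isGeneratedInDegree_induce_triangle {v a b : V} (hva : G.Adj v a) (hvb : G.Adj v b)
    (hab : G.Adj a b) (ea : α a ≃ Bool) (eb : α b ≃ Bool) :
    IsGeneratedInDegree
      (marginCon (fun x : ({v, a, b} : Set V) => α x) (graphComplex (G.induce {v, a, b}))) 4 := by
  classical
  replace hva : (G.induce {v, a, b}).Adj ⟨v, by simp⟩ ⟨a, by simp⟩ := hva
  replace hvb : (G.induce {v, a, b}).Adj ⟨v, by simp⟩ ⟨b, by simp⟩ := hvb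
  replace hab : (G.induce {v, a, b}).Adj ⟨a, by simp⟩ ⟨b, by simp⟩ := hab
  refine isGeneratedInDegree_marginCon_triangle (v := ⟨v, by simp⟩) (a := ⟨a, by simp⟩)
    (b := ⟨b, by simp⟩) hva.ne hvb.ne hab.ne (by rintro ⟨w, rfl | rfl | rfl⟩ <;> simp)
    (fun F => ⟨fun hF => ?_, fun hF => ?_⟩) ea eb
  · obtain rfl | ⟨⟨x, hx⟩, ⟨y, hy⟩, -, rfl⟩ := mem_graphComplex_iff.1 hF
    · simp
    · simp only [Set.mem_insert_iff, Set.mem_singleton_iff] at hx hy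
      simp only [Finset.insert_subset_iff, Finset.singleton_subset_iff, Finset.mem_insert,
        Finset.mem_singleton, Subtype.mk.injEq]
      tauto
  · obtain hF | hF | hF := hF
    · exact (graphComplex _).lower hF (mem_graphComplex_iff.2 (.inr ⟨_, _, .inr hva, rfl⟩))
    · exact (graphComplex _).lower hF (mem_graphComplex_iff.2 (.inr ⟨_, _, .inr hvb, rfl⟩))
    · exact (graphComplex _).lower hF (mem_graphComplex_iff.2 (.inr ⟨_, _, .inr hab, rfl⟩))

end GraphModel

/-! ### Noncrossing graph models are generated in degree four -/

section NoncrossingModel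

variable {V : Type u} {G : SimpleGraph V} {α : V → Type*} {f : V → ℝ}

/-- Some chord `a b` of the circle is an edge and has vertices strictly on both sides. -/
def HasSeparatingChord (G : SimpleGraph V) (f : V → ℝ) : Prop :=
  ∃ a b x y, G.Adj a b ∧ (f a < f x ∧ f x < f b) ∧ (f y < f a ∨ f b < f y)

/-- `v`, `a`, `b` are the first, the second and the last vertex, and `v` has exactly the
neighbours `a` and `b`. -/
structure IsEar (G : SimpleGraph V) (f : V → ℝ) (v a b : V) : Prop where
  adj_left : G.Adj v a
  adj_right : G.Adj v b
  lt_left : f v < f a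
  left_lt_right : f a < f b
  mem_Icc : ∀ x, x ≠ v → f x ∈ Set.Icc (f a) (f b)
  eq_or_eq : ∀ x, G.Adj v x → x = a ∨ x = b

lemma NoncrossingOn.isGeneratedInDegree_of_hasSeparatingChord (hf : NoncrossingOn G f Set.univ)
    (hsep : HasSeparatingChord G f) (ih : ∀ A : Set V, A ≠ Set.univ →
      IsGeneratedInDegree (marginCon (fun v : A => α v) (graphComplex (G.induce A))) 4) :
    IsGeneratedInDegree (marginCon α (graphComplex G)) 4 := by
  classical
  obtain ⟨a, b, x, y, hab, ⟨hax, hxb⟩, hy⟩ := hsep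
  have not_adj_across {p q} (hp : f a < f p ∧ f p < f b) (hq : f q < f a ∨ f b < f q) :
      ¬ G.Adj p q := fun hpq => hq.elim
    (fun hqa => hf.not_cross q trivial a trivial p trivial b trivial hqa hp.1 hp.2 hpq.symm hab)
    (fun hbq => hf.not_cross a trivial p trivial b trivial q trivial hp.1 hp.2 hbq hab hpq)
  have hcover : {p | f p ∈ Set.Icc (f a) (f b)} ∪ {p | f p ≤ f a ∨ f b ≤ f p} = Set.univ := by
    ext p
    simp only [Set.mem_union, Set.mem_ofPred_eq, Set.mem_Icc, Set.mem_univ, iff_true]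
    grind
  refine isGeneratedInDegree_marginCon_of_separating_face hcover
    (subset_or_subset_of_mem_graphComplex hcover fun p q hpq => ?_) (S := {a, b})
    (mem_graphComplex_iff.2 (.inr ⟨a, b, .inr hab, rfl⟩)) ?_ (by norm_num)
    (inducedComplex_graphComplex (G := G) _ ▸ ih _ fun h => ?_)
    (inducedComplex_graphComplex (G := G) _ ▸ ih _ fun h => ?_)
  · have hpq' := not_adj_across (p := p) (q := q)
    have hqp' := not_adj_across (p := q) (q := p)
    have hqp := hpq.symm
    simp only [Set.mem_ofPred_eq, Set.mem_Icc]
    grind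
  · ext p
    have hpa : p = a ↔ f p = f a := (hf.injOn.eq_iff trivial trivial).symm
    have hpb : p = b ↔ f p = f b := (hf.injOn.eq_iff trivial trivial).symm
    simp only [Set.mem_inter_iff, Set.mem_ofPred_eq, Set.mem_Icc, Finset.coe_insert,
      Finset.coe_singleton, Set.mem_insert_iff, Set.mem_singleton_iff, hpa, hpb]
    grind
  · obtain ⟨hay, hyb⟩ : f y ∈ Set.Icc (f a) (f b) := Set.eq_univ_iff_forall.1 h y
    grind
  · have : f x ≤ f a ∨ f b ≤ f x := Set.eq_univ_iff_forall.1 h x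
    grind

lemma exists_isEar (hinj : Function.Injective f) (hsep : ¬ HasSeparatingChord G f) {v : V}
    (hv : ∀ x, f v ≤ f x) (hnbr : (G.neighborSet v).Nontrivial) : ∃ a b, IsEar G f v a b := by
  simp only [HasSeparatingChord] at hsep
  push Not at hsep
  have hmin (x : V) (hx : x ≠ v) : f v < f x := lt_of_le_of_ne (hv x) (hinj.ne hx.symm)
  obtain ⟨a, b, hva, hvb, hab⟩ : ∃ a b, G.Adj v a ∧ G.Adj v b ∧ f a < f b := by
    obtain ⟨a, ha, b, hb, hne⟩ := hnbr
    obtain h | h := lt_or_gt_of_ne (hinj.ne hne)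
    exacts [⟨a, b, ha, hb, h⟩, ⟨b, a, hb, ha, h⟩]
  have hlast (x : V) : f x ≤ f b := (hsep v b a x hvb ⟨hmin a hva.ne', hab⟩).2
  have hsecond (x : V) (hx : x ≠ v) : f a ≤ f x := by
    by_contra! hxa
    exact hab.not_ge (hsep v a x b hva ⟨hmin x hx, hxa⟩).2
  refine ⟨a, b, hva, hvb, hmin a hva.ne', hab, fun x hx => ⟨hsecond x hx, hlast x⟩, fun x hx => ?_⟩
  by_contra! hne
  have hax : f a < f x := lt_of_le_of_ne (hsecond x hx.ne') (hinj.ne hne.1.symm)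
  exact hne.2 (hinj ((hlast x).antisymm (hsep v x a b hx ⟨hmin a hva.ne', hax⟩).2))

namespace IsEar

variable {v a b : V}

lemma isGeneratedInDegree_two_induce_triple (h : IsEar G f v a b) (hinj : Function.Injective f)
    (hab : ¬ G.Adj a b) :
    IsGeneratedInDegree
      (marginCon (fun x : ({v, a, b} : Set V) => α x) (graphComplex (G.induce {v, a, b}))) 2 := by
  refine isGeneratedInDegree_two_of_lower_neighbors_subsingleton
    (hinj.comp Subtype.val_injective) ?_
  have hva := h.lt_left
  have hlt := h.left_lt_right
  rintro ⟨x, hx⟩ ⟨y, hy⟩ ⟨hxy, hyx⟩ ⟨z, hz⟩ ⟨hxz, hzx⟩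
  simp only [SimpleGraph.comap_adj, Function.Embedding.subtype_apply, Function.comp_apply,
    Subtype.mk.injEq] at *
  have hba : ¬ G.Adj b a := fun h => hab h.symm
  grind

/-- Two lower neighbours `y < z` of `x` would make `y x` a chord separating `z` from `v`. -/
lemma isGeneratedInDegree_two_induce_compl (h : IsEar G f v a b) (hinj : Function.Injective f)
    [Finite V] (hsep : ¬ HasSeparatingChord G f) :
    IsGeneratedInDegree
      (marginCon (fun x : ({v}ᶜ : Set V) => α x) (graphComplex (G.induce {v}ᶜ))) 2 := by
  refine isGeneratedInDegree_two_of_lower_neighbors_subsingleton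
    (hinj.comp Subtype.val_injective) ?_
  have not_between (x y z : V) (hy : y ≠ v) (hxy : G.Adj x y) (hzx : f z < f x) : ¬ f y < f z :=
    fun hyz => hsep ⟨y, x, z, v, hxy.symm, ⟨hyz, hzx⟩,
      .inl (h.lt_left.trans_le (h.mem_Icc y hy).1)⟩
  rintro ⟨x, hx⟩ ⟨y, hy⟩ ⟨hxy, hyx⟩ ⟨z, hz⟩ ⟨hxz, hzx⟩
  exact Subtype.ext (hinj (le_antisymm (not_lt.1 (not_between x z y hz hxz hyx))
    (not_lt.1 (not_between x y z hy hxy hzx))))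

lemma noncrossingOn_sup_edge_induce (h : IsEar G f v a b) (hf : NoncrossingOn G f Set.univ) :
    NoncrossingOn ((G ⊔ SimpleGraph.edge a b).induce {v}ᶜ) (fun x => f x) Set.univ where
  injOn x _ y _ hxy := Subtype.ext (hf.injOn trivial trivial hxy)
  not_cross := by
    rintro ⟨x, hx⟩ - ⟨y, hy⟩ - ⟨z, hz⟩ - ⟨t, ht⟩ - hxy hyz hzt hxz hyt
    have hnot := hf.not_cross x trivial y trivial z trivial t trivial
    have hx := h.mem_Icc x hx
    have ht := h.mem_Icc t ht
    simp only [SimpleGraph.comap_adj, Function.Embedding.subtype_apply, SimpleGraph.sup_adj,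
      SimpleGraph.edge_adj, Set.mem_Icc] at *
    grind

lemma adj_imp_mem (h : IsEar G f v a b) (x y : V) (hxy : G.Adj x y) :
    x ∈ ({v, a, b} : Set V) ∧ y ∈ ({v, a, b} : Set V) ∨
      x ∈ ({v}ᶜ : Set V) ∧ y ∈ ({v}ᶜ : Set V) := by
  have hx := h.eq_or_eq x
  have hy := h.eq_or_eq y
  have hyx := hxy.symm
  simp only [Set.mem_insert_iff, Set.mem_singleton_iff, Set.mem_compl_iff]
  grind

lemma isGeneratedInDegree_four (h : IsEar G f v a b) [Finite V] (hinj : Function.Injective f)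
    (hsep : ¬ HasSeparatingChord G f) (ea : α a ≃ Bool) (eb : α b ≃ Bool)
    (ih : IsGeneratedInDegree
      (marginCon (fun x : ({v}ᶜ : Set V) => α x) (graphComplex (G.induce {v}ᶜ))) 4)
    (ih_edge : IsGeneratedInDegree (marginCon (fun x : ({v}ᶜ : Set V) => α x)
      (graphComplex ((G ⊔ SimpleGraph.edge a b).induce {v}ᶜ))) 4) :
    IsGeneratedInDegree (marginCon α (graphComplex G)) 4 := by
  classical
  have hne : a ≠ b := ne_of_apply_ne f h.left_lt_right.ne
  have hcover : ({v, a, b} : Set V) ∪ {v}ᶜ = Set.univ :=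
    Set.eq_univ_iff_forall.2 fun x => by simp only [Set.mem_union, Set.mem_insert_iff,
      Set.mem_compl_iff, Set.mem_singleton_iff]; tauto
  have hinter : ({v, a, b} : Set V) ∩ {v}ᶜ = {a, b} := by
    rw [Set.insert_inter_of_notMem (by simp), Set.inter_eq_left]
    simp [h.adj_left.ne, h.adj_right.ne]
  have hfaces := subset_or_subset_of_mem_graphComplex hcover h.adj_imp_mem
  have hpath := h.isGeneratedInDegree_two_induce_triple (α := α) hinj
  have hrest := h.isGeneratedInDegree_two_induce_compl (α := α) hinj hsep
  by_cases hab : G.Adj a b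
  · have htriangle := isGeneratedInDegree_induce_triangle h.adj_left h.adj_right hab ea eb
    rw [← inducedComplex_graphComplex] at ih htriangle
    exact isGeneratedInDegree_marginCon_of_separating_face hcover hfaces
      (mem_graphComplex_iff.2 (.inr ⟨a, b, .inr hab, rfl⟩)) (by simpa using hinter)
      (by norm_num) htriangle ih
  · have htriangle := isGeneratedInDegree_induce_triangle (G := G ⊔ SimpleGraph.edge a b)
      (.inl h.adj_left) (.inl h.adj_right) (.inr (by simp [SimpleGraph.edge_adj, hne])) ea eb
    have hpath := hpath hab
    rw [← inducedComplex_graphComplex] at hpath hrest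
    rw [← inducedComplex_graphComplex, graphComplex_sup_edge hne] at ih_edge htriangle
    exact isGeneratedInDegree_marginCon_of_separating_binary_pair (singleton_mem_graphComplex a)
      (singleton_mem_graphComplex b) hcover hfaces hinter ea eb (by norm_num) hpath hrest
      htriangle ih_edge

end IsEar

theorem isGeneratedInDegree_four_of_noncrossingOn {V : Type u} [Finite V] {G : SimpleGraph V}
    {α : V → Type*} {f : V → ℝ} (hf : NoncrossingOn G f Set.univ) {I : Set V} (hI : G.IsIndepSet I)
    (hα : ∀ v ∉ I, Nonempty (α v ≃ Bool)) :
    IsGeneratedInDegree (marginCon α (graphComplex G)) 4 := by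
  induction hn : Nat.card V using Nat.strong_induction_on generalizing V with
  | _ n ih =>
  have hinduce (A : Set V) (hA : A ≠ Set.univ) (H : SimpleGraph V) (g : V → ℝ)
      (hH : NoncrossingOn (H.induce A) (fun x => g x) Set.univ) (hHI : H.IsIndepSet I) :
      IsGeneratedInDegree (marginCon (fun x : A => α x) (graphComplex (H.induce A))) 4 :=
    ih _ (hn ▸ Set.ncard_lt_card hA) hH (I := Subtype.val ⁻¹' I)
      (fun x hx y hy hxy => hHI hx hy (Subtype.coe_ne_coe.2 hxy)) (fun x hx => hα x hx) rfl
  obtain hV | hV := isEmpty_or_nonempty V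
  · exact isGeneratedInDegree_graphComplex_of_isEmpty
  by_cases hleaf : ∃ m, (G.neighborSet m).Subsingleton
  · obtain ⟨m, hm⟩ := hleaf
    exact isGeneratedInDegree_graphComplex_of_leaf hm (by norm_num)
      (hinduce _ (by simp) G f (hf.induce _) hI)
  obtain ⟨v, hvI⟩ : ∃ v, v ∈ I ∨ I = ∅ := by
    obtain rfl | ⟨v, hv⟩ := I.eq_empty_or_nonempty
    exacts [⟨Classical.arbitrary V, .inr rfl⟩, ⟨v, .inl hv⟩]
  obtain ⟨g, hg, hv⟩ := hf.exists_rotate Set.finite_univ (Set.mem_univ v)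
  have hinj : Function.Injective g := fun x y h => hg.injOn trivial trivial h
  by_cases hsep : HasSeparatingChord G g
  · exact hg.isGeneratedInDegree_of_hasSeparatingChord hsep
      fun A hA => hinduce A hA G g (hg.induce A) hI
  obtain ⟨a, b, hear⟩ := exists_isEar hinj hsep (fun x => hv x trivial)
    (Set.not_subsingleton_iff.1 (not_exists.1 hleaf v))
  have hbinary (x : V) (hx : G.Adj v x) : x ∉ I := fun hxI =>
    hvI.elim (fun hvI => hI hvI hxI hx.ne hx) (fun hI => (hI ▸ hxI : x ∈ (∅ : Set V)))
  obtain ⟨ea⟩ := hα a (hbinary a hear.adj_left)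
  obtain ⟨eb⟩ := hα b (hbinary b hear.adj_right)
  have hindep : (G ⊔ SimpleGraph.edge a b).IsIndepSet I := by
    rintro x hx y hy hxy (h | h)
    · exact hI hx hy hxy h
    · obtain ⟨rfl, -⟩ | ⟨-, rfl⟩ := ((SimpleGraph.edge_adj ..).1 h).1
      exacts [hbinary _ hear.adj_left hx, hbinary _ hear.adj_left hy]
  exact hear.isGeneratedInDegree_four hinj hsep ea eb
    (hinduce _ (by simp) G g (hg.induce _) hI)
    (hinduce _ (by simp) _ g (hear.noncrossingOn_sup_edge_induce hg) hindep)

end NoncrossingModel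

/-! ### Toric ideals -/

section Toric

open MvPolynomial

variable {σ τ K : Type*} [Field K] {k : ℕ}

/-- The monomial with a given multiset of variables. -/
noncomputable def mon (K : Type*) [Field K] {σ : Type*} (T : Multiset σ) : MvPolynomial σ K :=
  (T.map X).prod

lemma mon_zero : mon K (0 : Multiset σ) = 1 := by
  rw [mon, Multiset.map_zero, Multiset.prod_zero]

lemma mon_singleton (x : σ) : mon K {x} = X x := by
  rw [mon, Multiset.map_singleton, Multiset.prod_singleton]

lemma mon_add (T U : Multiset σ) : mon K (T + U) = mon K T * mon K U := by
  rw [mon, Multiset.map_add, Multiset.prod_add, mon, mon]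

lemma mon_toMultiset (s : σ →₀ ℕ) : mon K (Finsupp.toMultiset s) = monomial s 1 := by
  rw [mon, Finsupp.toMultiset_map, Finsupp.prod_toMultiset, monomial_eq, C_1, one_mul,
    Finsupp.prod_mapDomain_index (fun _ => pow_zero _) fun _ => pow_add _]

lemma monomial_eq_smul_mon (s : σ →₀ ℕ) (a : K) :
    monomial s a = a • mon K (Finsupp.toMultiset s) := by
  rw [mon_toMultiset, smul_monomial, smul_eq_mul, mul_one]

lemma coeff_mon [DecidableEq (Multiset σ)] (s : σ →₀ ℕ) (T : Multiset σ) :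
    coeff s (mon K T) = if T = Finsupp.toMultiset s then 1 else 0 := by
  classical
  obtain ⟨t, rfl⟩ : ∃ t, Finsupp.toMultiset t = T := ⟨_, Multiset.toFinsupp_toMultiset T⟩
  rw [mon_toMultiset, coeff_monomial]
  exact if_congr Multiset.toFinsupp.symm.injective.eq_iff.symm rfl rfl

lemma isHomogeneous_mon (T : Multiset σ) : (mon K T).IsHomogeneous T.card := by
  classical
  rw [← Multiset.toFinsupp_toMultiset T, mon_toMultiset, Multiset.toFinsupp_toMultiset]
  exact isHomogeneous_monomial _ (Multiset.toFinsupp_sum_eq T)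

/-- The homomorphism that sends the monomial of each multiset `T` to the monomial of `m T`. -/
noncomputable def monomialHom (K : Type*) [Field K] (m : Multiset σ →+ Multiset τ) :
    MvPolynomial σ K →ₐ[K] MvPolynomial τ K :=
  aeval fun x => mon K (m {x})

variable {c : AddCon (Multiset σ)} {m : Multiset σ →+ Multiset τ} {T U : Multiset σ}

lemma monomialHom_mon (T : Multiset σ) : monomialHom K m (mon K T) = mon K (m T) := by
  induction T using Multiset.induction with
  | empty => rw [map_zero, mon_zero, mon_zero, map_one]
  | cons x T ih =>
    rw [← Multiset.singleton_add, mon_add, map_mul, ih, mon_singleton, monomialHom, aeval_X,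
      map_add, mon_add]

/-- The binomials of degree at most `k` that belong to pairs of congruent multisets. -/
def shortBinomials (K : Type*) [Field K] (c : AddCon (Multiset σ)) (k : ℕ) :
    Set (MvPolynomial σ K) :=
  {g | ∃ T U, T.card ≤ k ∧ U.card ≤ k ∧ c T U ∧ g = mon K T - mon K U}

lemma mon_sub_mon_mem_span_of_linked (h : Linked c k T U) :
    mon K T - mon K U ∈ Ideal.span (shortBinomials K c k) := by
  induction h with
  | refl => simp only [sub_self, zero_mem]
  | tail _ hmove ih =>
    obtain ⟨A, B, C, hA, hB, hAB, rfl, rfl⟩ := hmove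
    have hmem : mon K A - mon K B ∈ shortBinomials K c k := ⟨A, B, hA, hB, hAB, rfl⟩
    have := Ideal.mul_mem_right (mon K C) _ (Ideal.subset_span hmem)
    rw [sub_mul, ← mon_add, ← mon_add] at this
    simpa only [sub_add_sub_cancel] using add_mem ih this

lemma mon_sub_mon_mem_ker (h : m T = m U) :
    mon K T - mon K U ∈ RingHom.ker (monomialHom K m) := by
  rw [RingHom.mem_ker, map_sub, monomialHom_mon, monomialHom_mon, h, sub_self]

/-- Modulo `J`, the `K`-linear map that sends the monomial of `m T` back to the monomial of one
chosen element of the fibre of `T` inverts `monomialHom K m`. -/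
lemma ker_monomialHom_le {J : Ideal (MvPolynomial σ K)}
    (hJ : ∀ T U, m T = m U → mon K T - mon K U ∈ J) : RingHom.ker (monomialHom K m) ≤ J := by
  classical
  let choice : Multiset τ → MvPolynomial σ K := Function.extend m (mon K) 0
  let ρ := (basisMonomials τ K).constr K fun t => choice (Finsupp.toMultiset t)
  have sub_choice_mem (T) : mon K T - choice (m T) ∈ J := by
    have hT : ∃ U, m U = m T := ⟨T, rfl⟩
    rw [show choice (m T) = mon K hT.choose from dif_pos hT]
    exact hJ _ _ hT.choose_spec.symm
  have ρ_mon (T : Multiset τ) : ρ (mon K T) = choice T := by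
    obtain ⟨t, rfl⟩ : ∃ t, Finsupp.toMultiset t = T := ⟨_, Multiset.toFinsupp_toMultiset T⟩
    rw [mon_toMultiset]
    exact (basisMonomials τ K).constr_basis K _ t
  have sub_mem (p) : p - ρ (monomialHom K m p) ∈ J := by
    induction p using MvPolynomial.induction_on' with
    | monomial s a =>
      rw [monomial_eq_smul_mon, map_smul, map_smul, monomialHom_mon, ρ_mon, ← smul_sub]
      exact Submodule.smul_of_tower_mem J a (sub_choice_mem _)
    | add p q hp hq =>
      rw [map_add, map_add, add_sub_add_comm]
      exact add_mem hp hq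
  intro p hp
  simpa only [RingHom.mem_ker.1 hp, map_zero, sub_zero] using sub_mem p

theorem span_shortBinomials_eq_ker (h : IsGeneratedInDegree (AddCon.ker m) k) :
    Ideal.span (shortBinomials K (AddCon.ker m) k) = RingHom.ker (monomialHom K m) := by
  refine le_antisymm (Ideal.span_le.2 ?_)
    (ker_monomialHom_le fun T U hTU => mon_sub_mon_mem_span_of_linked (h hTU))
  rintro _ ⟨T, U, -, -, hTU, rfl⟩
  exact mon_sub_mon_mem_ker hTU

end Toric

section GeneratorDegree

open MvPolynomial

variable {σ τ K : Type*} [Field K] {k : ℕ} {I : Ideal (MvPolynomial σ K)}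
  {S B : Set (MvPolynomial σ K)}

lemma map_mem_of_mem_span {M : Type*} [AddCommMonoid M] (L : MvPolynomial σ K →+ M)
    {N : AddSubmonoid M} (h : ∀ s ∈ S, ∀ t a, L (monomial t a * s) ∈ N)
    {p : MvPolynomial σ K} (hp : p ∈ Ideal.span S) : L p ∈ N := by
  suffices ∀ q, L (q * p) ∈ N by simpa only [one_mul] using this 1
  induction hp using Submodule.span_induction with
  | mem s hs =>
    intro q
    induction q using MvPolynomial.induction_on' with
    | monomial t a => exact h s hs t a
    | add q r hq hr => simpa only [add_mul, map_add] using add_mem hq hr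
  | zero => simp only [mul_zero, map_zero, zero_mem, implies_true]
  | add x y _ _ hx hy => exact fun q => by simpa only [mul_add, map_add] using add_mem (hx q) (hy q)
  | smul b x _ hx => exact fun q => by simpa only [smul_eq_mul, mul_assoc] using hx (q * b)

lemma homogeneousComponent_mem_span_totalDegree_le (hS : ∀ f ∈ S, ∃ n, f.IsHomogeneous n) {n : ℕ}
    {p : MvPolynomial σ K} (hp : p ∈ Ideal.span S) :
    homogeneousComponent n p ∈ Ideal.span {f ∈ S | f.totalDegree ≤ n} := by
  refine map_mem_of_mem_span (homogeneousComponent n).toAddMonoidHom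
    (N := (Ideal.span {f ∈ S | f.totalDegree ≤ n}).toAddSubmonoid) (fun s hs t a => ?_) hp
  obtain ⟨d, hd⟩ := hS s hs
  have hts : (monomial t a * s).IsHomogeneous (t.degree + d) :=
    (isHomogeneous_monomial a rfl).mul hd
  rw [LinearMap.toAddMonoidHom_coe, homogeneousComponent_of_mem hts]
  split_ifs with hn
  · have hmem : s ∈ {f ∈ S | f.totalDegree ≤ n} := ⟨hs, hd.totalDegree_le.trans (by omega)⟩
    exact Ideal.mul_mem_left _ _ (Ideal.subset_span hmem)
  · exact zero_mem _

lemma totalDegree_le_maxGeneratorDegree (hS : Minimal (IsHomogeneousGenerating I) S)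
    {f : MvPolynomial σ K} (hf : f ∈ S) : (f.totalDegree : ℕ∞) ≤ maxGeneratorDegree I :=
  le_trans (le_iSup₂ (f := fun f (_ : f ∈ S) => (f.totalDegree : ℕ∞)) f hf)
    (le_iSup₂ (f := fun S (_ : Minimal (IsHomogeneousGenerating I) S) =>
      ⨆ f ∈ S, (f.totalDegree : ℕ∞)) S hS)

theorem maxGeneratorDegree_le (hB : ∀ g ∈ B, ∃ n ≤ k, g.IsHomogeneous n)
    (hI : Ideal.span B = I) : maxGeneratorDegree I ≤ k := by
  refine iSup₂_le fun S hS => iSup₂_le fun f hf => ?_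
  have hgen : IsHomogeneousGenerating I {f ∈ S | f.totalDegree ≤ k} := by
    refine ⟨fun s hs => hS.prop.1 s hs.1, le_antisymm ?_ ?_⟩
    · exact (Ideal.span_mono fun _ hs => hs.1).trans hS.prop.2.le
    · rw [← hI, Ideal.span_le]
      intro g hg
      obtain ⟨n, hn, hgn⟩ := hB g hg
      have hgS : g ∈ Ideal.span S := hS.prop.2.trans hI.symm ▸ Ideal.subset_span hg
      have := homogeneousComponent_mem_span_totalDegree_le hS.prop.1 (n := n) hgS
      rw [homogeneousComponent_of_mem hgn, if_pos rfl] at this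
      exact Ideal.span_mono (fun s hs => And.intro hs.1 (hs.2.trans hn)) this
  exact Nat.cast_le.2 (hS.le_of_le hgen (fun _ hs => hs.1) hf).2

lemma exists_minimal_isHomogeneousGenerating [Finite σ] (hB : IsHomogeneousGenerating I B) :
    ∃ S, Minimal (IsHomogeneousGenerating I) S := by
  obtain ⟨B₀, hB₀, hspan⟩ := (Submodule.fg_span_iff_fg_span_finset_subset B).1
    (IsNoetherian.noetherian (Ideal.span B))
  have hgen : IsHomogeneousGenerating I (B₀ : Set (MvPolynomial σ K)) :=
    ⟨fun f hf => hB.1 f (hB₀ hf), hspan.symm.trans hB.2⟩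
  have hfin : {S : Set (MvPolynomial σ K) | S ⊆ B₀ ∧ IsHomogeneousGenerating I S}.Finite :=
    B₀.finite_toSet.finite_subsets.subset fun S hS => hS.1
  obtain ⟨S, -, hS⟩ := hfin.exists_le_minimal (a := (B₀ : Set (MvPolynomial σ K)))
    (And.intro subset_rfl hgen)
  exact ⟨S, hS.prop.2, fun S' hS' hle => hS.le_of_le ⟨hle.trans hS.prop.1, hS'⟩ hle⟩

variable {m : Multiset σ →+ Multiset τ} {u : Multiset σ}

lemma isHomogeneousGenerating_binomials (hcard : ∀ T U, m T = m U → T.card = U.card) :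
    IsHomogeneousGenerating (RingHom.ker (monomialHom K m))
      {g | ∃ T U, m T = m U ∧ g = mon K T - mon K U} := by
  refine ⟨?_, le_antisymm (Ideal.span_le.2 ?_) ?_⟩
  · rintro _ ⟨T, U, hTU, rfl⟩
    exact ⟨T.card, (isHomogeneous_mon T).sub (hcard T U hTU ▸ isHomogeneous_mon U)⟩
  · rintro _ ⟨T, U, hTU, rfl⟩
    exact mon_sub_mon_mem_ker hTU
  · exact ker_monomialHom_le fun T U hTU => Ideal.subset_span ⟨T, U, hTU, rfl⟩

lemma coeff_eq_zero_of_mem_ker {w : σ →₀ ℕ}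
    (hw : ∀ T, m T = m (Finsupp.toMultiset w) → T = Finsupp.toMultiset w)
    {p : MvPolynomial σ K} (hp : p ∈ RingHom.ker (monomialHom K m)) : coeff w p = 0 := by
  classical
  have coeff_eq (p) :
      coeff w p = coeff (m (Finsupp.toMultiset w)).toFinsupp (monomialHom K m p) := by
    induction p using MvPolynomial.induction_on' with
    | monomial s a =>
      simp only [monomial_eq_smul_mon, map_smul, monomialHom_mon, coeff_smul, coeff_mon,
        Multiset.toFinsupp_toMultiset]
      exact congrArg _ (if_congr ⟨congrArg m, hw _⟩ rfl rfl)
    | add p q hp hq => rw [map_add, coeff_add, coeff_add, hp, hq]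
  rw [coeff_eq, RingHom.mem_ker.1 hp, coeff_zero]

/-- After removing some variables of `u`, nothing else is left in the fibre. -/
lemma coeff_monomial_mul_eq_zero [DecidableEq σ] (hu : ∀ w, m w = m u → w = u ∨ Disjoint w u)
    {p : MvPolynomial σ K} (hp : p ∈ RingHom.ker (monomialHom K m)) (hpu : p.totalDegree < u.card)
    (t : σ →₀ ℕ) (a : K) : coeff u.toFinsupp (monomial t a * p) = 0 := by
  rw [coeff_monomial_mul']
  split_ifs with ht
  swap
  · rfl
  obtain ⟨w, hw⟩ := exists_add_of_le ht
  have hwt : Finsupp.toMultiset w + Finsupp.toMultiset t = u := by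
    rw [← Finsupp.toMultiset_add, add_comm, ← hw, Multiset.toFinsupp_toMultiset]
  rw [hw, add_tsub_cancel_left]
  obtain rfl | ht0 := eq_or_ne t 0
  · rw [map_zero, add_zero] at hwt
    rw [coeff_eq_zero_of_totalDegree_lt, mul_zero]
    rwa [← hwt, Finsupp.card_toMultiset] at hpu
  · rw [coeff_eq_zero_of_mem_ker (fun T hT => ?_) hp, mul_zero]
    have hfib : m (T + Finsupp.toMultiset t) = m u := by rw [map_add, hT, ← map_add, hwt]
    obtain h | h := hu _ hfib
    · exact add_right_cancel (h.trans hwt.symm)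
    · rw [← hwt, Multiset.disjoint_add_left, Multiset.disjoint_add_right,
        Multiset.disjoint_add_right, disjoint_self] at h
      exact absurd (Multiset.toFinsupp.symm.map_eq_zero_iff.1 h.2.2) ht0

/-- The coefficient of `u` vanishes on the ideal generated by the elements of the kernel of degree
less than `u.card`, but not on the binomial of `u` and `v`. -/
theorem lt_maxGeneratorDegree [Finite σ] (hcard : ∀ T U, m T = m U → T.card = U.card)
    (hu : ∀ w, m w = m u → w = u ∨ Disjoint w u) (hk : k < u.card) {v : Multiset σ}
    (hv : m v = m u) (hvu : v ≠ u) :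
    k < maxGeneratorDegree (RingHom.ker (monomialHom K m)) := by
  classical
  by_contra! hle
  obtain ⟨S, hS⟩ :=
    exists_minimal_isHomogeneousGenerating (isHomogeneousGenerating_binomials (K := K) hcard)
  have hdeg (s) (hs : s ∈ S) : s.totalDegree < u.card :=
    (Nat.cast_le.1 ((totalDegree_le_maxGeneratorDegree hS hs).trans hle)).trans_lt hk
  have hker (s) (hs : s ∈ S) : s ∈ RingHom.ker (monomialHom K m) :=
    hS.prop.2 ▸ Ideal.subset_span hs
  have hspan : mon K u - mon K v ∈ Ideal.span S := hS.prop.2 ▸ mon_sub_mon_mem_ker hv.symm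
  have hcoeff : coeff u.toFinsupp (mon K u - mon K v) = 0 :=
    map_mem_of_mem_span (coeffAddMonoidHom _) (N := ⊥)
      (fun s hs => coeff_monomial_mul_eq_zero hu (hker s hs) (hdeg s hs)) hspan
  simp [coeff_mon, hvu] at hcoeff

end GeneratorDegree

section GraphToric

lemma card_eq_of_marginCon_graphComplex {V : Type*} {α : V → Type*} {G : SimpleGraph V}
    {T U : Multiset (∀ v, α v)} (h : marginCon α (graphComplex G) T U) : T.card = U.card := by
  classical
  simpa only [Multiset.card_map] using
    congrArg Multiset.card (h ∅ (mem_graphComplex_iff.2 (.inl rfl)))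

open MvPolynomial

variable {V : Type u} [Finite V] {Γ : LowerSet (Finset V)} {d : V → ℕ} {k : ℕ}

/-- The facets of a complex, which index the blocks of parameters of `toricHom`. -/
abbrev Facet {V : Type*} (Γ : LowerSet (Finset V)) :=
  {F : Finset V // Maximal (fun A : Finset V => A ∈ Γ) F}

noncomputable instance : Fintype (Facet Γ) := Fintype.ofFinite _

lemma count_sigma_univ {ι : Type*} [Fintype ι] {β : ι → Type*} [DecidableEq (Sigma β)] (i : ι)
    [DecidableEq (β i)] (t : ∀ i, Multiset (β i)) (b : β i) :
    (Finset.univ.val.sigma t).count ⟨i, b⟩ = (t i).count b := by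
  classical
  rw [Multiset.sigma, Multiset.count_bind]
  refine (Finset.sum_eq_single i (fun a _ hai => Multiset.count_eq_zero.2 fun hmem => ?_)
    (fun hi => absurd (Finset.mem_univ i) hi)).trans
    (Multiset.count_map_eq_count' _ _ sigma_mk_injective b)
  obtain ⟨x, -, hx⟩ := Multiset.mem_map.1 hmem
  exact hai (congrArg Sigma.fst hx)

/-- The exponents of the toric homomorphism: the entries of a contingency table are replaced by
their restrictions to all facets of `Γ`, which index the parameters. -/
noncomputable def parameters (Γ : LowerSet (Finset V)) (d : V → ℕ) :
    Multiset (∀ w, Fin (d w)) →+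
      Multiset (Σ F : Facet Γ, ((w : {x : V // x ∈ F.1}) → Fin (d w.1))) :=
  { toFun T := Finset.univ.val.sigma fun F => T.map F.1.restrict
    map_zero' := Multiset.bind_zero _
    map_add' T U := by simp only [Multiset.map_add, Multiset.sigma_add] }

lemma toricHom_eq_monomialHom (K : Type v) [Field K] (Γ : LowerSet (Finset V)) (d : V → ℕ) :
    toricHom K Γ d = monomialHom K (parameters Γ d) := by
  refine algHom_ext fun i => ?_
  rw [toricHom, aeval_X, finprod_eq_prod_of_fintype, monomialHom, aeval_X, mon, parameters]
  simp only [AddMonoidHom.coe_mk, ZeroHom.coe_mk, Multiset.sigma, Multiset.map_singleton,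
    Multiset.bind_singleton, Multiset.map_map]
  rfl

lemma ker_parameters (Γ : LowerSet (Finset V)) (d : V → ℕ) :
    AddCon.ker (parameters Γ d) = marginCon (fun w => Fin (d w)) Γ := by
  classical
  ext T U
  refine ⟨fun h F hF => ?_, fun h => ?_⟩
  · obtain ⟨F', hle, hF'⟩ := Finite.exists_le_maximal (p := (· ∈ Γ)) hF
    refine map_eq_map_of_factors (g := F'.restrict (π := fun w => Fin (d w)))
      (fun x y hxy => ?_) (Multiset.ext.2 fun j => ?_)
    · exact funext fun v => congrFun hxy ⟨v, hle v.2⟩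
    · have hcount (T) : (parameters Γ d T).count ⟨⟨F', hF'⟩, j⟩ = (T.map F'.restrict).count j :=
        count_sigma_univ (⟨F', hF'⟩ : Facet Γ) (fun F => T.map F.1.restrict) j
      rw [← hcount, ← hcount, h]
  · exact congrArg Finset.univ.val.sigma (funext fun F => h F.1 F.2.prop)

theorem markovWidth_le (K : Type v) [Field K] {G : SimpleGraph V}
    (h : IsGeneratedInDegree (marginCon (fun w => Fin (d w)) (graphComplex G)) k) :
    markovWidth K G d ≤ k := by
  rw [markovWidth, toricIdeal, toricHom_eq_monomialHom]
  rw [← ker_parameters] at h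
  refine maxGeneratorDegree_le ?_ (span_shortBinomials_eq_ker h)
  rintro _ ⟨T, U, hT, -, hTU, rfl⟩
  rw [ker_parameters] at hTU
  exact ⟨T.card, hT, (isHomogeneous_mon T).sub
    (card_eq_of_marginCon_graphComplex hTU ▸ isHomogeneous_mon U)⟩

theorem lt_markovWidth (K : Type v) [Field K] {G : SimpleGraph V}
    {T T' : Multiset (∀ w, Fin (d w))} (hk : k < T.card)
    (hT : ∀ U, marginCon _ (graphComplex G) U T → U = T ∨ Disjoint U T)
    (hT' : marginCon _ (graphComplex G) T' T) (hne : T' ≠ T) : k < markovWidth K G d := by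
  rw [markovWidth, toricIdeal, toricHom_eq_monomialHom]
  rw [← ker_parameters] at hT hT'
  refine lt_maxGeneratorDegree (fun A B h => ?_) hT hk hT' hne
  exact card_eq_of_marginCon_graphComplex (G := G) (ker_parameters _ d ▸ h)

theorem isMarkovSlim_of_noncrossingOn (K : Type v) [Field K] {G : SimpleGraph V} {f : V → ℝ}
    (hf : NoncrossingOn G f Set.univ) : IsMarkovSlim K G := by
  intro I hI d _ hd
  refine markovWidth_le K (isGeneratedInDegree_four_of_noncrossingOn hf hI fun w hw => ?_)
  rw [hd w hw]
  exact ⟨finTwoEquiv⟩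

end GraphToric

/-! ### Two graphs that are not Markov slim -/

section Forbidden

variable {V : Type u} {G : SimpleGraph V} {β γ : Type*}

lemma map_pair_eq_of_marginCon {α : V → Type*} {T U : Multiset (∀ v, α v)}
    (h : marginCon α (graphComplex G) T U) {a b : V} (hab : G.Adj a b) :
    T.map (fun x => (x a, x b)) = U.map fun x => (x a, x b) := by
  classical
  refine map_eq_map_of_marginCon h (mem_graphComplex_iff.2 (.inr ⟨a, b, .inr hab, rfl⟩))
    fun x y hxy => ?_
  rw [hxy a (by simp), hxy b (by simp)]

lemma marginCon_graphComplex_of_forall_pair {α : V → Type*} {T U : Multiset (∀ v, α v)}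
    (hcard : T.card = U.card) (hpair : ∀ a b, a = b ∨ G.Adj a b →
      T.map (fun x => (x a, x b)) = U.map fun x => (x a, x b)) :
    marginCon α (graphComplex G) T U := by
  classical
  intro F hF
  obtain rfl | ⟨a, b, hab, rfl⟩ := mem_graphComplex_iff.1 hF
  · have (x : ∀ v, α v) : (∅ : Finset V).restrict x = isEmptyElim := Subsingleton.elim _ _
    simp only [this, Multiset.map_const', hcard]
  · refine map_eq_map_of_factors (fun x y hxy => funext fun ⟨v, hv⟩ => ?_) (hpair a b hab)
    obtain rfl | rfl : v = a ∨ v = b := by simpa using hv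
    exacts [congrArg Prod.fst hxy, congrArg Prod.snd hxy]

lemma lt_markovWidth_of_map (K : Type v) [Field K] [Finite V] {d : V → ℕ} {k : ℕ}
    {cell : β → ∀ w, Fin (d w)} (hcell : Function.Injective cell) {T T' : Multiset β}
    (hk : k < T.card)
    (hrange : ∀ U, marginCon _ (graphComplex G) U (T.map cell) → ∃ P : Multiset β, P.map cell = U)
    (hfib : ∀ P : Multiset β, marginCon _ (graphComplex G) (P.map cell) (T.map cell) →
      P = T ∨ Disjoint P T)
    (hT' : marginCon _ (graphComplex G) (T'.map cell) (T.map cell)) (hne : T' ≠ T) :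
    k < markovWidth K G d := by
  refine lt_markovWidth K (T := T.map cell) (by rwa [Multiset.card_map]) (fun U hU => ?_) hT'
    ((Multiset.map_injective hcell).ne hne)
  obtain ⟨P, rfl⟩ := hrange U hU
  refine (hfib P hU).imp (congrArg _) fun h => ?_
  rw [Multiset.disjoint_map_map]
  exact fun x hx y hy hxy => Multiset.disjoint_left.1 h hx (hcell hxy ▸ hy)

lemma sum_ite_count_eq_of_map_eq [Fintype β] [DecidableEq β] [DecidableEq γ] {g : β → γ}
    {P T : Multiset β} (h : P.map g = T.map g) (y : γ) :
    ∑ x, (if g x = y then P.count x else 0) = (T.map g).count y := by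
  rw [← Finset.sum_filter, ← count_map_eq_sum, h]

lemma eq_or_disjoint_of_count [DecidableEq β] {P T : Multiset β} (hcard : P.card = T.card)
    (h : (∀ x ∈ T, P.count x = 0) ∨ ∀ x ∈ T, P.count x = T.count x) : P = T ∨ Disjoint P T := by
  obtain h | h := h
  · exact .inr (Multiset.disjoint_right.2 fun hx => Multiset.count_eq_zero.1 (h _ hx))
  · refine .inl (Multiset.eq_of_le_of_card_le (Multiset.le_iff_count.2 fun x => ?_) hcard.le).symm
    by_cases hx : x ∈ T
    · exact (h x hx).ge
    · exact (Multiset.count_eq_zero.2 hx).trans_le (Nat.zero_le _)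

end Forbidden

section CompleteFour

/-- The cells of the binary model on four vertices. -/
def cellFour (x : Fin 2 × Fin 2 × Fin 2 × Fin 2) (w : ULift.{u} (Fin 4)) : Fin 2 :=
  ![x.1, x.2.1, x.2.2.1, x.2.2.2] w.down

lemma cellFour_bijective : Function.Bijective cellFour.{u} := by
  refine Function.bijective_iff_has_inverse.2 ⟨fun y => (y ⟨0⟩, y ⟨1⟩, y ⟨2⟩, y ⟨3⟩), fun x => rfl,
    fun y => funext fun ⟨i⟩ => ?_⟩
  fin_cases i <;> rfl

/-- One observation for each one-element subset of the vertex set, and two for the full set. -/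
def tableFour : Multiset (Fin 2 × Fin 2 × Fin 2 × Fin 2) :=
  {(1, 0, 0, 0), (0, 1, 0, 0), (0, 0, 1, 0), (0, 0, 0, 1), (1, 1, 1, 1), (1, 1, 1, 1)}

/-- The other table with the margins of `tableFour`: the complements of its entries. -/
def tableFourCompl : Multiset (Fin 2 × Fin 2 × Fin 2 × Fin 2) :=
  {(0, 1, 1, 1), (1, 0, 1, 1), (1, 1, 0, 1), (1, 1, 1, 0), (0, 0, 0, 0), (0, 0, 0, 0)}

lemma marginCon_tableFourCompl :
    marginCon _ (graphComplex (⊤ : SimpleGraph (ULift.{u} (Fin 4))))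
      (tableFourCompl.map cellFour) (tableFour.map cellFour) := by
  refine marginCon_graphComplex_of_forall_pair rfl ?_
  rintro ⟨i⟩ ⟨j⟩ -
  rw [Multiset.map_map, Multiset.map_map]
  revert i j
  decide

/-- The margins are linear equations for the counts, which leave only the two tables. -/
lemma eq_or_disjoint_tableFour {P : Multiset (Fin 2 × Fin 2 × Fin 2 × Fin 2)}
    (h : marginCon _ (graphComplex (⊤ : SimpleGraph (ULift.{u} (Fin 4))))
      (P.map cellFour) (tableFour.map cellFour)) :
    P = tableFour ∨ Disjoint P tableFour := by
  have hcard : P.card = tableFour.card := by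
    simpa only [Multiset.card_map] using card_eq_of_marginCon_graphComplex h
  have hmargin (i j : Fin 4) (hij : i ≠ j) := sum_ite_count_eq_of_map_eq
    (g := fun x => (cellFour.{u} x ⟨i⟩, cellFour.{u} x ⟨j⟩)) (P := P) (T := tableFour) <| by
      simpa only [Multiset.map_map, Function.comp_def] using
        map_pair_eq_of_marginCon h (a := ⟨i⟩) (b := ⟨j⟩) fun he => hij (congrArg ULift.down he)
  have e₁ := hmargin 0 1 (by decide)
  have e₂ := hmargin 0 2 (by decide)
  have e₃ := hmargin 0 3 (by decide)
  have e₄ := hmargin 1 2 (by decide)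
  have e₅ := hmargin 1 3 (by decide)
  have e₆ := hmargin 2 3 (by decide)
  clear hmargin h
  simp [Fintype.sum_prod_type, cellFour, tableFour, Multiset.count_cons,
    Multiset.count_singleton] at e₁ e₂ e₃ e₄ e₅ e₆
  have hfull : P.count (1, 1, 1, 1) = 0 ∨ P.count (1, 1, 1, 1) = 2 := by omega
  refine eq_or_disjoint_of_count hcard (hfull.imp (fun h0 => ?_) fun h2 => ?_) <;>
  · simp [tableFour, Multiset.count_cons, Multiset.count_singleton, -Multiset.count_eq_zero]
    omega

theorem not_isMarkovSlim_completeFour (K : Type v) [Field K] :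
    ¬ IsMarkovSlim K (⊤ : SimpleGraph (ULift.{u} (Fin 4))) := by
  intro h
  refine (h ∅ (Set.pairwise_empty _) (fun _ => 2) (fun _ hw => hw.elim) fun _ _ => rfl).not_gt ?_
  refine lt_markovWidth_of_map (k := 4) K cellFour_bijective.1 (by decide) (fun U _ => ?_)
    (fun P => eq_or_disjoint_tableFour) marginCon_tableFourCompl (by decide)
  exact Multiset.map_surjective_of_surjective cellFour_bijective.2 U

end CompleteFour

section CompleteBipartiteTwoThree

/-- Three levels on the side with two vertices and two levels on the other side. -/
abbrev levelsTwoThree : ULift.{u} (Fin 2) ⊕ ULift.{u} (Fin 3) → ℕ :=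
  Sum.elim (fun _ => 3) fun _ => 2

/-- The cell that encodes an edge `(a, b)` of `K_{3,3}` with a colour `x`: the last two binary
coordinates indicate whether `a = 1` and whether `a = 2`. -/
def cellTwoThree (e : Fin 3 × Fin 3 × Fin 2) :
    ∀ w : ULift.{u} (Fin 2) ⊕ ULift.{u} (Fin 3), Fin (levelsTwoThree w)
  | .inl i => (![e.1, e.2.1] i.down : Fin 3)
  | .inr i => (![e.2.2, if 1 = e.1 then 1 else 0, if 2 = e.1 then 1 else 0] i.down : Fin 2)

lemma cellTwoThree_injective : Function.Injective cellTwoThree.{u} :=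
  Function.LeftInverse.injective (g := fun y => (y (.inl ⟨0⟩), y (.inl ⟨1⟩), y (.inr ⟨0⟩)))
    fun _ => rfl

/-- The edges of a hexagon in `K_{3,3}`, coloured alternately. -/
def hexagon : Multiset (Fin 3 × Fin 3 × Fin 2) :=
  {(0, 0, 0), (0, 1, 1), (1, 1, 0), (1, 2, 1), (2, 0, 1), (2, 2, 0)}

/-- `hexagon` with the two colours exchanged. -/
def hexagonSwap : Multiset (Fin 3 × Fin 3 × Fin 2) :=
  {(0, 0, 1), (0, 1, 0), (1, 1, 1), (1, 2, 0), (2, 0, 0), (2, 2, 1)}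

lemma marginCon_hexagonSwap :
    marginCon _ (graphComplex (completeBipartiteGraph (ULift.{u} (Fin 2)) (ULift.{u} (Fin 3))))
      (hexagonSwap.map cellTwoThree) (hexagon.map cellTwoThree) := by
  refine marginCon_graphComplex_of_forall_pair rfl ?_
  rintro (⟨i⟩ | ⟨i⟩) (⟨j⟩ | ⟨j⟩) hij <;> rw [Multiset.map_map, Multiset.map_map]
  · obtain rfl : i = j := by simpa using hij
    clear hij
    revert i
    decide
  · clear hij
    revert i j
    decide
  · clear hij
    revert i j
    decide
  · obtain rfl : i = j := by simpa using hij
    clear hij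
    revert i
    decide

lemma exists_map_cellTwoThree_eq {U : Multiset (∀ w, Fin (levelsTwoThree.{u} w))}
    (h : marginCon _
      (graphComplex (completeBipartiteGraph (ULift.{u} (Fin 2)) (ULift.{u} (Fin 3))))
      U (hexagon.map cellTwoThree)) :
    ∃ P : Multiset (Fin 3 × Fin 3 × Fin 2), P.map cellTwoThree = U := by
  refine ⟨U.map fun y => (y (.inl ⟨0⟩), y (.inl ⟨1⟩), y (.inr ⟨0⟩)), ?_⟩
  rw [Multiset.map_map]
  refine (Multiset.map_congr rfl fun y hy => ?_).trans (Multiset.map_id U)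
  have indicator_hexagon : ∀ j x : Fin 3, ∀ z : Fin 2, j ≠ 0 →
      (x, z) ∈ hexagon.map (β := Fin 3 × Fin 2) (fun e =>
        (cellTwoThree.{u} e (.inl ⟨0⟩), cellTwoThree.{u} e (.inr ⟨j⟩))) →
      z = if j = x then 1 else 0 := by decide
  have indicator_eq (j : Fin 3) (hj : j ≠ 0) :
      ∀ x : Fin 3, y (.inl ⟨0⟩) = x → y (.inr ⟨j⟩) = if j = x then (1 : Fin 2) else 0 := by
    rintro _ rfl
    have hpair := map_pair_eq_of_marginCon h (a := .inl ⟨0⟩) (b := .inr ⟨j⟩) (by simp)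
    rw [Multiset.map_map] at hpair
    exact indicator_hexagon j _ _ hj (hpair ▸ Multiset.mem_map_of_mem _ hy)
  funext w
  obtain ⟨i⟩ | ⟨i⟩ := w <;> fin_cases i
  · rfl
  · rfl
  · rfl
  · exact (indicator_eq 1 (by decide) _ rfl).symm
  · exact (indicator_eq 2 (by decide) _ rfl).symm

lemma eq_or_disjoint_hexagon {P : Multiset (Fin 3 × Fin 3 × Fin 2)}
    (h : marginCon _
      (graphComplex (completeBipartiteGraph (ULift.{u} (Fin 2)) (ULift.{u} (Fin 3))))
      (P.map cellTwoThree) (hexagon.map cellTwoThree)) :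
    P = hexagon ∨ Disjoint P hexagon := by
  have hcard : P.card = hexagon.card := by
    simpa only [Multiset.card_map] using card_eq_of_marginCon_graphComplex h
  have hmargin (i : Fin 2) (j : Fin 3) := sum_ite_count_eq_of_map_eq
    (g := fun e => (cellTwoThree.{u} e (.inl ⟨i⟩), cellTwoThree.{u} e (.inr ⟨j⟩))) (P := P)
    (T := hexagon) <| by
      simpa only [Multiset.map_map, Function.comp_def] using
        map_pair_eq_of_marginCon h (a := .inl ⟨i⟩) (b := .inr ⟨j⟩) (by simp)
  have e₁ := hmargin 0 0
  have e₂ := hmargin 1 0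
  have e₃ := hmargin 1 1
  have e₄ := hmargin 1 2
  clear hmargin h
  simp [Fintype.sum_prod_type, Fin.sum_univ_three, cellTwoThree, hexagon, Multiset.count_cons,
    Multiset.count_singleton, Fin.forall_fin_succ, -Multiset.count_eq_zero] at e₁ e₂ e₃ e₄
  have hfirst : P.count (0, 0, 0) = 0 ∨ P.count (0, 0, 0) = 1 := by omega
  refine eq_or_disjoint_of_count hcard (hfirst.imp (fun h0 => ?_) fun h1 => ?_) <;>
  · simp [hexagon, Multiset.count_cons, Multiset.count_singleton, -Multiset.count_eq_zero]
    omega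

theorem not_isMarkovSlim_completeBipartiteTwoThree (K : Type v) [Field K] :
    ¬ IsMarkovSlim K (completeBipartiteGraph (ULift.{u} (Fin 2)) (ULift.{u} (Fin 3))) := by
  intro h
  refine (h (Set.range Sum.inl) ?_ levelsTwoThree ?_ ?_).not_gt
    (lt_markovWidth_of_map (k := 4) K cellTwoThree_injective (by decide)
      (fun U => exists_map_cellTwoThree_eq) (fun P => eq_or_disjoint_hexagon)
      marginCon_hexagonSwap (by decide))
  · rintro _ ⟨a, rfl⟩ _ ⟨b, rfl⟩ -
    simp
  · rintro _ ⟨a, rfl⟩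
    exact Nat.le_succ 2
  · rintro (a | b) hw
    exacts [(hw ⟨a, rfl⟩).elim, rfl]

end CompleteBipartiteTwoThree

/-! ### Noncrossing orders and outerplanar embeddings -/

section Crossing

open Complex

lemma lift_sub_eq_log_sub {ℓ γ : ℝ → ℂ} (hℓ : Continuous ℓ) (hγ : Continuous γ)
    (hre : ∀ t, 0 < (γ t).re) {w : ℂ} (h : ∀ t, exp (ℓ t) = w * γ t) (s t : ℝ) :
    ℓ s - ℓ t = log (γ s) - log (γ t) := by
  have hne (t : ℝ) : γ t ≠ 0 := fun h0 => by simpa only [h0, zero_re, lt_irrefl] using hre t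
  have hexp (t : ℝ) : exp (ℓ t - log (γ t)) = w := by
    rw [exp_sub, h, exp_log (hne t), mul_div_cancel_right₀ _ (hne t)]
  have hw : w ≠ 0 := hexp 0 ▸ exp_ne_zero _
  have hlog : Continuous fun t => log (γ t) := hγ.clog fun t => .inl (hre t)
  have hconst : (⟨fun t => ℓ t - log (γ t), hℓ.sub hlog⟩ : C(ℝ, ℂ)) =
      ContinuousMap.const ℝ (ℓ t - log (γ t)) :=
    (isCoveringMapOn_exp.existsUnique_continuousMap_lifts (ContinuousMap.const ℝ w) (hexp t)
      fun _ => hw).unique ⟨rfl, funext hexp⟩ ⟨rfl, funext fun _ => hexp t⟩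
  have hs : ℓ s - log (γ s) = ℓ t - log (γ t) := DFunLike.congr_fun hconst s
  linear_combination hs

lemma one_sub_exp_eq (ψ : ℝ) :
    1 - exp (ψ * I) = (2 * Real.sin (ψ / 2) : ℝ) *
      (cos ((ψ - Real.pi) / 2 : ℝ) + sin ((ψ - Real.pi) / 2 : ℝ) * I) := by
  have hcos : Real.cos ψ = 1 - 2 * Real.sin (ψ / 2) ^ 2 := by
    rw [← Real.cos_two_mul_eq_one_sub, mul_div_cancel₀ _ two_ne_zero]
  have hsin : Real.sin ψ = 2 * Real.sin (ψ / 2) * Real.cos (ψ / 2) := by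
    rw [← Real.sin_two_mul, mul_div_cancel₀ _ two_ne_zero]
  rw [exp_mul_I, ← ofReal_cos, ← ofReal_sin, ← ofReal_cos, ← ofReal_sin, sub_div,
    Real.cos_sub_pi_div_two, Real.sin_sub_pi_div_two, hcos, hsin]
  push_cast
  ring

lemma arg_one_sub_exp_of_pos {ψ : ℝ} (h₀ : 0 < ψ) (h₁ : ψ < 2 * Real.pi) :
    arg (1 - exp (ψ * I)) = (ψ - Real.pi) / 2 := by
  have hsin : 0 < Real.sin (ψ / 2) := Real.sin_pos_of_pos_of_lt_pi (by linarith) (by linarith)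
  rw [one_sub_exp_eq, arg_mul_cos_add_sin_mul_I (by positivity)
    ⟨by linarith [Real.pi_pos], by linarith [Real.pi_pos]⟩]

lemma arg_one_sub_exp_of_neg {ψ : ℝ} (h₀ : -(2 * Real.pi) < ψ) (h₁ : ψ < 0) :
    arg (1 - exp (ψ * I)) = (ψ + Real.pi) / 2 := by
  have h := arg_one_sub_exp_of_pos (ψ := ψ + 2 * Real.pi) (by linarith) (by linarith)
  have hperiod : exp ((ψ + 2 * Real.pi : ℝ) * I) = exp (ψ * I) := by
    push_cast
    rw [add_mul, exp_add, exp_two_pi_mul_I, mul_one]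
  rw [hperiod] at h
  rw [h]
  ring

lemma re_one_sub_conj_mul_pos {b z : ℂ} (hb : ‖b‖ = 1) (hz : ‖z‖ ≤ 1) (hne : z ≠ b) :
    0 < (1 - (starRingEnd ℂ) b * z).re := by
  have hsub : 0 < normSq (z - b) := normSq_pos.2 (sub_ne_zero.2 hne)
  have hb' : normSq b = 1 := by rw [normSq_eq_norm_sq, hb, one_pow]
  have hz' : normSq z ≤ 1 := by
    rw [normSq_eq_norm_sq]
    exact pow_le_one₀ (norm_nonneg z) hz
  simp only [normSq_apply, sub_re, sub_im, one_re, mul_re, conj_re, conj_im] at *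
  nlinarith

lemma conj_exp_mul_exp (x y : ℝ) :
    (starRingEnd ℂ) (exp (x * I)) * exp (y * I) = exp ((y - x : ℝ) * I) := by
  rw [← exp_conj, ← exp_add, map_mul, conj_ofReal, conj_I]
  push_cast
  ring_nf

/-- Seen from a point of the circle, the disc lies in a half plane, so that the principal branch of
the logarithm measures the change of angle. -/
lemma im_lift_sub_eq_arg_sub {ℓ f : ℝ → ℂ} (hℓ : Continuous ℓ) (hf : Continuous f)
    (hdisc : ∀ t, ‖f t‖ ≤ 1) {α γ x : ℝ} (h₀ : f 0 = exp (α * I)) (h₁ : f 1 = exp (γ * I))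
    (hne : ∀ t, f t ≠ exp (x * I)) {w : ℂ} (h : ∀ t, exp (ℓ t) = w * (exp (x * I) - f t)) :
    (ℓ 1).im - (ℓ 0).im =
      arg (1 - exp ((γ - x : ℝ) * I)) - arg (1 - exp ((α - x : ℝ) * I)) := by
  have hunit : exp (x * I) * (starRingEnd ℂ) (exp (x * I)) = 1 := by
    rw [mul_comm, conj_exp_mul_exp, sub_self, ofReal_zero, zero_mul, exp_zero]
  have hlog := lift_sub_eq_log_sub hℓ (γ := fun t => 1 - (starRingEnd ℂ) (exp (x * I)) * f t)
    (by fun_prop) (fun t => re_one_sub_conj_mul_pos (norm_exp_ofReal_mul_I x) (hdisc t) (hne t))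
    (w := w * exp (x * I)) (fun t => by rw [h]; linear_combination (w * f t) * hunit) 1 0
  simpa only [h₀, h₁, conj_exp_mul_exp, sub_im, log_im] using congrArg im hlog

/-- A logarithm of `f s - g t` on the square of parameters would have a nonzero change of its
imaginary part along the boundary. -/
theorem exists_eq_of_alternating {f g : ℝ → ℂ} (hf : Continuous f) (hg : Continuous g)
    (hf_disc : ∀ t, ‖f t‖ ≤ 1) (hg_disc : ∀ t, ‖g t‖ ≤ 1) {α β γ δ : ℝ} (hαβ : α < β) (hβγ : β < γ)
    (hγδ : γ < δ) (hδα : δ < α + 2 * Real.pi) (hf₀ : f 0 = exp (α * I)) (hf₁ : f 1 = exp (γ * I))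
    (hg₀ : g 0 = exp (β * I)) (hg₁ : g 1 = exp (δ * I)) : ∃ s t, f s = g t := by
  by_contra! hne
  obtain ⟨L, hL⟩ : ∃ L : C(ℝ × ℝ, ℂ), ∀ s t, exp (L (s, t)) = f s - g t := by
    obtain ⟨L, hL, -⟩ := isCoveringMapOn_exp.existsUnique_continuousMap_lifts
      (⟨fun p : ℝ × ℝ => f p.1 - g p.2, by fun_prop⟩ : C(ℝ × ℝ, ℂ)) (a₀ := (0, 0))
      (e₀ := log (f 0 - g 0)) (exp_log (sub_ne_zero.2 (hne 0 0)))
      (fun p => sub_ne_zero.2 (hne p.1 p.2))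
    exact ⟨L, fun s t => congrFun hL.2 (s, t)⟩
  have change_along_f (x t : ℝ) (hx : g t = exp (x * I)) :=
    im_lift_sub_eq_arg_sub (ℓ := fun s => L (s, t)) (by fun_prop) hf hf_disc hf₀ hf₁
      (fun s => hx ▸ hne s t) (w := -1) fun s => by rw [hL, hx]; ring
  have change_along_g (x s : ℝ) (hx : f s = exp (x * I)) :=
    im_lift_sub_eq_arg_sub (ℓ := fun t => L (s, t)) (by fun_prop) hg hg_disc hg₀ hg₁
      (fun t => hx ▸ (hne s t).symm) (w := 1) fun t => by rw [hL, hx, one_mul]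
  have bottom := change_along_f β 0 hg₀
  have right := change_along_g γ 1 hf₁
  have top := change_along_f δ 1 hg₁
  have left := change_along_g α 0 hf₀
  rw [arg_one_sub_exp_of_pos (by linarith) (by linarith),
    arg_one_sub_exp_of_neg (by linarith) (by linarith)] at bottom right
  rw [arg_one_sub_exp_of_neg (by linarith) (by linarith),
    arg_one_sub_exp_of_neg (by linarith) (by linarith)] at top
  rw [arg_one_sub_exp_of_pos (by linarith) (by linarith),
    arg_one_sub_exp_of_pos (by linarith) (by linarith)] at left
  linarith [Real.pi_pos]

end Crossing

section Embedding

variable {V : Type u} {G : SimpleGraph V}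

lemma OuterplanarEmbedding.exists_path (E : OuterplanarEmbedding G) {a c : V}
    (hac : G.Adj a c) : ∃ f : ℝ → ℂ, Continuous f ∧ (∀ t, ‖f t‖ ≤ 1) ∧ f 0 = E.pos a ∧
      f 1 = E.pos c ∧ ∀ t, f t ∈ Set.range (E.arc ⟨s(a, c), hac⟩) := by
  set e : G.edgeSet := ⟨s(a, c), hac⟩ with he
  have hnorm (t : unitInterval) : ‖E.arc e t‖ ≤ 1 := by simpa using E.arc_mem_disc e t
  have hends := E.arc_ends e
  rw [he, Sym2.map_mk, Sym2.eq_iff] at hends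
  obtain ⟨h₀, h₁⟩ | ⟨h₀, h₁⟩ := hends
  · refine ⟨fun t => E.arc e (Set.projIcc 0 1 zero_le_one t), by fun_prop, fun t => hnorm _, ?_, ?_,
      fun t => ⟨_, rfl⟩⟩
    · exact (congrArg (E.arc e) (Set.projIcc_left zero_le_one)).trans h₀
    · exact (congrArg (E.arc e) (Set.projIcc_right zero_le_one)).trans h₁
  · refine ⟨fun t => E.arc e (Set.projIcc 0 1 zero_le_one (1 - t)), by fun_prop, fun t => hnorm _,
      ?_, ?_, fun t => ⟨_, rfl⟩⟩
    · simp only [sub_zero, Set.projIcc_right]; exact h₁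
    · simp only [sub_self, Set.projIcc_left]; exact h₀

lemma OuterplanarEmbedding.pos_eq_exp_arg (E : OuterplanarEmbedding G) (v : V) :
    E.pos v = Complex.exp ((E.pos v).arg * Complex.I) := by
  have hnorm : ‖E.pos v‖ = 1 := by simpa using E.pos_mem_circle v
  simpa only [hnorm, Complex.ofReal_one, one_mul] using
    (Complex.norm_mul_exp_arg_mul_I (E.pos v)).symm

theorem OuterplanarEmbedding.noncrossingOn (E : OuterplanarEmbedding G) :
    NoncrossingOn G (fun v => (E.pos v).arg) Set.univ where
  injOn v _ w _ (hvw : (E.pos v).arg = (E.pos w).arg) :=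
    E.pos_injective (by rw [E.pos_eq_exp_arg v, E.pos_eq_exp_arg w, hvw])
  not_cross a _ b _ c _ d _ hab hbc hcd hac hbd := by
    obtain ⟨f, hf, hf_disc, hf₀, hf₁, hf_arc⟩ := E.exists_path hac
    obtain ⟨g, hg, hg_disc, hg₀, hg₁, hg_arc⟩ := E.exists_path hbd
    obtain ⟨s, t, hst⟩ := exists_eq_of_alternating hf hg hf_disc hg_disc hab hbc hcd
      (by linarith [Complex.arg_le_pi (E.pos d), Complex.neg_pi_lt_arg (E.pos a)])
      (hf₀.trans (E.pos_eq_exp_arg a)) (hf₁.trans (E.pos_eq_exp_arg c))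
      (hg₀.trans (E.pos_eq_exp_arg b)) (hg₁.trans (E.pos_eq_exp_arg d))
    have hne {x y : V} (h : (E.pos x).arg < (E.pos y).arg) : x ≠ y := fun hxy =>
      h.ne (hxy ▸ rfl)
    have hedges : s(a, c) ≠ s(b, d) := fun h => by
      obtain ⟨h, -⟩ | ⟨h, -⟩ := Sym2.eq_iff.1 h
      exacts [hne hab h, hne (hab.trans (hbc.trans hcd)) h]
    obtain ⟨w, hw, hw', -⟩ := E.arc_inter ⟨s(a, c), hac⟩ ⟨s(b, d), hbd⟩
      (fun h => hedges (congrArg Subtype.val h)) (f s) ⟨hf_arc s, hst ▸ hg_arc t⟩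
    obtain rfl | rfl := Sym2.mem_iff.1 hw <;> obtain h | h := Sym2.mem_iff.1 hw'
    exacts [hne hab h, hne (hab.trans (hbc.trans hcd)) h, hne hbc h.symm, hne hcd h]

/-- The rational parametrization of the unit circle without the point `-1`. -/
noncomputable def circlePoint (x : ℝ) : ℂ := ⟨(1 - x ^ 2) / (1 + x ^ 2), 2 * x / (1 + x ^ 2)⟩

/-- An affine form that vanishes on the line through `circlePoint a` and `circlePoint b`. -/
noncomputable def chordForm (a b : ℝ) (z : ℂ) : ℝ :=
  (1 + a * b) / 2 + (a * b - 1) / 2 * z.re - (a + b) / 2 * z.im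

lemma chordForm_circlePoint (a b x : ℝ) :
    chordForm a b (circlePoint x) = (x - a) * (x - b) / (1 + x ^ 2) := by
  have : 1 + x ^ 2 ≠ 0 := by positivity
  simp only [chordForm, circlePoint]
  field_simp
  ring

lemma chordForm_circlePoint_eq_zero_iff {a b x : ℝ} :
    chordForm a b (circlePoint x) = 0 ↔ x = a ∨ x = b := by
  have : 1 + x ^ 2 ≠ 0 := by positivity
  rw [chordForm_circlePoint, div_eq_zero_iff, or_iff_left this, mul_eq_zero, sub_eq_zero,
    sub_eq_zero]

lemma chordForm_lineMap (a b : ℝ) (z w : ℂ) (t : ℝ) :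
    chordForm a b (AffineMap.lineMap z w t) = (1 - t) * chordForm a b z + t * chordForm a b w := by
  simp only [chordForm, AffineMap.lineMap_apply_module', Complex.add_re, Complex.add_im,
    Complex.real_smul, Complex.re_ofReal_mul, Complex.im_ofReal_mul, Complex.sub_re, Complex.sub_im]
  ring

lemma chordForm_lineMap_self (a b t : ℝ) :
    chordForm a b (AffineMap.lineMap (circlePoint a) (circlePoint b) t) = 0 := by
  rw [chordForm_lineMap, chordForm_circlePoint_eq_zero_iff.2 (.inl rfl),
    chordForm_circlePoint_eq_zero_iff.2 (.inr rfl), mul_zero, mul_zero, add_zero]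

lemma norm_circlePoint (x : ℝ) : ‖circlePoint x‖ = 1 := by
  have : 1 + x ^ 2 ≠ 0 := by positivity
  rw [Complex.norm_def, Real.sqrt_eq_one, Complex.normSq_apply]
  simp only [circlePoint]
  field_simp
  ring

lemma circlePoint_injective : Function.Injective circlePoint := fun x y h => by
  have hzero : chordForm y y (circlePoint x) = 0 :=
    h ▸ chordForm_circlePoint_eq_zero_iff.2 (.inl rfl)
  exact or_self_iff.1 (chordForm_circlePoint_eq_zero_iff.1 hzero)

variable {f : V → ℝ} {a b c d : V}

lemma NoncrossingOn.not_separated (hf : NoncrossingOn G f Set.univ) (hab : G.Adj a b)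
    (hcd : G.Adj c d) (hc : (f c - f a) * (f c - f b) < 0)
    (hd : 0 < (f d - f a) * (f d - f b)) : False := by
  wlog h : f a ≤ f b generalizing a b
  · exact this hab.symm (by rwa [mul_comm]) (by rwa [mul_comm]) (le_of_not_ge h)
  have hac : f a < f c := by
    by_contra! hca
    exact hc.not_ge (mul_nonneg_of_nonpos_of_nonpos (by linarith) (by linarith))
  have hcb : f c < f b := by
    by_contra! hbc
    exact hc.not_ge (mul_nonneg (by linarith) (by linarith))
  obtain ⟨-, hbd⟩ | ⟨hda, -⟩ := mul_pos_iff.1 hd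
  · exact hf.not_cross a trivial c trivial b trivial d trivial hac hcb (sub_pos.1 hbd) hab hcd
  · exact hf.not_cross d trivial a trivial c trivial b trivial (sub_neg.1 hda) hac hcb hcd.symm hab

lemma NoncrossingOn.chordForm_mul_chordForm_pos (hf : NoncrossingOn G f Set.univ)
    (hab : G.Adj a b) (hcd : G.Adj c d) (hc : chordForm (f a) (f b) (circlePoint (f c)) ≠ 0)
    (hd : chordForm (f a) (f b) (circlePoint (f d)) ≠ 0) :
    0 < chordForm (f a) (f b) (circlePoint (f c)) * chordForm (f a) (f b) (circlePoint (f d)) := by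
  have hpos (v : V) : 0 < 1 + f v ^ 2 := by positivity
  refine (mul_ne_zero hc hd).lt_of_le' ?_
  simp only [chordForm_circlePoint, ne_eq, div_eq_zero_iff, (hpos _).ne', or_false] at hc hd ⊢
  rw [div_mul_div_comm]
  refine div_nonneg (not_lt.1 fun hneg => ?_) (mul_pos (hpos c) (hpos d)).le
  obtain ⟨hc', hd'⟩ | ⟨hc', hd'⟩ := mul_neg_iff.1 hneg
  · exact hf.not_separated hab hcd.symm hd' hc'
  · exact hf.not_separated hab hcd hc' hd'

lemma NoncrossingOn.exists_common_end (hf : NoncrossingOn G f Set.univ) (hab : G.Adj a b)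
    (hcd : G.Adj c d) (hne : s(a, b) ≠ s(c, d)) (t : unitInterval)
    (hz : chordForm (f a) (f b)
      (AffineMap.lineMap (circlePoint (f c)) (circlePoint (f d)) (t : ℝ)) = 0) :
    ∃ v, v ∈ s(a, b) ∧ v ∈ s(c, d) ∧
      AffineMap.lineMap (circlePoint (f c)) (circlePoint (f d)) (t : ℝ) = circlePoint (f v) := by
  have mem_iff (v : V) : chordForm (f a) (f b) (circlePoint (f v)) = 0 ↔ v ∈ s(a, b) := by
    rw [chordForm_circlePoint_eq_zero_iff, Sym2.mem_iff, hf.injOn.eq_iff trivial trivial,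
      hf.injOn.eq_iff trivial trivial]
  rw [chordForm_lineMap] at hz
  by_cases hc : chordForm (f a) (f b) (circlePoint (f c)) = 0
  · by_cases hd : chordForm (f a) (f b) (circlePoint (f d)) = 0
    · exact (hne ((Sym2.mem_and_mem_iff hcd.ne).1 ⟨(mem_iff c).1 hc, (mem_iff d).1 hd⟩)).elim
    · refine ⟨c, (mem_iff c).1 hc, Sym2.mem_mk_left c d, ?_⟩
      rw [hc, mul_zero, zero_add, mul_eq_zero, or_iff_left hd] at hz
      rw [hz, AffineMap.lineMap_apply_zero]
  · by_cases hd : chordForm (f a) (f b) (circlePoint (f d)) = 0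
    · refine ⟨d, (mem_iff d).1 hd, Sym2.mem_mk_right c d, ?_⟩
      rw [hd, mul_zero, add_zero, mul_eq_zero, or_iff_left hc, sub_eq_zero] at hz
      rw [← hz, AffineMap.lineMap_apply_one]
    · have hpos := hf.chordForm_mul_chordForm_pos hab hcd hc hd
      generalize chordForm (f a) (f b) (circlePoint (f c)) = x at hz hpos
      generalize chordForm (f a) (f b) (circlePoint (f d)) = y at hz hpos
      have hx : 0 ≤ (1 - (t : ℝ)) * x ^ 2 := mul_nonneg (sub_nonneg.2 t.2.2) (sq_nonneg x)
      have hy : 0 ≤ (t : ℝ) * y ^ 2 := mul_nonneg t.2.1 (sq_nonneg y)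
      have hxy : x * y + (1 - t) * x ^ 2 + t * y ^ 2 = 0 := by linear_combination (x + y) * hz
      linarith

/-- The straight arc of an edge between two points of the unit circle. -/
noncomputable def chord (f : V → ℝ) (e : G.edgeSet) : C(unitInterval, ℂ) where
  toFun t := AffineMap.lineMap (circlePoint (f e.1.out.1)) (circlePoint (f e.1.out.2)) (t : ℝ)

lemma exists_chord_apply_eq (f : V → ℝ) (e : G.edgeSet) : ∃ a b, G.Adj a b ∧ e.1 = s(a, b) ∧
    ∀ t, chord f e t = AffineMap.lineMap (circlePoint (f a)) (circlePoint (f b)) (t : ℝ) := by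
  have he : e.1 = s(e.1.out.1, e.1.out.2) := (Quot.out_eq e.1).symm
  exact ⟨_, _, G.mem_edgeSet.1 (he ▸ e.2), he, fun _ => rfl⟩

theorem NoncrossingOn.isOuterplanar (hf : NoncrossingOn G f Set.univ) : IsOuterplanar G := by
  have hinj : Function.Injective fun v => circlePoint (f v) :=
    circlePoint_injective.comp (Set.injOn_univ.1 hf.injOn)
  refine ⟨⟨fun v => circlePoint (f v), chord f, hinj, fun v => ?_, fun e s t hst => ?_,
    fun e t => ?_, fun e => ?_, ?_, ?_⟩⟩
  · rw [mem_sphere_zero_iff_norm, norm_circlePoint]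
  · obtain ⟨a, b, hab, -, hchord⟩ := exists_chord_apply_eq f e
    rw [hchord, hchord] at hst
    exact Subtype.ext (AffineMap.lineMap_injective ℝ (hinj.ne hab.ne) hst)
  · obtain ⟨a, b, -, -, hchord⟩ := exists_chord_apply_eq f e
    have hmem (x : ℝ) : circlePoint x ∈ Metric.closedBall (0 : ℂ) 1 :=
      mem_closedBall_zero_iff.2 (norm_circlePoint x).le
    rw [hchord]
    exact (convex_closedBall (0 : ℂ) 1).lineMap_mem (hmem _) (hmem _) t.2
  · obtain ⟨a, b, -, he, hchord⟩ := exists_chord_apply_eq f e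
    rw [he, Sym2.map_mk, hchord, hchord, Set.Icc.coe_zero, Set.Icc.coe_one,
      AffineMap.lineMap_apply_zero, AffineMap.lineMap_apply_one]
  · rintro e w ⟨t, ht⟩
    obtain ⟨a, b, -, he, hchord⟩ := exists_chord_apply_eq f e
    have hzero := chordForm_lineMap_self (f a) (f b) t
    rw [← hchord, ht, chordForm_circlePoint_eq_zero_iff] at hzero
    rw [he, Sym2.mem_iff]
    exact hzero.imp (hf.injOn trivial trivial ·) (hf.injOn trivial trivial ·)
  · rintro e e' hne _ ⟨⟨s, rfl⟩, ⟨t, ht⟩⟩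
    obtain ⟨a, b, hab, he, hchord⟩ := exists_chord_apply_eq f e
    obtain ⟨c, d, hcd, he', hchord'⟩ := exists_chord_apply_eq f e'
    have hzero := chordForm_lineMap_self (f a) (f b) s
    rw [← hchord, ← ht, hchord'] at hzero
    rw [← ht, hchord', he, he']
    exact hf.exists_common_end hab hcd (he ▸ he' ▸ Subtype.coe_ne_coe.2 hne) t hzero

theorem isOuterplanar_iff : IsOuterplanar G ↔ ∃ f, NoncrossingOn G f Set.univ :=
  ⟨fun ⟨E⟩ => ⟨_, E.noncrossingOn⟩, fun ⟨_, hf⟩ => hf.isOuterplanar⟩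

end Embedding

/-! ### Connected sets of vertices -/

section Connected

variable {V : Type*} {G : SimpleGraph V} {A B C : Set V} {s t c v w : V}

lemma exists_adj_of_connected_induce (hA : (G.induce A).Connected) {P : Set V} {a b : V}
    (ha : a ∈ A) (haP : a ∈ P) (hb : b ∈ A) (hbP : b ∉ P) :
    ∃ u ∈ A, ∃ v ∈ A, G.Adj u v ∧ u ∈ P ∧ v ∉ P := by
  obtain ⟨p⟩ := hA.preconnected ⟨a, ha⟩ ⟨b, hb⟩
  obtain ⟨d, -, hd, hd'⟩ := p.exists_boundary_dart (Subtype.val ⁻¹' P) haP hbP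
  exact ⟨d.fst, d.fst.2, d.snd, d.snd.2, d.adj, hd, hd'⟩

lemma connected_induce_of_le {H : SimpleGraph V} (hHG : H ≤ G) (hA : (H.induce A).Connected) :
    (G.induce A).Connected :=
  hA.mono fun _ _ h => hHG h

/-- There is an edge between `A` and `B`. -/
def Touches (G : SimpleGraph V) (A B : Set V) : Prop := ∃ a ∈ A, ∃ b ∈ B, G.Adj a b

lemma Touches.symm (h : Touches G A B) : Touches G B A := by
  obtain ⟨a, ha, b, hb, hab⟩ := h
  exact ⟨b, hb, a, ha, hab.symm⟩

lemma Touches.connected_induce_union (h : Touches G A B) (hA : (G.induce A).Connected)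
    (hB : (G.induce B).Connected) : (G.induce (A ∪ B)).Connected := by
  obtain ⟨a, ha, b, hb, hab⟩ := h
  exact SimpleGraph.connected_induce_union hA.preconnected hB.preconnected ha hb hab

/-- The connected component of `s` in the subgraph induced by `A`, as a set of vertices of `G`;
it is empty unless `s ∈ A`. -/
def component (G : SimpleGraph V) (A : Set V) (s : V) : Set V :=
  ⋃₀ {C | C ⊆ A ∧ s ∈ C ∧ (G.induce C).Connected}

lemma component_subset : component G A s ⊆ A := Set.sUnion_subset fun _ hC => hC.1

lemma mem_component_self (hs : s ∈ A) : s ∈ component G A s :=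
  ⟨{s}, ⟨Set.singleton_subset_iff.2 hs, rfl, .of_subsingleton⟩, rfl⟩

lemma mem_of_mem_component (hv : v ∈ component G A s) : s ∈ A := by
  obtain ⟨C, ⟨hCA, hs, -⟩, -⟩ := hv
  exact hCA hs

lemma mem_component_comm : t ∈ component G A s ↔ s ∈ component G A t := by
  constructor <;> rintro ⟨C, ⟨hCA, h, hC⟩, h'⟩ <;> exact ⟨C, ⟨hCA, h', hC⟩, h⟩

lemma connected_induce_component (hs : s ∈ A) : (G.induce (component G A s)).Connected :=
  SimpleGraph.induce_sUnion_connected_of_pairwise_not_disjoint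
    ⟨{s}, Set.singleton_subset_iff.2 hs, rfl, .of_subsingleton⟩
    (fun hC hD => ⟨s, hC.2.1, hD.2.1⟩) fun hC => hC.2.2

lemma subset_component (hC : (G.induce C).Connected) (hCA : C ⊆ A) (hv : v ∈ C)
    (hvs : v ∈ component G A s) : C ⊆ component G A s := by
  obtain ⟨D, ⟨hDA, hs, hD⟩, hvD⟩ := hvs
  exact Set.subset_union_right.trans <| Set.subset_sUnion_of_mem
    ⟨Set.union_subset hDA hCA, .inl hs,
      SimpleGraph.induce_union_connected hD.preconnected hC.preconnected ⟨v, hvD, hv⟩⟩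

lemma mem_component_of_adj (hv : v ∈ component G A s) (hw : w ∈ A) (hvw : G.Adj v w) :
    w ∈ component G A s :=
  subset_component (SimpleGraph.induce_pair_connected_of_adj hvw)
    (Set.pair_subset (component_subset hv) hw) (Set.mem_insert v {w}) hv (.inr rfl)

lemma disjoint_component (ht : t ∉ component G A s) :
    Disjoint (component G A s) (component G A t) := by
  refine Set.disjoint_left.2 fun v hvs hvt => ht ?_
  have htA := mem_of_mem_component hvt
  exact subset_component (connected_induce_component htA) component_subset hvt hvs
    (mem_component_self htA)

lemma touches_component_sdiff_singleton (hC : (G.induce C).Connected) (hCA : C ⊆ A) (hs : s ∈ C)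
    (hsc : s ≠ c) (ht : t ∈ C) (htc : t ∉ component G (A \ {c}) s) :
    Touches G (component G (A \ {c}) s) {c} := by
  have hsA : s ∈ A \ {c} := ⟨hCA hs, hsc⟩
  obtain ⟨u, -, v, hv, huv, hu, hvs⟩ :=
    exists_adj_of_connected_induce hC hs (mem_component_self hsA) ht htc
  obtain rfl : v = c := by
    by_contra hvc
    exact hvs (mem_component_of_adj hu ⟨hCA hv, hvc⟩ huv)
  exact ⟨u, hu, v, rfl, huv⟩

end Connected

/-! ### Disjoint connections between two sets -/

section Menger

variable {V : Type*} {G H : SimpleGraph V} {S T X Y : Set V} {c x y v w : V}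

/-- `X` induces a connected subgraph that meets `S` and `T`. It plays the role of a path from `S`
to `T` in Menger's theorem. -/
structure Joins (G : SimpleGraph V) (S T X : Set V) : Prop where
  connected : (G.induce X).Connected
  meets_left : (X ∩ S).Nonempty
  meets_right : (X ∩ T).Nonempty

/-- There are two disjoint connections between `S` and `T`. -/
def HasDisjointJoins (G : SimpleGraph V) (S T : Set V) : Prop :=
  ∃ X Y, Joins G S T X ∧ Joins G S T Y ∧ Disjoint X Y

lemma Joins.symm (h : Joins G S T X) : Joins G T S X where
  connected := h.connected
  meets_left := h.meets_right
  meets_right := h.meets_left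

lemma Joins.of_le (hHG : H ≤ G) (h : Joins H S T X) : Joins G S T X where
  connected := connected_induce_of_le hHG h.connected
  meets_left := h.meets_left
  meets_right := h.meets_right

lemma joins_singleton (hS : x ∈ S) (hT : x ∈ T) : Joins G S T {x} where
  connected := .of_subsingleton
  meets_left := ⟨x, rfl, hS⟩
  meets_right := ⟨x, rfl, hT⟩

lemma Joins.mem_of_singleton (h : Joins G S {c} X) : c ∈ X := by
  obtain ⟨c, hc, rfl⟩ := h.meets_right
  exact hc

lemma Joins.union_of_common (hX : Joins G S {c} X) (hY : Joins G T {c} Y) :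
    Joins G S T (X ∪ Y) where
  connected := SimpleGraph.induce_union_connected hX.connected.preconnected
    hY.connected.preconnected ⟨c, hX.mem_of_singleton, hY.mem_of_singleton⟩
  meets_left := hX.meets_left.mono (Set.inter_subset_inter_left S Set.subset_union_left)
  meets_right := hY.meets_left.mono (Set.inter_subset_inter_left T Set.subset_union_right)

lemma Joins.union_of_adj (hX : Joins G S {x} X) (hY : Joins G T {y} Y) (hxy : G.Adj x y) :
    Joins G S T (X ∪ Y) where
  connected := SimpleGraph.connected_induce_union hX.connected.preconnected
    hY.connected.preconnected hX.mem_of_singleton hY.mem_of_singleton hxy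
  meets_left := hX.meets_left.mono (Set.inter_subset_inter_left S Set.subset_union_left)
  meets_right := hY.meets_left.mono (Set.inter_subset_inter_left T Set.subset_union_right)

/-- The vertices that can be reached from `S` without using `c`. -/
def side (G : SimpleGraph V) (S : Set V) (c : V) : Set V := ⋃ s ∈ S, component G {c}ᶜ s

lemma subset_side (hX : (G.induce X).Connected) (hS : (X ∩ S).Nonempty) (hc : c ∉ X) :
    X ⊆ side G S c := by
  obtain ⟨s, hsX, hsS⟩ := hS
  have hXc : X ⊆ {c}ᶜ := Set.subset_compl_singleton_iff.2 hc
  exact (subset_component hX hXc hsX (mem_component_self (hXc hsX))).trans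
    (Set.subset_biUnion_of_mem (u := component G {c}ᶜ) hsS)

lemma notMem_side : c ∉ side G S c := by
  simp only [side, Set.mem_iUnion, not_exists]
  exact fun s _ hc => component_subset hc rfl

lemma disjoint_side (hsep : ∀ X, Joins G S T X → c ∈ X) :
    Disjoint (side G S c) (side G T c) := by
  simp only [side, Set.disjoint_iUnion_left, Set.disjoint_iUnion_right]
  refine fun t ht s hs => disjoint_component fun hts => ?_
  have hsc := mem_of_mem_component hts
  exact component_subset (hsep (component G {c}ᶜ s) ⟨connected_induce_component hsc,
    ⟨s, mem_component_self hsc, hs⟩, t, hts, ht⟩) rfl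

lemma exists_joins_singleton_subset_insert_side (hX : (G.induce X).Connected)
    (hS : (X ∩ S).Nonempty) (hc : c ∈ X) :
    ∃ Y ⊆ X, Joins G S {c} Y ∧ Y ⊆ insert c (side G S c) := by
  obtain ⟨s, hsX, hsS⟩ := hS
  obtain rfl | hsc := eq_or_ne s c
  · exact ⟨{s}, Set.singleton_subset_iff.2 hsX, joins_singleton hsS rfl, by simp⟩
  have hs : s ∈ X \ {c} := ⟨hsX, hsc⟩
  have hK := connected_induce_component (G := G) hs
  have htouch := touches_component_sdiff_singleton hX subset_rfl hsX hsc hc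
    fun h => (component_subset h).2 rfl
  refine ⟨component G (X \ {c}) s ∪ {c}, ?_,
    ⟨htouch.connected_induce_union hK .of_subsingleton, ⟨s, .inl (mem_component_self hs), hsS⟩,
      c, .inr rfl, rfl⟩, ?_⟩
  · exact Set.union_subset (component_subset.trans Set.sdiff_subset) (Set.singleton_subset_iff.2 hc)
  · rw [Set.union_singleton]
    exact Set.insert_subset_insert (subset_side hK ⟨s, mem_component_self hs, hsS⟩
      fun h => (component_subset h).2 rfl)

lemma HasDisjointJoins.exists_subset_side (hcx : c ≠ x) (h : HasDisjointJoins G S {c, x}) :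
    ∃ X Y, Joins G S {c} X ∧ Joins G S {x} Y ∧ Disjoint X Y ∧ X ⊆ insert c (side G S c) ∧
      Y ⊆ side G S c := by
  obtain ⟨X, Y, hX, hY, hXY, hc, hx⟩ : ∃ X Y, Joins G S {c, x} X ∧ Joins G S {c, x} Y ∧
      Disjoint X Y ∧ c ∈ X ∧ x ∈ Y := by
    obtain ⟨X, Y, hX, hY, hXY⟩ := h
    obtain ⟨p, hpX, rfl | rfl⟩ := hX.meets_right <;> obtain ⟨q, hqY, rfl | rfl⟩ := hY.meets_right
    · exact (Set.disjoint_left.1 hXY hpX hqY).elim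
    · exact ⟨X, Y, hX, hY, hXY, hpX, hqY⟩
    · exact ⟨Y, X, hY, hX, hXY.symm, hqY, hpX⟩
    · exact (Set.disjoint_left.1 hXY hpX hqY).elim
  obtain ⟨X', hX'X, hX', hX'c⟩ :=
    exists_joins_singleton_subset_insert_side hX.connected hX.meets_left hc
  exact ⟨X', Y, hX', ⟨hY.connected, hY.meets_left, x, hx, rfl⟩, hXY.mono_left hX'X, hX'c,
    subset_side hY.connected hY.meets_left (Set.disjoint_left.1 hXY hc)⟩

lemma hasDisjointJoins_of_separated (hHG : H ≤ G) (hxy : G.Adj x y)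
    (hsep : ∀ X, Joins H S T X → c ∈ X) (hcx : c ≠ x) (hcy : c ≠ y)
    (hS : HasDisjointJoins H S {c, x}) (hT : HasDisjointJoins H T {c, y}) :
    HasDisjointJoins G S T := by
  obtain ⟨X₁, Y₁, hX₁, hY₁, hXY₁, hX₁c, hY₁c⟩ := hS.exists_subset_side hcx
  obtain ⟨X₂, Y₂, hX₂, hY₂, hXY₂, hX₂c, hY₂c⟩ := hT.exists_subset_side hcy
  have hside := disjoint_side hsep
  refine ⟨X₁ ∪ X₂, Y₁ ∪ Y₂, (hX₁.union_of_common hX₂).of_le hHG,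
    (hY₁.of_le hHG).union_of_adj (hY₂.of_le hHG) hxy, ?_⟩
  simp only [Set.disjoint_union_left, Set.disjoint_union_right]
  refine ⟨⟨hXY₁, ?_⟩, ?_, hXY₂⟩
  · exact Set.disjoint_of_subset hX₂c hY₁c (Set.disjoint_insert_left.2 ⟨notMem_side, hside.symm⟩)
  · exact Set.disjoint_of_subset hX₁c hY₂c (Set.disjoint_insert_left.2 ⟨notMem_side, hside⟩)

lemma adj_deleteEdges_singleton_or (e : Sym2 V) (hvw : G.Adj v w) :
    (G.deleteEdges {e}).Adj v w ∨ s(v, w) = e := by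
  rw [SimpleGraph.deleteEdges_adj]
  tauto

lemma Joins.exists_joins_of_deleted_edge (h : Joins G S T X)
    (hHG : ∀ u v, G.Adj u v → H.Adj u v ∨ s(u, v) = s(x, y)) :
    ∃ Y ⊆ X, Joins H S T Y ∨ Joins H S {x, y} Y := by
  obtain ⟨s, hsX, hsS⟩ := h.meets_left
  obtain ⟨t, htX, htT⟩ := h.meets_right
  have hs := mem_component_self (G := H) hsX
  have hK := connected_induce_component (G := H) hsX
  refine ⟨component H X s, component_subset, ?_⟩
  by_cases ht : t ∈ component H X s
  · exact .inl ⟨hK, ⟨s, hs, hsS⟩, t, ht, htT⟩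
  obtain ⟨u, -, v, hvX, huv, hu, hv⟩ := exists_adj_of_connected_induce h.connected hsX hs htX ht
  have he := (hHG u v huv).resolve_left fun hadj => hv (mem_component_of_adj hu hvX hadj)
  exact .inr ⟨hK, ⟨s, hs, hsS⟩, u, hu, Sym2.mem_iff.1 (he ▸ Sym2.mem_mk_left u v)⟩

lemma Joins.mem_side_or_mem_side (h : Joins G S T X) (hc : c ∉ X)
    (hHG : ∀ u v, G.Adj u v → H.Adj u v ∨ s(u, v) = s(x, y))
    (hsep : ∀ X, Joins H S T X → c ∈ X) : x ∈ side H S c ∨ y ∈ side H S c := by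
  obtain ⟨Y, hYX, hY | hY⟩ := h.exists_joins_of_deleted_edge hHG
  · exact absurd (hYX (hsep Y hY)) hc
  · have hYc := subset_side hY.connected hY.meets_left fun hcY => hc (hYX hcY)
    obtain ⟨z, hzY, rfl | rfl⟩ := hY.meets_right
    exacts [.inl (hYc hzY), .inr (hYc hzY)]

lemma Joins.exists_joins_pair (h : Joins G S T X)
    (hHG : ∀ u v, G.Adj u v → H.Adj u v ∨ s(u, v) = s(x, y))
    (hsep : ∀ X, Joins H S T X → c ∈ X) (hy : y ∉ side H S c) :
    ∃ Y ⊆ X, Joins H S {c, x} Y := by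
  obtain ⟨Y, hYX, hY⟩ := h.exists_joins_of_deleted_edge hHG
  by_cases hc : c ∈ Y
  · exact ⟨Y, hYX, hY.elim Joins.connected Joins.connected,
      hY.elim Joins.meets_left Joins.meets_left, c, hc, .inl rfl⟩
  have hY := hY.resolve_left fun hY => hc (hsep Y hY)
  obtain ⟨z, hzY, rfl | rfl⟩ := hY.meets_right
  · exact ⟨Y, hYX, hY.connected, hY.meets_left, z, hzY, .inr rfl⟩
  · exact absurd (subset_side hY.connected hY.meets_left hc hzY) hy

/-- The connections of `H` from `S` to `{c, x}` and from `T` to `{c, y}` are combined at `c` and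
along the edge `x y`. -/
lemma hasDisjointJoins_of_bridge (hle : H ≤ G) (hxy : G.Adj x y)
    (hHG : ∀ u v, G.Adj u v → H.Adj u v ∨ s(u, v) = s(x, y))
    (hsep : ∀ X, Joins H S T X → c ∈ X) (hx : x ∈ side H S c) (hy : y ∈ side H T c)
    (hH : ∀ S T, (∀ z, ∃ X, Joins H S T X ∧ z ∉ X) → HasDisjointJoins H S T)
    (h : ∀ z, ∃ X, Joins G S T X ∧ z ∉ X) : HasDisjointJoins G S T := by
  have hside := Set.disjoint_left.1 (disjoint_side hsep)
  refine hasDisjointJoins_of_separated hle hxy hsep (fun e => notMem_side (e ▸ hx))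
    (fun e => notMem_side (e ▸ hy)) (hH S _ fun z => ?_) (hH T _ fun z => ?_)
  all_goals obtain ⟨X, hX, hz⟩ := h z
  · obtain ⟨Y, hYX, hY⟩ := hX.exists_joins_pair hHG hsep fun hyS => hside hyS hy
    exact ⟨Y, hY, fun hzY => hz (hYX hzY)⟩
  · obtain ⟨Y, hYX, hY⟩ := hX.symm.exists_joins_pair
      (fun u v huv => (hHG u v huv).imp_right (·.trans Sym2.eq_swap))
      (fun Y hY => hsep Y hY.symm) (hside hx)
    exact ⟨Y, hY, fun hzY => hz (hYX hzY)⟩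

lemma Joins.nonempty_inter_of_edgeless (h : Joins G S T X) (hG : ∀ u v, ¬ G.Adj u v) :
    (X ∩ (S ∩ T)).Nonempty := by
  obtain ⟨s, hsX, hsS⟩ := h.meets_left
  obtain ⟨t, htX, htT⟩ := h.meets_right
  by_cases hst : t = s
  · exact ⟨s, hsX, hsS, hst ▸ htT⟩
  · obtain ⟨u, -, v, -, huv, -⟩ :=
      exists_adj_of_connected_induce (P := {s}) h.connected hsX rfl htX hst
    exact absurd huv (hG u v)

lemma hasDisjointJoins_of_edgeless [Nonempty V] (hG : ∀ u v, ¬ G.Adj u v)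
    (h : ∀ z, ∃ X, Joins G S T X ∧ z ∉ X) : HasDisjointJoins G S T := by
  obtain ⟨X, hX, -⟩ := h (Classical.arbitrary V)
  obtain ⟨x, -, hxS, hxT⟩ := hX.nonempty_inter_of_edgeless hG
  obtain ⟨Y, hY, hxY⟩ := h x
  obtain ⟨y, hyY, hyS, hyT⟩ := hY.nonempty_inter_of_edgeless hG
  refine ⟨{x}, {y}, joins_singleton hxS hxT, joins_singleton hyS hyT, ?_⟩
  exact Set.disjoint_singleton.2 fun hxy => hxY (hxy ▸ hyY)

/-- This is Menger's theorem for two connections. -/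
theorem hasDisjointJoins_of_forall_exists_notMem [Finite V] [Nonempty V] (G : SimpleGraph V)
    (S T : Set V) (h : ∀ z, ∃ X, Joins G S T X ∧ z ∉ X) : HasDisjointJoins G S T := by
  induction G using WellFoundedLT.induction generalizing S T with
  | ind G ih =>
  by_cases hG : ∀ u v, ¬ G.Adj u v
  · exact hasDisjointJoins_of_edgeless hG h
  push Not at hG
  obtain ⟨x, y, hxy⟩ := hG
  set H := G.deleteEdges {s(x, y)} with hH
  have hle : H ≤ G := SimpleGraph.deleteEdges_le _
  have hlt : H < G := hle.lt_of_not_ge fun hGH => by simpa [hH] using hGH hxy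
  have hHG (u v) (huv : G.Adj u v) : H.Adj u v ∨ s(u, v) = s(x, y) :=
    adj_deleteEdges_singleton_or _ huv
  by_cases hgood : ∀ z, ∃ X, Joins H S T X ∧ z ∉ X
  · obtain ⟨X, Y, hX, hY, hXY⟩ := ih H hlt S T hgood
    exact ⟨X, Y, hX.of_le hle, hY.of_le hle, hXY⟩
  push Not at hgood
  obtain ⟨c, hc⟩ := hgood
  have hside := Set.disjoint_left.1 (disjoint_side hc)
  obtain ⟨X, hX, hcX⟩ := h c
  obtain hx | hy := hX.mem_side_or_mem_side hcX hHG hc <;>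
    obtain hx' | hy' := hX.symm.mem_side_or_mem_side hcX hHG fun Y hY => hc Y hY.symm
  · exact absurd hx' (hside hx)
  · exact hasDisjointJoins_of_bridge hle hxy hHG hc hx hy' (ih H hlt) h
  · exact hasDisjointJoins_of_bridge hle hxy.symm
      (fun u v huv => (hHG u v huv).imp_right (·.trans Sym2.eq_swap)) hc hy hx' (ih H hlt) h
  · exact absurd hy' (hside hy)

end Menger

/-! ### Minors -/

section Minor

variable {V W : Type u} {G : SimpleGraph V} {H : SimpleGraph W} {f : V → ℝ}

lemma NoncrossingOn.mem_Ioo_of_connected (hf : NoncrossingOn G f Set.univ) {C : Set V}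
    (hC : (G.induce C).Connected) {u v p q : V} (hu : u ∉ C) (hv : v ∉ C) (huv : G.Adj u v)
    (hp : p ∈ C) (hq : q ∈ C) (hpuv : f p ∈ Set.Ioo (f u) (f v)) :
    f q ∈ Set.Ioo (f u) (f v) := by
  by_contra hq'
  obtain ⟨x, -, y, hy, hxy, ⟨hux, hxv⟩, hy'⟩ :=
    exists_adj_of_connected_induce (P := f ⁻¹' Set.Ioo (f u) (f v)) hC hp hpuv hq hq'
  have hyu : f y ≠ f u := fun e => hu (hf.injOn trivial trivial e ▸ hy)
  have hyv : f y ≠ f v := fun e => hv (hf.injOn trivial trivial e ▸ hy)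
  obtain hlt | hgt := hyu.lt_or_gt
  · exact hf.not_cross y trivial u trivial x trivial v trivial hlt hux hxv hxy.symm huv
  · have hvy : f v < f y := hyv.lt_or_gt.resolve_left fun h => hy' ⟨hgt, h⟩
    exact hf.not_cross u trivial x trivial v trivial y trivial hux hxv hvy huv hxy

lemma NoncrossingOn.not_cross_of_connected (hf : NoncrossingOn G f Set.univ) {A C : Set V}
    (hA : (G.induce A).Connected) (hC : (G.induce C).Connected) (hAC : Disjoint A C)
    {a b c d : V} (ha : a ∈ A) (hb : b ∈ C) (hc : c ∈ A) (hd : d ∈ C) (hab : f a < f b)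
    (hbc : f b < f c) : ¬ f c < f d := by
  intro hcd
  obtain ⟨x, hx, y, hy, hxy, ⟨hbx, hxd⟩, hy'⟩ :=
    exists_adj_of_connected_induce (P := f ⁻¹' Set.Ioo (f b) (f d)) hA hc ⟨hbc, hcd⟩ ha
      fun h => hab.not_gt h.1
  have hxC := Set.disjoint_left.1 hAC hx
  have hyC := Set.disjoint_left.1 hAC hy
  have hyb : f y ≠ f b := fun e => hyC (hf.injOn trivial trivial e ▸ hb)
  have hyd : f y ≠ f d := fun e => hyC (hf.injOn trivial trivial e ▸ hd)
  obtain hlt | hgt := hyb.lt_or_gt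
  · exact hxd.not_gt (hf.mem_Ioo_of_connected hC hyC hxC hxy.symm hb hd ⟨hlt, hbx⟩).2
  · have hdy : f d < f y := hyd.lt_or_gt.resolve_left fun h => hy' ⟨hgt, h⟩
    exact hbx.not_gt (hf.mem_Ioo_of_connected hC hxC hyC hxy hd hb ⟨hxd, hdy⟩).1

theorem IsOuterplanar.of_isMinor (hG : IsOuterplanar G) (h : IsMinor H G) : IsOuterplanar H := by
  rw [isOuterplanar_iff] at hG ⊢
  obtain ⟨f, hf⟩ := hG
  obtain ⟨B, hconn, hdisj, hadj⟩ := h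
  choose r hr using fun x => Set.nonempty_coe_sort.1 (hconn x).nonempty
  have hB : ∀ x y, f (r x) < f (r y) → Disjoint (B x) (B y) := fun x y hlt =>
    hdisj x y fun hxy => hlt.ne (hxy ▸ rfl)
  refine ⟨fun x => f (r x), fun x _ y _ hxy => ?_, fun a _ b _ c _ d _ hab hbc hcd hac hbd => ?_⟩
  · by_contra hne
    exact Set.disjoint_left.1 (hdisj x y hne) (hr x)
      (hf.injOn trivial trivial hxy ▸ hr y)
  · refine hf.not_cross_of_connected (Touches.connected_induce_union (hadj a c hac) (hconn a)
      (hconn c)) (Touches.connected_induce_union (hadj b d hbd) (hconn b) (hconn d)) ?_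
      (.inl (hr a)) (.inl (hr b)) (.inr (hr c)) (.inr (hr d)) hab hbc hcd
    rw [Set.disjoint_union_left, Set.disjoint_union_right, Set.disjoint_union_right]
    exact ⟨⟨hB a b hab, hB a d (hab.trans (hbc.trans hcd))⟩, (hB b c hbc).symm, hB c d hcd⟩

lemma isMinor_completeFour {A B C D : Set V} (hA : (G.induce A).Connected)
    (hB : (G.induce B).Connected) (hC : (G.induce C).Connected) (hD : (G.induce D).Connected)
    (dAB : Disjoint A B) (dAC : Disjoint A C) (dAD : Disjoint A D) (dBC : Disjoint B C)
    (dBD : Disjoint B D) (dCD : Disjoint C D) (tAB : Touches G A B) (tAC : Touches G A C)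
    (tAD : Touches G A D) (tBC : Touches G B C) (tBD : Touches G B D) (tCD : Touches G C D) :
    IsMinor (⊤ : SimpleGraph (ULift.{u} (Fin 4))) G := by
  refine ⟨fun x => ![A, B, C, D] x.down, ?_, ?_, ?_⟩
  · rintro ⟨x⟩
    fin_cases x <;> assumption
  · rintro ⟨x⟩ ⟨y⟩ hxy
    fin_cases x <;> fin_cases y <;> first | exact absurd rfl hxy | assumption |
      (apply Disjoint.symm; assumption)
  · rintro ⟨x⟩ ⟨y⟩ hxy
    change Touches G _ _
    fin_cases x <;> fin_cases y <;> first | exact absurd rfl hxy | assumption |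
      (apply Touches.symm; assumption)

lemma isMinor_completeBipartiteTwoThree {P Q X Y Z : Set V} (hP : (G.induce P).Connected)
    (hQ : (G.induce Q).Connected) (hX : (G.induce X).Connected) (hY : (G.induce Y).Connected)
    (hZ : (G.induce Z).Connected) (dPQ : Disjoint P Q) (dPX : Disjoint P X) (dPY : Disjoint P Y)
    (dPZ : Disjoint P Z) (dQX : Disjoint Q X) (dQY : Disjoint Q Y) (dQZ : Disjoint Q Z)
    (dXY : Disjoint X Y) (dXZ : Disjoint X Z) (dYZ : Disjoint Y Z) (tPX : Touches G P X)
    (tPY : Touches G P Y) (tPZ : Touches G P Z) (tQX : Touches G Q X) (tQY : Touches G Q Y)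
    (tQZ : Touches G Q Z) :
    IsMinor (completeBipartiteGraph (ULift.{u} (Fin 2)) (ULift.{u} (Fin 3))) G := by
  refine ⟨Sum.elim (fun x => ![P, Q] x.down) (fun x => ![X, Y, Z] x.down), ?_, ?_, ?_⟩
  · rintro (⟨x⟩ | ⟨x⟩) <;> fin_cases x <;> assumption
  · rintro (⟨x⟩ | ⟨x⟩) (⟨y⟩ | ⟨y⟩) hxy <;> fin_cases x <;> fin_cases y <;>
      first | exact absurd rfl hxy | assumption | (apply Disjoint.symm; assumption)
  · rintro (⟨x⟩ | ⟨x⟩) (⟨y⟩ | ⟨y⟩) (⟨hx, hy⟩ | ⟨hx, hy⟩) <;> try contradiction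
    all_goals
      change Touches G _ _
      fin_cases x <;> fin_cases y <;> first | assumption | (apply Touches.symm; assumption)

end Minor

section TwoConnections

variable {V : Type*} {G H : SimpleGraph V} {A B S T X : Set V} {c s t : V}

lemma Touches.inter_neighborSet_nonempty (h : Touches G A {c}) :
    (A ∩ G.neighborSet c).Nonempty := by
  obtain ⟨a, ha, _, rfl, hac⟩ := h
  exact ⟨a, ha, hac.symm⟩

lemma Joins.touches_left (h : Joins G (G.neighborSet s) T X) : Touches G {s} X := by
  obtain ⟨x, hx, hsx⟩ := h.meets_left
  exact ⟨s, rfl, x, hx, hsx⟩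

lemma adj_spanningCoe_induce {u v : V} :
    (G.induce A).spanningCoe.Adj u v ↔ G.Adj u v ∧ u ∈ A ∧ v ∈ A := by
  simp only [SimpleGraph.map_adj, SimpleGraph.comap_adj, Function.Embedding.subtype_apply,
    Subtype.exists, exists_and_left, exists_prop, ↓existsAndEq, and_true, true_and]

lemma joins_spanningCoe_induce_iff :
    Joins (G.induce A).spanningCoe (S ∩ A) T X ↔ Joins G S T X ∧ X ⊆ A := by
  constructor
  · rintro ⟨hX, ⟨x, hxX, hxS, hxA⟩, hT⟩
    refine ⟨⟨connected_induce_of_le (SimpleGraph.spanningCoe_induce_le G A) hX,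
      ⟨x, hxX, hxS⟩, hT⟩, fun y hy => ?_⟩
    by_contra hyA
    obtain ⟨u, -, v, -, huv, -, hv⟩ := exists_adj_of_connected_induce hX hxX hxA hy hyA
    exact hv (adj_spanningCoe_induce.1 huv).2.2
  · rintro ⟨⟨hX, ⟨x, hxX, hxS⟩, hT⟩, hXA⟩
    exact ⟨hX.mono fun u v huv => adj_spanningCoe_induce.2 ⟨huv, hXA u.2, hXA v.2⟩,
      ⟨x, hxX, hxS, hXA hxX⟩, hT⟩

lemma exists_subset_disjoint_joins [Finite V] [Nonempty V]
    (h : ∀ z, ∃ X ⊆ A, Joins G S T X ∧ z ∉ X) :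
    ∃ X ⊆ A, ∃ Y ⊆ A, Joins G S T X ∧ Joins G S T Y ∧ Disjoint X Y := by
  obtain ⟨X, Y, hX, hY, hXY⟩ := hasDisjointJoins_of_forall_exists_notMem
    (G.induce A).spanningCoe (S ∩ A) T fun z => by
      obtain ⟨X, hXA, hX, hz⟩ := h z
      exact ⟨X, joins_spanningCoe_induce_iff.2 ⟨hX, hXA⟩, hz⟩
  rw [joins_spanningCoe_induce_iff] at hX hY
  exact ⟨X, hX.2, Y, hY.2, hX.1, hY.1, hXY⟩

lemma exists_joins_neighborSet (hst : s ≠ t) (hadj : ¬ G.Adj s t) (ht : t ∈ component G A s) :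
    ∃ X ⊆ A \ {s, t}, Joins G (G.neighborSet s) (G.neighborSet t) X := by
  have hs := mem_of_mem_component ht
  have htA : t ∈ A \ {s} := ⟨component_subset ht, hst.symm⟩
  set K := component G (A \ {s}) t
  have hK : (G.induce K).Connected := connected_induce_component htA
  obtain ⟨x, hxK, _, rfl, hxs⟩ : Touches G K {s} :=
    touches_component_sdiff_singleton (connected_induce_component hs) component_subset ht
      hst.symm (mem_component_self hs) fun h => (component_subset h).2 rfl
  have hxt : x ≠ t := fun e => hadj (e ▸ hxs.symm)
  refine ⟨component G (K \ {t}) x, fun v hv => ?_, ?_⟩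
  · obtain ⟨hvK, hvt⟩ := component_subset hv
    obtain ⟨hvA, hvs⟩ := component_subset hvK
    exact ⟨hvA, by rintro (h | h) <;> contradiction⟩
  · exact ⟨connected_induce_component ⟨hxK, hxt⟩, ⟨x, mem_component_self ⟨hxK, hxt⟩, hxs.symm⟩,
      (touches_component_sdiff_singleton hK subset_rfl hxK hxt (mem_component_self htA)
        fun h => (component_subset h).2 rfl).inter_neighborSet_nonempty⟩

lemma exists_disjoint_joins_neighborSet [Finite V] (hst : s ≠ t) (hadj : ¬ G.Adj s t)
    (ht : t ∈ component G A s)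
    (hcut : ∀ c ∈ A, c ≠ s → c ≠ t → t ∈ component G (A \ {c}) s) :
    ∃ X ⊆ A \ {s, t}, ∃ Y ⊆ A \ {s, t}, Joins G (G.neighborSet s) (G.neighborSet t) X ∧
      Joins G (G.neighborSet s) (G.neighborSet t) Y ∧ Disjoint X Y := by
  have : Nonempty V := ⟨s⟩
  refine exists_subset_disjoint_joins fun z => ?_
  by_cases hz : z ∈ A \ {s, t}
  · have hzs : z ≠ s := fun e => hz.2 (.inl e)
    have hzt : z ≠ t := fun e => hz.2 (.inr e)
    obtain ⟨X, hXA, hX⟩ := exists_joins_neighborSet hst hadj (hcut z hz.1 hzs hzt)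
    exact ⟨X, hXA.trans (Set.sdiff_subset_sdiff_left Set.sdiff_subset), hX,
      fun h => (hXA h).1.2 rfl⟩
  · obtain ⟨X, hXA, hX⟩ := exists_joins_neighborSet hst hadj ht
    exact ⟨X, hXA, hX, fun h => hz (hXA h)⟩

end TwoConnections

/-! ### Gluing noncrossing orders -/

section Glue

variable {V : Type*} {G : SimpleGraph V} {f f₁ f₂ : V → ℝ} {A A₁ A₂ B : Set V} {c s t : V}

lemma NoncrossingOn.mono (h : NoncrossingOn G f A) (hBA : B ⊆ A) : NoncrossingOn G f B where
  injOn := h.injOn.mono hBA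
  not_cross a ha b hb c hc d hd := h.not_cross a (hBA ha) b (hBA hb) c (hBA hc) d (hBA hd)

lemma NoncrossingOn.congr (h : NoncrossingOn G f A) (hg : Set.EqOn f₁ f A) :
    NoncrossingOn G f₁ A where
  injOn := h.injOn.congr hg.symm
  not_cross a ha b hb c hc d hd := by
    simpa only [hg ha, hg hb, hg hc, hg hd] using h.not_cross a ha b hb c hc d hd

lemma NoncrossingOn.sub_const (h : NoncrossingOn G f A) (k : ℝ) :
    NoncrossingOn G (fun v => f v - k) A where
  injOn _ ha _ hb hab := h.injOn ha hb (sub_left_injective hab)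
  not_cross := by simpa only [sub_lt_sub_iff_right] using h.not_cross

lemma NoncrossingOn.const_sub (h : NoncrossingOn G f A) (k : ℝ) :
    NoncrossingOn G (fun v => k - f v) A where
  injOn _ ha _ hb hab := h.injOn ha hb (sub_right_injective hab)
  not_cross a ha b hb c hc d hd hab hbc hcd hac hbd :=
    h.not_cross d hd c hc b hb a ha ((sub_lt_sub_iff_left k).1 hcd) ((sub_lt_sub_iff_left k).1 hbc)
      ((sub_lt_sub_iff_left k).1 hab) hbd.symm hac.symm

/-- All edges from negative to positive vertices start at the first vertex `s`. Hence a crossing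
lies in `A₁`, or in `A₂`, or consists of an edge of `s` and an edge of `A₂`. -/
lemma NoncrossingOn.union (h₁ : NoncrossingOn G f A₁) (h₂ : NoncrossingOn G f A₂)
    (hA₁ : ∀ a ∈ A₁, f a ≤ 0) (hA₂ : ∀ a ∈ A₂, 0 ≤ f a)
    (h₀ : ∀ a ∈ A₁ ∪ A₂, f a = 0 → a ∈ A₁ ∩ A₂) (hs : ∀ a ∈ A₁ ∪ A₂, f s ≤ f a)
    (hcut : ∀ p ∈ A₁ \ A₂, ∀ u ∈ A₂ \ A₁, G.Adj p u → p = s)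
    (hcross : ∀ b ∈ A₂, ∀ c ∈ A₂ \ A₁, ∀ d ∈ A₂, s ∈ A₁ \ A₂ → f b < f c → f c < f d →
      G.Adj s c → ¬ G.Adj b d) : NoncrossingOn G f (A₁ ∪ A₂) := by
  have mem₁ (a) (ha : a ∈ A₁ ∪ A₂) (h : f a ≤ 0) : a ∈ A₁ := ha.elim id fun ha₂ =>
    (h₀ a ha (h.antisymm (hA₂ a ha₂))).1
  have mem₂ (a) (ha : a ∈ A₁ ∪ A₂) (h : 0 ≤ f a) : a ∈ A₂ := ha.elim (fun ha₁ =>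
    (h₀ a ha ((hA₁ a ha₁).antisymm h)).2) id
  have mem_neg (a) (ha : a ∈ A₁ ∪ A₂) (h : f a < 0) : a ∈ A₁ \ A₂ :=
    ⟨mem₁ a ha h.le, fun ha₂ => h.not_ge (hA₂ a ha₂)⟩
  have mem_pos (a) (ha : a ∈ A₁ ∪ A₂) (h : 0 < f a) : a ∈ A₂ \ A₁ :=
    ⟨mem₂ a ha h.le, fun ha₁ => h.not_ge (hA₁ a ha₁)⟩
  refine ⟨fun a ha b hb hab => ?_, fun a ha b hb c hc d hd hab hbc hcd hac hbd => ?_⟩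
  · obtain h | h := le_total (f a) 0
    · exact h₁.injOn (mem₁ a ha h) (mem₁ b hb (hab ▸ h)) hab
    · exact h₂.injOn (mem₂ a ha h) (mem₂ b hb (hab ▸ h)) hab
  obtain hd₀ | hd₀ := le_or_gt (f d) 0
  · exact h₁.not_cross a (mem₁ a ha (by linarith)) b (mem₁ b hb (by linarith)) c
      (mem₁ c hc (by linarith)) d (mem₁ d hd hd₀) hab hbc hcd hac hbd
  obtain ha₀ | ha₀ := le_or_gt 0 (f a)
  · exact h₂.not_cross a (mem₂ a ha ha₀) b (mem₂ b hb (by linarith)) c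
      (mem₂ c hc (by linarith)) d (mem₂ d hd hd₀.le) hab hbc hcd hac hbd
  have hb₀ : 0 ≤ f b := by
    by_contra! hb₀
    obtain rfl := hcut b (mem_neg b hb hb₀) d (mem_pos d hd hd₀) hbd
    exact hab.not_ge (hs a ha)
  have hc₀ := mem_pos c hc (hb₀.trans_lt hbc)
  obtain rfl := hcut a (mem_neg a ha ha₀) c hc₀ hac
  exact hcross b (mem₂ b hb hb₀) c hc₀ d (mem₂ d hd hd₀.le) (mem_neg a ha ha₀) hbc hcd hac hbd

lemma exists_eqOn_eqOn (h : Set.EqOn f₁ f₂ (A₁ ∩ A₂)) :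
    ∃ f, Set.EqOn f f₁ A₁ ∧ Set.EqOn f f₂ A₂ := by
  classical
  refine ⟨A₁.piecewise f₁ f₂, Set.piecewise_eqOn A₁ f₁ f₂, fun v hv => ?_⟩
  by_cases hv₁ : v ∈ A₁
  · rw [Set.piecewise_eq_of_mem _ _ _ hv₁, h ⟨hv₁, hv⟩]
  · rw [Set.piecewise_eq_of_notMem _ _ _ hv₁]

/-- There is a noncrossing order of `A` that starts at `s` and ends at `t`. -/
def HasOrderFromTo (G : SimpleGraph V) (A : Set V) (s t : V) : Prop :=
  s ∈ A ∧ t ∈ A ∧ ∃ f, NoncrossingOn G f A ∧ ∀ a ∈ A, f a ∈ Set.Icc (f s) (f t)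

lemma hasOrderFromTo_union (hs : s ∈ A₁) (ht : t ∈ A₂) (h₁ : NoncrossingOn G f₁ A₁)
    (h₂ : NoncrossingOn G f₂ A₂) (heq : Set.EqOn f₁ f₂ (A₁ ∩ A₂))
    (hA₁ : ∀ a ∈ A₁, f₁ a ∈ Set.Icc (f₁ s) 0) (hA₂ : ∀ a ∈ A₂, f₂ a ∈ Set.Icc 0 (f₂ t))
    (h₀₁ : ∀ a ∈ A₁, f₁ a = 0 → a ∈ A₂) (h₀₂ : ∀ a ∈ A₂, f₂ a = 0 → a ∈ A₁)
    (hcut : ∀ p ∈ A₁ \ A₂, ∀ u ∈ A₂ \ A₁, G.Adj p u → p = s ∧ u = t) :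
    HasOrderFromTo G (A₁ ∪ A₂) s t := by
  obtain ⟨f, hf₁, hf₂⟩ := exists_eqOn_eqOn heq
  have hA₁' (a) (ha : a ∈ A₁) : f a ∈ Set.Icc (f s) 0 := hf₁ hs ▸ hf₁ ha ▸ hA₁ a ha
  have hA₂' (a) (ha : a ∈ A₂) : f a ∈ Set.Icc 0 (f t) := hf₂ ht ▸ hf₂ ha ▸ hA₂ a ha
  have hIcc (a) (ha : a ∈ A₁ ∪ A₂) : f a ∈ Set.Icc (f s) (f t) := by
    obtain ha | ha := ha
    · exact ⟨(hA₁' a ha).1, (hA₁' a ha).2.trans (hA₂' t ht).1⟩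
    · exact ⟨(hA₁' s hs).2.trans (hA₂' a ha).1, (hA₂' a ha).2⟩
  refine ⟨.inl hs, .inr ht, f, (h₁.congr hf₁).union (h₂.congr hf₂) (fun a ha => (hA₁' a ha).2)
    (fun a ha => (hA₂' a ha).1) ?_ (fun a ha => (hIcc a ha).1)
    (fun p hp u hu hpu => (hcut p hp u hu hpu).1) ?_, hIcc⟩
  · rintro a (ha | ha) h
    exacts [⟨ha, h₀₁ a ha (hf₁ ha ▸ h)⟩, ⟨h₀₂ a ha (hf₂ ha ▸ h), ha⟩]
  · intro b _ c hc d hd hsA _ hcd hsc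
    obtain ⟨-, rfl⟩ := hcut s hsA c hc hsc
    exact absurd hcd (hA₂' d hd).2.not_gt

lemma hasOrderFromTo_of_disjoint [Finite V] (hs : s ∈ A₁) (ht : t ∈ A₂) (hd : Disjoint A₁ A₂)
    (h₁ : ∃ f, NoncrossingOn G f A₁) (h₂ : ∃ f, NoncrossingOn G f A₂)
    (hcut : ∀ p ∈ A₁, ∀ u ∈ A₂, G.Adj p u → p = s ∧ u = t) :
    HasOrderFromTo G (A₁ ∪ A₂) s t := by
  obtain ⟨f₁, h₁⟩ := h₁
  obtain ⟨f₁, h₁, hf₁⟩ := h₁.exists_rotate A₁.toFinite hs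
  obtain ⟨f₂, h₂⟩ := h₂
  obtain ⟨f₂, h₂, hf₂⟩ := h₂.exists_rotate A₂.toFinite ht
  obtain ⟨M₁, hM₁⟩ := exists_forall_abs_lt_of_finite A₁.toFinite f₁
  obtain ⟨M₂, hM₂⟩ := exists_forall_abs_lt_of_finite A₂.toFinite f₂
  have hneg (a) (ha : a ∈ A₁) : f₁ a - M₁ < 0 := sub_neg.2 (abs_lt.1 (hM₁ a ha)).2
  have hpos (a) (ha : a ∈ A₂) : 0 < M₂ - f₂ a := sub_pos.2 (abs_lt.1 (hM₂ a ha)).2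
  refine hasOrderFromTo_union hs ht (h₁.sub_const M₁) (h₂.const_sub M₂)
    (fun a ha => (Set.disjoint_left.1 hd ha.1 ha.2).elim)
    (fun a ha => ⟨sub_le_sub_right (hf₁ a ha) M₁, (hneg a ha).le⟩)
    (fun a ha => ⟨(hpos a ha).le, sub_le_sub_left (hf₂ a ha) M₂⟩)
    (fun a ha h => absurd h (hneg a ha).ne) (fun a ha h => absurd h (hpos a ha).ne')
    fun p hp u hu => hcut p hp.1 u hu.1

lemma HasOrderFromTo.trans (h₁ : HasOrderFromTo G A₁ s c) (h₂ : HasOrderFromTo G A₂ c t)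
    (hint : ∀ v ∈ A₁ ∩ A₂, v = c)
    (hcut : ∀ p ∈ A₁ \ A₂, ∀ u ∈ A₂ \ A₁, G.Adj p u → p = s ∧ u = t) :
    HasOrderFromTo G (A₁ ∪ A₂) s t := by
  obtain ⟨hs, hc₁, f₁, h₁, hf₁⟩ := h₁
  obtain ⟨hc₂, ht, f₂, h₂, hf₂⟩ := h₂
  refine hasOrderFromTo_union hs ht (h₁.sub_const (f₁ c)) (h₂.sub_const (f₂ c)) ?_
    (fun a ha => ⟨sub_le_sub_right (hf₁ a ha).1 _, sub_nonpos.2 (hf₁ a ha).2⟩)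
    (fun a ha => ⟨sub_nonneg.2 (hf₂ a ha).1, sub_le_sub_right (hf₂ a ha).2 _⟩)
    (fun a ha h => h₁.injOn ha hc₁ (sub_eq_zero.1 h) ▸ hc₂)
    (fun a ha h => h₂.injOn ha hc₂ (sub_eq_zero.1 h) ▸ hc₁) hcut
  intro a ha
  obtain rfl := hint a ha
  simp only [sub_self]

/-- The second order is reversed, which gives a cyclic order in which `A₁` and `A₂` occupy the two
arcs between `s` and `t`. -/
lemma HasOrderFromTo.exists_noncrossingOn_union (h₁ : HasOrderFromTo G A₁ s t)
    (h₂ : HasOrderFromTo G A₂ s t) (hst : s ≠ t) (hint : A₁ ∩ A₂ ⊆ {s, t})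
    (hcut : ∀ p ∈ A₁ \ A₂, ∀ u ∈ A₂ \ A₁, ¬ G.Adj p u) :
    ∃ f, NoncrossingOn G f (A₁ ∪ A₂) := by
  obtain ⟨hs₁, ht₁, f₁, h₁, hf₁⟩ := h₁
  obtain ⟨hs₂, ht₂, f₂, h₂, hf₂⟩ := h₂
  have hA : A₁ ∪ A₂ = A₁ ∪ A₂ \ {s} := by
    rw [← Set.union_eq_self_of_subset_right (Set.singleton_subset_iff.2 hs₁), Set.union_assoc,
      Set.union_assoc, Set.union_sdiff_self]
  have heq : Set.EqOn (fun v => f₁ v - f₁ t) (fun v => f₂ t - f₂ v) (A₁ ∩ (A₂ \ {s})) := by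
    rintro a ⟨ha₁, ha₂, has⟩
    obtain rfl := (hint ⟨ha₁, ha₂⟩).resolve_left has
    simp only [sub_self]
  obtain ⟨f, hf₁', hf₂'⟩ := exists_eqOn_eqOn heq
  have hneg (a) (ha : a ∈ A₁) : f a ≤ 0 := hf₁' ha ▸ sub_nonpos.2 (hf₁ a ha).2
  have hpos (a) (ha : a ∈ A₂ \ {s}) : 0 ≤ f a := hf₂' ha ▸ sub_nonneg.2 (hf₂ a ha.1).2
  refine ⟨f, hA ▸ ((h₁.sub_const (f₁ t)).congr hf₁').union (s := s)
    (((h₂.const_sub (f₂ t)).mono Set.sdiff_subset).congr hf₂') hneg hpos ?_ ?_ ?_ ?_⟩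
  · have ht : t ∈ A₁ ∩ (A₂ \ {s}) := ⟨ht₁, ht₂, hst.symm⟩
    rintro a (ha | ha) h
    · exact h₁.injOn ha ht₁ (sub_eq_zero.1 ((hf₁' ha).symm.trans h)) ▸ ht
    · exact h₂.injOn ha.1 ht₂ (sub_eq_zero.1 ((hf₂' ha).symm.trans h)).symm ▸ ht
  · rintro a (ha | ha)
    · exact hf₁' hs₁ ▸ hf₁' ha ▸ sub_le_sub_right (hf₁ a ha).1 _
    · exact (hneg s hs₁).trans (hpos a ha)
  · intro p hp u hu hpu
    by_contra hps
    exact hcut p ⟨hp.1, fun hp₂ => hp.2 ⟨hp₂, hps⟩⟩ u ⟨hu.1.1, hu.2⟩ hpu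
  · intro b hb c hc d hd _ hbc hcd hsc hbd
    rw [hf₂' hb, hf₂' hc.1, sub_lt_sub_iff_left] at hbc
    rw [hf₂' hc.1, hf₂' hd, sub_lt_sub_iff_left] at hcd
    have hsd : f₂ s < f₂ d := (hf₂ d hd.1).1.lt_of_ne fun e => hd.2 (h₂.injOn hs₂ hd.1 e).symm
    exact h₂.not_cross s hs₂ d hd.1 c hc.1.1 b hb.1 hsd hcd hbc hsc hbd.symm

end Glue

/-! ### Graphs without the two excluded minors -/

section Excluded

variable {V : Type*} {G H : SimpleGraph V} {A B C X Y : Set V} {c s t x : V}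

/-- `s` and `t` are connected through vertices outside `A`. -/
def LinkedOutside (G : SimpleGraph V) (A : Set V) (s t : V) : Prop :=
  ∃ Z, Joins G (G.neighborSet s) (G.neighborSet t) Z ∧ Disjoint Z A

lemma LinkedOutside.symm (h : LinkedOutside G A s t) : LinkedOutside G A t s := by
  obtain ⟨Z, hZ, hZA⟩ := h
  exact ⟨Z, hZ.symm, hZA⟩

/-- The statement about vertex sets that is proved by induction. The connection outside `A` makes
`s t` behave like an edge, so that `s` and `t` can be chosen as consecutive vertices of a cyclic
order. -/
def HasNoncrossingOrders (G : SimpleGraph V) (A : Set V) : Prop :=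
  (∃ f, NoncrossingOn G f A) ∧
    ∀ s ∈ A, ∀ t ∈ A, s ≠ t → LinkedOutside G A s t → HasOrderFromTo G A s t

lemma linkedOutside_of_touches (hlink : G.Adj s t ∨ LinkedOutside G A s t) (hBA : B ⊆ A)
    (hC : (G.induce C).Connected) (ht : t ∈ C) (hcC : Touches G C {c}) (hCB : Disjoint C B) :
    LinkedOutside G B s c := by
  obtain hst | ⟨Z, hZ, hZA⟩ := hlink
  · exact ⟨C, ⟨hC, ⟨t, ht, hst⟩, hcC.inter_neighborSet_nonempty⟩, hCB⟩
  · obtain ⟨z, hz, htz⟩ := hZ.meets_right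
    exact ⟨C ∪ Z, ⟨Touches.connected_induce_union ⟨t, ht, z, hz, htz⟩ hC hZ.connected,
      hZ.meets_left.mono (Set.inter_subset_inter_left _ Set.subset_union_right),
      hcC.inter_neighborSet_nonempty.mono (Set.inter_subset_inter_left _ Set.subset_union_left)⟩,
      hCB.union_left (hZA.mono_right hBA)⟩

lemma eq_and_eq_of_adj_of_notMem_component
    (hHG : ∀ u v, G.Adj u v → H.Adj u v ∨ s(u, v) = s(s, t)) (ht : t ∉ component H A s)
    {p u : V} (hp : p ∈ component H A s) (huA : u ∈ A) (hu : u ∉ component H A s)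
    (hpu : G.Adj p u) : p = s ∧ u = t := by
  obtain h | h := hHG p u hpu
  · exact absurd (mem_component_of_adj hp huA h) hu
  · obtain h | ⟨rfl, -⟩ := Sym2.eq_iff.1 h
    exacts [h, absurd hp ht]

lemma hasOrderFromTo_of_notMem_component [Finite V] (hs : s ∈ A) (ht : t ∈ A)
    (hHG : ∀ u v, G.Adj u v → H.Adj u v ∨ s(u, v) = s(s, t)) (htC : t ∉ component H A s)
    (ih : ∀ B < A, HasNoncrossingOrders G B) : HasOrderFromTo G A s t := by
  have hsC := mem_component_self (G := H) hs
  rw [← Set.union_sdiff_cancel (component_subset (G := H) (A := A) (s := s))]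
  exact hasOrderFromTo_of_disjoint hsC ⟨ht, htC⟩ Set.disjoint_sdiff_right
    (ih _ (component_subset.ssubset_of_mem_notMem ht htC)).1
    (ih _ (Set.sdiff_subset.ssubset_of_mem_notMem hs fun h => h.2 hsC)).1
    fun p hp u hu => eq_and_eq_of_adj_of_notMem_component hHG htC hp hu.1 hu.2

lemma linkedOutside_of_cut_vertex (hle : H ≤ G) (hct : c ≠ t) (ht : t ∈ component H A s)
    (hsc : s ∉ component H (A \ {c}) t) (hlink : G.Adj s t ∨ LinkedOutside G A s t) (hBA : B ⊆ A)
    (hB : Disjoint (component H (A \ {c}) t) B) : LinkedOutside G B s c := by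
  have hs := mem_of_mem_component ht
  have ht' : t ∈ A \ {c} := ⟨component_subset ht, hct.symm⟩
  obtain ⟨x, hx, y, hy, hxy⟩ := touches_component_sdiff_singleton (connected_induce_component hs)
    component_subset ht hct.symm (mem_component_self hs) hsc
  exact linkedOutside_of_touches hlink hBA (connected_induce_of_le hle
    (connected_induce_component ht')) (mem_component_self ht') ⟨x, hx, y, hy, hle hxy⟩ hB

/-- The component of `s` in `A \ {c}` has an order from `s` to `c`, the rest of `A` has an order
from `c` to `t`. -/
lemma hasOrderFromTo_of_cut_vertex (hle : H ≤ G)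
    (hHG : ∀ u v, G.Adj u v → H.Adj u v ∨ s(u, v) = s(s, t)) (hc : c ∈ A) (hcs : c ≠ s)
    (hct : c ≠ t) (ht : t ∈ component H A s) (htc : t ∉ component H (A \ {c}) s)
    (hlink : G.Adj s t ∨ LinkedOutside G A s t) (ih : ∀ B < A, HasNoncrossingOrders G B) :
    HasOrderFromTo G A s t := by
  have htA := component_subset ht
  have hsA := mem_of_mem_component ht
  set C := component H (A \ {c}) s
  have hCA : C ⊆ A := component_subset.trans Set.sdiff_subset
  have hsC : s ∈ C := mem_component_self ⟨hsA, hcs.symm⟩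
  have hcC (v) : c ∉ component H (A \ {c}) v := fun h => (component_subset h).2 rfl
  have hA₁ : insert c C ⊆ A := Set.insert_subset hc hCA
  have htA₁ : t ∉ insert c C := by
    rintro (h | h)
    exacts [hct h.symm, htc h]
  have o₁ : HasOrderFromTo G (insert c C) s c :=
    (ih _ (hA₁.ssubset_of_mem_notMem htA htA₁)).2 s (.inr hsC) c (.inl rfl) hcs.symm <|
      linkedOutside_of_cut_vertex hle hct ht (fun h => htc (mem_component_comm.1 h)) hlink hA₁
        (Set.disjoint_insert_right.2 ⟨hcC t, (disjoint_component htc).symm⟩)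
  have o₂ : HasOrderFromTo G (A \ C) c t :=
    (ih _ (Set.sdiff_subset.ssubset_of_mem_notMem hsA fun h => h.2 hsC)).2 c ⟨hc, hcC s⟩ t
      ⟨htA, htc⟩ hct <| LinkedOutside.symm <|
      linkedOutside_of_cut_vertex hle hcs (mem_component_comm.1 ht) htc
        (hlink.imp SimpleGraph.Adj.symm LinkedOutside.symm) Set.sdiff_subset
        Set.disjoint_sdiff_right
  have hA : insert c C ∪ A \ C = A := by
    rw [Set.insert_union, Set.union_sdiff_cancel hCA, Set.insert_eq_of_mem hc]
  rw [← hA]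
  refine o₁.trans o₂ ?_ ?_
  · rintro v ⟨rfl | hv, hv'⟩
    exacts [rfl, absurd hv hv'.2]
  · rintro p ⟨rfl | hp, hp'⟩ u ⟨hu, hu'⟩ hpu
    · exact absurd ⟨hc, hcC s⟩ hp'
    · exact eq_and_eq_of_adj_of_notMem_component hHG htc hp
        ⟨hu.1, fun h => hu' (.inl h)⟩ hu.2 hpu

lemma Joins.neighborSet_of_le (h : Joins H (H.neighborSet s) (H.neighborSet t) X) (hle : H ≤ G) :
    Joins G (G.neighborSet s) (G.neighborSet t) X where
  connected := connected_induce_of_le hle h.connected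
  meets_left := h.meets_left.mono (Set.inter_subset_inter_right X fun _ h => hle h)
  meets_right := h.meets_right.mono (Set.inter_subset_inter_right X fun _ h => hle h)

lemma hasOrderFromTo_or_exists_disjoint_joins [Finite V] (hs : s ∈ A) (ht : t ∈ A) (hst : s ≠ t)
    (hlink : G.Adj s t ∨ LinkedOutside G A s t) (ih : ∀ B < A, HasNoncrossingOrders G B) :
    HasOrderFromTo G A s t ∨ ∃ X ⊆ A \ {s, t}, ∃ Y ⊆ A \ {s, t},
      Joins G (G.neighborSet s) (G.neighborSet t) X ∧
      Joins G (G.neighborSet s) (G.neighborSet t) Y ∧ Disjoint X Y := by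
  set H := G.deleteEdges {s(s, t)}
  have hle : H ≤ G := SimpleGraph.deleteEdges_le _
  have hHG (u v) (huv : G.Adj u v) : H.Adj u v ∨ s(u, v) = s(s, t) :=
    adj_deleteEdges_singleton_or _ huv
  have hadj : ¬ H.Adj s t := fun h => (SimpleGraph.deleteEdges_adj.1 h).2 rfl
  by_cases hconn : t ∈ component H A s
  swap
  · exact .inl (hasOrderFromTo_of_notMem_component hs ht hHG hconn ih)
  by_cases! hcut : ∀ c ∈ A, c ≠ s → c ≠ t → t ∈ component H (A \ {c}) s
  · obtain ⟨X, hXA, Y, hYA, hX, hY, hXY⟩ := exists_disjoint_joins_neighborSet hst hadj hconn hcut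
    exact .inr ⟨X, hXA, Y, hYA, hX.neighborSet_of_le hle, hY.neighborSet_of_le hle, hXY⟩
  · obtain ⟨c, hc, hcs, hct, htc⟩ := hcut
    exact .inl (hasOrderFromTo_of_cut_vertex hle hHG hc hcs hct hconn htc hlink ih)

lemma exists_noncrossingOn_of_edgeless [Countable V] (hA : ∀ a ∈ A, ∀ b ∈ A, ¬ G.Adj a b) :
    ∃ f, NoncrossingOn G f A := by
  obtain ⟨f, hf⟩ := exists_injective_nat V
  exact ⟨fun v => (f v : ℝ), (Nat.cast_injective.comp hf).injOn,
    fun a ha _ _ c hc _ _ _ _ _ hac => absurd hac (hA a ha c hc)⟩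

lemma exists_noncrossingOn_of_disjoint_component (hst : s ≠ t) (hs : s ∈ A) (ht : t ∈ A)
    (hXA : X ⊆ A \ {s, t}) (hYA : Y ⊆ A \ {s, t})
    (hX : Joins G (G.neighborSet s) (G.neighborSet t) X)
    (hY : Joins G (G.neighborSet s) (G.neighborSet t) Y) (hx : x ∈ X)
    (hYx : Disjoint Y (component G (A \ {s, t}) x)) (ih : ∀ B < A, HasNoncrossingOrders G B) :
    ∃ f, NoncrossingOn G f A := by
  obtain ⟨y, hy, -⟩ := hY.meets_left
  have hxD := mem_component_self (G := G) (hXA hx)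
  have hXD := subset_component hX.connected hXA hx hxD
  set D := component G (A \ {s, t}) x
  have hDA : D ⊆ A \ {s, t} := component_subset
  have hsD : s ∉ D := fun h => (hDA h).2 (.inl rfl)
  have htD : t ∉ D := fun h => (hDA h).2 (.inr rfl)
  have hA₁ : D ∪ {s, t} ⊆ A :=
    Set.union_subset (hDA.trans Set.sdiff_subset) (Set.pair_subset hs ht)
  have hYA₁ : Disjoint Y (D ∪ {s, t}) :=
    Set.disjoint_union_right.2 ⟨hYx, Set.disjoint_left.2 fun v hv => (hYA hv).2⟩
  have o₁ : HasOrderFromTo G (D ∪ {s, t}) s t :=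
    (ih _ (hA₁.ssubset_of_mem_notMem (hYA hy).1 (Set.disjoint_left.1 hYA₁ hy))).2
      s (.inr (.inl rfl)) t (.inr (.inr rfl)) hst ⟨Y, hY, hYA₁⟩
  have o₂ : HasOrderFromTo G (A \ D) s t :=
    (ih _ (Set.sdiff_subset.ssubset_of_mem_notMem (hXA hx).1 fun h => h.2 hxD)).2
      s ⟨hs, hsD⟩ t ⟨ht, htD⟩ hst ⟨X, hX, Set.disjoint_sdiff_right.mono_left hXD⟩
  have hA : D ∪ {s, t} ∪ A \ D = A := by
    rw [Set.union_right_comm, Set.union_sdiff_cancel (hDA.trans Set.sdiff_subset),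
      Set.union_eq_self_of_subset_right (Set.pair_subset hs ht)]
  rw [← hA]
  refine o₁.exists_noncrossingOn_union o₂ hst ?_ ?_
  · rintro v ⟨hv | hv, hv'⟩
    exacts [absurd hv hv'.2, hv]
  · rintro p ⟨hp | hp, hp'⟩ u ⟨hu, hu'⟩ hpu
    · exact hu.2 (mem_component_of_adj hp ⟨hu.1, fun h => hu' (.inr h)⟩ hpu)
    · exact hp' ⟨hA₁ (.inr hp), fun h => (hDA h).2 hp⟩

end Excluded

section ExcludedMinors

variable {V : Type u} {G : SimpleGraph V} {A X Y Z : Set V} {s t x : V}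

lemma subset_compl_pair_iff : X ⊆ {s, t}ᶜ ↔ Disjoint {s} X ∧ Disjoint {t} X := by
  simp only [Set.subset_compl_iff_disjoint_left, Set.disjoint_insert_left,
    Set.disjoint_singleton_left]

lemma isMinor_completeFour_of_joins (hst : G.Adj s t) (hXA : X ⊆ A \ {s, t})
    (hYA : Y ⊆ A \ {s, t}) (hX : Joins G (G.neighborSet s) (G.neighborSet t) X)
    (hY : Joins G (G.neighborSet s) (G.neighborSet t) Y) (hXY : Disjoint X Y) (hx : x ∈ X)
    (hYx : ¬ Disjoint Y (component G (A \ {s, t}) x)) :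
    IsMinor (⊤ : SimpleGraph (ULift.{u} (Fin 4))) G := by
  obtain ⟨y, hyY, hyx⟩ := Set.not_disjoint_iff.1 hYx
  have hxY : x ∈ (A \ {s, t}) \ Y := ⟨hXA hx, Set.disjoint_left.1 hXY hx⟩
  set X' := component G ((A \ {s, t}) \ Y) x
  have hXX' : X ⊆ X' := subset_component hX.connected (Set.subset_sdiff.2 ⟨hXA, hXY⟩) hx
    (mem_component_self hxY)
  have hX'A : X' ⊆ (A \ {s, t}) \ Y := component_subset
  have hsX' : Joins G (G.neighborSet s) (G.neighborSet t) X' :=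
    ⟨connected_induce_component hxY, hX.meets_left.mono (Set.inter_subset_inter_left _ hXX'),
      hX.meets_right.mono (Set.inter_subset_inter_left _ hXX')⟩
  have touches : Touches G X' Y := by
    obtain ⟨a, -, b, hb, hab, ha, hb'⟩ := exists_adj_of_connected_induce
      (connected_induce_component (G := G) (hXA hx)) (mem_component_self (hXA hx))
      (mem_component_self hxY) hyx fun h => (hX'A h).2 hyY
    refine ⟨a, ha, b, ?_, hab⟩
    by_contra hbY
    exact hb' (mem_component_of_adj ha ⟨component_subset hb, hbY⟩ hab)
  obtain ⟨hsX, htX⟩ := subset_compl_pair_iff.1 fun v hv => (hX'A hv).1.2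
  obtain ⟨hsY, htY⟩ := subset_compl_pair_iff.1 fun v hv => (hYA hv).2
  exact isMinor_completeFour .of_subsingleton .of_subsingleton hsX'.connected hY.connected
    (Set.disjoint_singleton.2 hst.ne) hsX hsY htX htY
    (Set.disjoint_left.2 fun v hv => (hX'A hv).2) ⟨s, rfl, t, rfl, hst⟩ hsX'.touches_left
    hY.touches_left hsX'.symm.touches_left hY.symm.touches_left touches

lemma isMinor_completeBipartiteTwoThree_of_joins (hst : s ≠ t) (hXst : X ⊆ {s, t}ᶜ)
    (hYst : Y ⊆ {s, t}ᶜ) (hZst : Z ⊆ {s, t}ᶜ)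
    (hX : Joins G (G.neighborSet s) (G.neighborSet t) X)
    (hY : Joins G (G.neighborSet s) (G.neighborSet t) Y)
    (hZ : Joins G (G.neighborSet s) (G.neighborSet t) Z) (hXY : Disjoint X Y)
    (hXZ : Disjoint X Z) (hYZ : Disjoint Y Z) :
    IsMinor (completeBipartiteGraph (ULift.{u} (Fin 2)) (ULift.{u} (Fin 3))) G := by
  rw [subset_compl_pair_iff] at hXst hYst hZst
  exact isMinor_completeBipartiteTwoThree .of_subsingleton .of_subsingleton hX.connected
    hY.connected hZ.connected (Set.disjoint_singleton.2 hst) hXst.1 hYst.1 hZst.1 hXst.2 hYst.2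
    hZst.2 hXY hXZ hYZ hX.touches_left hY.touches_left hZ.touches_left hX.symm.touches_left
    hY.symm.touches_left hZ.symm.touches_left

theorem hasNoncrossingOrders_of_not_isMinor [Finite V]
    (h4 : ¬ IsMinor (⊤ : SimpleGraph (ULift.{u} (Fin 4))) G)
    (h23 : ¬ IsMinor (completeBipartiteGraph (ULift.{u} (Fin 2)) (ULift.{u} (Fin 3))) G)
    (A : Set V) : HasNoncrossingOrders G A := by
  induction A using WellFoundedLT.induction with
  | ind A ih =>
  refine ⟨?_, fun s hs t ht hst hlink => ?_⟩
  · by_cases! hedge : ∀ s ∈ A, ∀ t ∈ A, ¬ G.Adj s t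
    · exact exists_noncrossingOn_of_edgeless hedge
    obtain ⟨s, hs, t, ht, hst⟩ := hedge
    obtain ⟨-, -, f, hf, -⟩ | ⟨X, hXA, Y, hYA, hX, hY, hXY⟩ :=
      hasOrderFromTo_or_exists_disjoint_joins hs ht hst.ne (.inl hst) ih
    · exact ⟨f, hf⟩
    obtain ⟨x, hx, -⟩ := hX.meets_left
    refine exists_noncrossingOn_of_disjoint_component hst.ne hs ht hXA hYA hX hY hx ?_ ih
    by_contra hYx
    exact h4 (isMinor_completeFour_of_joins hst hXA hYA hX hY hXY hx hYx)
  · refine (hasOrderFromTo_or_exists_disjoint_joins hs ht hst (.inr hlink) ih).resolve_right ?_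
    rintro ⟨X, hXA, Y, hYA, hX, hY, hXY⟩
    obtain ⟨Z, hZ, hZA⟩ := hlink
    exact h23 (isMinor_completeBipartiteTwoThree_of_joins hst (fun v hv => (hXA hv).2)
      (fun v hv => (hYA hv).2)
      (Set.subset_compl_iff_disjoint_left.2 (hZA.symm.mono_left (Set.pair_subset hs ht)))
      hX hY hZ hXY (hZA.symm.mono_left (hXA.trans Set.sdiff_subset))
      (hZA.symm.mono_left (hYA.trans Set.sdiff_subset)))

end ExcludedMinors

end MarkovSlim

theorem mainTheorem9 (K : Type v) [Field K] :
    IsGreatest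
      {𝒞 : Set MarkovSlim.FinGraph.{u} |
        MarkovSlim.MinorClosed 𝒞 ∧ ∀ G ∈ 𝒞, MarkovSlim.IsMarkovSlim K G.graph}
      {G : MarkovSlim.FinGraph.{u} | MarkovSlim.IsOuterplanar G.graph} := by
  refine ⟨⟨fun G H hHG hG => MarkovSlim.IsOuterplanar.of_isMinor hG hHG, fun G hG => ?_⟩, ?_⟩
  · have := G.finite_V
    obtain ⟨f, hf⟩ := MarkovSlim.isOuterplanar_iff.1 hG
    exact MarkovSlim.isMarkovSlim_of_noncrossingOn K hf
  · rintro 𝒞 ⟨hminor, hslim⟩ G hG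
    have := G.finite_V
    have h4 : ¬ MarkovSlim.IsMinor (⊤ : SimpleGraph (ULift.{u} (Fin 4))) G.graph := fun h =>
      MarkovSlim.not_isMarkovSlim_completeFour K (hslim _ (hminor G ⟨_, inferInstance, _⟩ h hG))
    have h23 : ¬ MarkovSlim.IsMinor
        (completeBipartiteGraph (ULift.{u} (Fin 2)) (ULift.{u} (Fin 3))) G.graph := fun h =>
      MarkovSlim.not_isMarkovSlim_completeBipartiteTwoThree K
        (hslim _ (hminor G ⟨_, inferInstance, _⟩ h hG))
    exact MarkovSlim.isOuterplanar_iff.2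
      (MarkovSlim.hasNoncrossingOrders_of_not_isMinor h4 h23 Set.univ).1
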